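/- Let $k$ be a field, $n\ge 0$ an integer, $A_1,\dots,A_n$ unital associative $k$-algebras and, for $1\le i<j\le n$, let ${}_jM_i$ be an $A_j$-$A_i$-bimodule on which $k$ acts centrally, together with $k$-bilinear products $\mu_{l,j,i}:{}_lM_j\times{}_jM_i\to{}_lM_i$ for $i<j<l$ that are $A_l$-linear on the left, $A_i$-linear on the right, $A_j$-balanced, and associative. Let $\mathcal T$ be the resulting algebra of lower triangular matrices, with diagonal entries in the $A_i$ and $(j,i)$ entries in ${}_jM_i$; let $e_1,\dots,e_n$ be its diagonal idempotents, $R=\bigoplus_i k e_i$, let $X$ be a $\mathcal T$-bimodule (with $k$ acting centrally), and put ${}_jX_i=e_jXe_i$. In what follows ${}_jM_i$ is regarded as contained in $\mathcal T$ and $A_j=e_j\mathcal Te_j$. Consider the relative Hochschild complex $\mathcal H^m=\mathrm{Hom}_{R-R}(\mathcal T^{\otimes_R m},X)$ (with $\mathcal H^0=X^R=\{x: rx=xr \text{ for all } r\in R\}$) with the differential $$\delta f(t_1,\dots,t_{m+1})=t_1f(t_2,\dots,t_{m+1})+\sum_{s=1}^{m}(-1)^sf(t_1,\dots,t_st_{s+1},\dots,t_{m+1})+(-1)^{m+1}f(t_1,\dots,t_m)t_{m+1}.$$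 The bimodule $\mathcal T^{\otimes_R m}$ is the direct sum, over the sequences $v_0\ge v_1\ge\dots\ge v_m$ in $\{1,\dots,n\}$, of $\bigotimes_{s=1}^m e_{v_{s-1}}\mathcal Te_{v_s}$ (tensor products over $k$); the length of a sequence is the number of $s$ with $v_{s-1}\ne v_s$. Let $F^t\mathcal H^m$ be the space of the cochains that vanish on all summands of length $<t$, and let $(E_r^{t,l},d_r)$ be the spectral sequence of this filtration, where $l$ is the complementary degree and $d_1^{t,l}:E_1^{t,l}\to E_1^{t+1,l}$. Let $l\ge0$. Then: (a) restriction of cochains to $A_j^{\otimes l}$, for $j=1,\dots,n$, induces an isomorphism $E_1^{0,l}\cong\bigoplus_{j=1}^n HH^l(A_j,{}_jX_j)$; (b) restriction of cochains of degree $l+1$ to $A_j^{\otimes q}\otimes{}_jM_i\otimes A_i^{\otimes p}$, $q+p=l$, regarded as cochains on the two-sided bar resolution of ${}_jM_i$, induces an isomorphism $E_1^{1,l}\cong\bigoplus_{i<j}\mathrm{Ext}^l_{A_j-A_i}({}_jM_i,{}_jX_i)$; (c) for $i<j$, and for Hochschild cocycles $f$ of degree $l$ of $A_i$ with values in ${}_iX_i$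 and $g$ of degree $l$ of $A_j$ with values in ${}_jX_j$, the cochains $$1_{{}_jM_i}\smallsmile f:\ m\otimes a_1\otimes\dots\otimes a_l\mapsto m\,f(a_1,\dots,a_l),\qquad g\smallsmile 1_{{}_jM_i}:\ b_1\otimes\dots\otimes b_l\otimes m\mapsto g(b_1,\dots,b_l)\,m$$ (extended by zero to the other components $A_j^{\otimes q}\otimes{}_jM_i\otimes A_i^{\otimes p}$, $q+p=l$) are cocycles on the bar resolution and induce linear maps $HH^l(A_i,{}_iX_i)\to\mathrm{Ext}^l({}_jM_i,{}_jX_i)$ and $HH^l(A_j,{}_jX_j)\to\mathrm{Ext}^l({}_jM_i,{}_jX_i)$, written again $f\mapsto1_{{}_jM_i}\smallsmile f$ and $g\mapsto g\smallsmile1_{{}_jM_i}$; (d) under the isomorphisms (a) and (b), the differential $$d_1^{0,l}:\bigoplus_{j=1}^nHH^l(A_j,{}_jX_j)\longrightarrow\bigoplus_{1\le i<j\le n}\mathrm{Ext}^l_{A_j-A_i}({}_jM_i,{}_jX_i)$$ is given by $$d_1^{0,l}(f_1+\dots+f_n)=\sum_{j=1}^n\Big\{\sum_{\beta=1}^{n-j}1_{{}_{j+\beta}M_j}\smallsmile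 f_j+(-1)^{l+1}\sum_{\beta=1}^{j-1}f_j\smallsmile1_{{}_jM_{j-\beta}}\Big\}.$$ -/

import Mathlib

open scoped TensorProduct DirectSum
open MulOpposite CategoryTheory

universe u

namespace Hochschild

section

variable {α : Type*}

theorem contractNth_update {k A : Type*} [CommRing k] [Ring A] [Algebra k A] {m : ℕ}
    (j : Fin m) (t : Fin (m + 1) → A) (i : Fin (m + 1)) :
    ∃ (s : Fin m) (g : A →ₗ[k] A), ∀ x : A,
      Fin.contractNth j.castSucc (· * ·) (Function.update t i x) =
        Function.update (Fin.contractNth j.castSucc (· * ·) t) s (g x) := by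
  rcases lt_trichotomy (i : ℕ) j with h | h | h
  · refine ⟨⟨i, by omega⟩, LinearMap.id, fun x => ?_⟩
    ext r
    simp only [Fin.contractNth, Function.update_apply, Fin.ext_iff, Fin.val_castSucc, Fin.val_succ, LinearMap.id_apply]
    split_ifs <;> first | rfl | omega
  · refine ⟨j, LinearMap.mulRight k (t j.succ), fun x => ?_⟩
    ext r
    simp only [Fin.contractNth, Function.update_apply, Fin.ext_iff, Fin.val_castSucc, Fin.val_succ, LinearMap.mulRight_apply]
    split_ifs with h1 h2 h3 h4 <;> first | rfl | omega | skip
    all_goals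
      have : r = j := Fin.ext (by omega)
      subst this; rfl
  · by_cases h' : (i : ℕ) = j + 1
    · refine ⟨j, LinearMap.mulLeft k (t j.castSucc), fun x => ?_⟩
      ext r
      simp only [Fin.contractNth, Function.update_apply, Fin.ext_iff, Fin.val_castSucc, Fin.val_succ, LinearMap.mulLeft_apply]
      split_ifs with h1 h2 h3 h4 <;> first | rfl | omega | skip
      all_goals
        have : r = j := Fin.ext (by omega)
        subst this; rfl
    · refine ⟨⟨i - 1, by omega⟩, LinearMap.id, fun x => ?_⟩
      ext r
      simp only [Fin.contractNth, Function.update_apply, Fin.ext_iff, Fin.val_castSucc, Fin.val_succ, LinearMap.id_apply]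
      split_ifs <;> first | rfl | omega

theorem contractNth_contractNth {A : Type*} [Semigroup A] {m : ℕ} (t : Fin (m + 2) → A)
    (i j : Fin m) (h : i ≤ j) :
    Fin.contractNth i.castSucc (· * ·) (Fin.contractNth j.succ.castSucc (· * ·) t) =
      Fin.contractNth j.castSucc (· * ·) (Fin.contractNth i.castSucc.castSucc (· * ·) t) := by
  have h : (i : ℕ) ≤ j := h
  ext r
  simp only [Fin.contractNth, Fin.val_castSucc, Fin.val_succ]
  split_ifs <;> first | rfl | omega | skip
  simp [mul_assoc]

end

variable {k : Type*} [CommRing k] {A : Type*} [Ring A] [Algebra k A]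
  {X : Type*} [AddCommGroup X] [Module k X] [Module A X] [Module Aᵐᵒᵖ X]
  [SMulCommClass A Aᵐᵒᵖ X] [IsScalarTower k A X] [IsScalarTower k Aᵐᵒᵖ X]

theorem sum_contract_contract {G : Type*} [AddCommGroup G] {A : Type*} [Semigroup A] {m : ℕ}
    (g : (Fin m → A) → G) (t : Fin (m + 2) → A) :
    ∑ i : Fin (m + 1), ∑ j : Fin m, ((-1 : ℤ) ^ (i + j : ℕ)) •
      g (Fin.contractNth j.castSucc (· * ·) (Fin.contractNth i.castSucc (· * ·) t)) = 0 := by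
  rw [← Fintype.sum_prod_type', ← Finset.sum_filter_add_sum_filter_not Finset.univ
    (fun p : Fin (m + 1) × Fin m => (p.1 : ℕ) ≤ p.2), add_comm, add_eq_zero_iff_eq_neg,
    ← Finset.sum_neg_distrib]
  refine Finset.sum_bij' (fun p hp => (⟨p.2, by omega⟩, ⟨p.1 - 1, by
      simp at hp; omega⟩)) (fun p hp => (p.2.succ, ⟨p.1, by
      simp at hp; omega⟩)) ?_ ?_ ?_ ?_ ?_
  · rintro ⟨i, j⟩ hp; simp at hp ⊢; omega
  · rintro ⟨i, j⟩ hp; simp at hp ⊢; omega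
  · rintro ⟨i, j⟩ hp
    simp at hp ⊢
    ext; simp; omega
  · rintro ⟨i, j⟩ hp; simp
  · rintro ⟨i, j⟩ hp
    simp at hp
    obtain ⟨i, rfl⟩ : ∃ i' : Fin m, i = i'.succ := ⟨⟨i - 1, by omega⟩, by ext; simp; omega⟩
    have hp : (j : ℕ) ≤ i := by simp at hp; omega
    have := contractNth_contractNth t j i hp
    simp only [Fin.val_succ, add_tsub_cancel_right]
    rw [this, show (i + 1 + j : ℕ) = (j + i : ℕ) + 1 by ring, pow_succ]
    simp
    rfl


variable (k A X) in
/-- Hochschild `m`-cochains `Hom_k (A^{⊗ m}, X)`. -/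
abbrev Cochain (m : ℕ) : Type _ := MultilinearMap k (fun _ : Fin m => A) X

/-- `(t₁, …, t_{m+1}) ↦ t₁ f(t₂, …, t_{m+1})`. -/
def headFace {m : ℕ} (f : Cochain k A X m) : Cochain k A X (m + 1) where
  toFun t := t 0 • f (Fin.tail t)
  map_update_add' t i x y := by
    rename_i inst
    obtain rfl : inst = instDecidableEqFin _ := Subsingleton.elim _ _
    cases i using Fin.cases with
    | zero => simp [add_smul]
    | succ i => simp [Fin.tail_update_succ, (Fin.succ_ne_zero i).symm]
  map_update_smul' t i c x := by
    rename_i inst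
    obtain rfl : inst = instDecidableEqFin _ := Subsingleton.elim _ _
    cases i using Fin.cases with
    | zero => simp [smul_assoc]
    | succ i => simp [Fin.tail_update_succ, (Fin.succ_ne_zero i).symm, smul_comm (t 0) c]

/-- `(t₁, …, t_{m+1}) ↦ f(t₁, …, t_m) t_{m+1}`. -/
def lastFace {m : ℕ} (f : Cochain k A X m) : Cochain k A X (m + 1) where
  toFun t := op (t (Fin.last m)) • f (Fin.init t)
  map_update_add' t i x y := by
    rename_i inst
    obtain rfl : inst = instDecidableEqFin _ := Subsingleton.elim _ _
    cases i using Fin.lastCases with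
    | last => simp [add_smul]
    | cast i => simp [Fin.init_update_castSucc, (Fin.castSucc_lt_last i).ne']
  map_update_smul' t i c x := by
    rename_i inst
    obtain rfl : inst = instDecidableEqFin _ := Subsingleton.elim _ _
    cases i using Fin.lastCases with
    | last => simp [smul_assoc]
    | cast i => simp [Fin.init_update_castSucc, (Fin.castSucc_lt_last i).ne', smul_comm (op (t (Fin.last m))) c]

/-- `(t₁, …, t_{m+1}) ↦ f(t₁, …, tⱼ tⱼ₊₁, …, t_{m+1})`, the index `j` counted from `0`. -/
def midFace {m : ℕ} (j : Fin m) (f : Cochain k A X m) : Cochain k A X (m + 1) where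
  toFun t := f (Fin.contractNth j.castSucc (· * ·) t)
  map_update_add' t i x y := by
    rename_i inst
    obtain rfl : inst = instDecidableEqFin _ := Subsingleton.elim _ _
    obtain ⟨s, g, h⟩ := contractNth_update (k := k) j t i
    simp [h]
  map_update_smul' t i c x := by
    rename_i inst
    obtain rfl : inst = instDecidableEqFin _ := Subsingleton.elim _ _
    obtain ⟨s, g, h⟩ := contractNth_update (k := k) j t i
    simp [h]

variable (k A X) in
/-- The Hochschild coboundary
`δf(t₁, …, t_{m+1}) = t₁ f(t₂, …) + ∑_{1 ≤ i ≤ m} (-1)^i f(…, tᵢ tᵢ₊₁, …) + (-1)^{m+1} f(t₁, …, t_m) t_{m+1}`.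
-/
def coboundary (m : ℕ) : Cochain k A X m →ₗ[k] Cochain k A X (m + 1) where
  toFun f := headFace f + ∑ i : Fin m, ((-1 : k) ^ (i + 1 : ℕ)) • midFace i f
    + ((-1 : k) ^ (m + 1)) • lastFace f
  map_add' f g := by
    ext t
    simp only [headFace, midFace, lastFace, add_apply, sum_apply,
      smul_apply, MultilinearMap.coe_mk, smul_add, Finset.sum_add_distrib]
    abel
  map_smul' c f := by
    ext t
    simp only [headFace, midFace, lastFace, add_apply, sum_apply,
      smul_apply, MultilinearMap.coe_mk, smul_add, Finset.smul_sum, RingHom.id_apply,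
      smul_comm _ c]

theorem coboundary_apply {m : ℕ} (f : Cochain k A X m) (t : Fin (m + 1) → A) :
    coboundary k A X m f t = t 0 • f (Fin.tail t)
      + ∑ i : Fin m, ((-1 : k) ^ (i + 1 : ℕ)) • f (Fin.contractNth i.castSucc (· * ·) t)
      + ((-1 : k) ^ (m + 1)) • op (t (Fin.last m)) • f (Fin.init t) := by
  simp [coboundary, headFace, midFace, lastFace]

/-- `(b₀, …, b_{m+1}) ↦ b₀ f(b₁, …, b_m) b_{m+1}`. -/
def extend {m : ℕ} (f : Cochain k A X m) (b : Fin (m + 2) → A) : X :=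
  b 0 • op (b (Fin.last _)) • f (Fin.init (Fin.tail b))

theorem extend_coboundary {m : ℕ} (f : Cochain k A X m) (b : Fin (m + 3) → A) :
    extend (coboundary k A X m f) b = ∑ i : Fin (m + 2), ((-1 : ℤ) ^ (i : ℕ)) •
      extend f (Fin.contractNth i.castSucc (· * ·) b) := by
  have key (r : ℕ) (x : X) : ((-1 : ℤ) ^ r) • x = ((-1 : k) ^ r) • x := by
    rcases neg_one_pow_eq_or ℤ r with h | h <;> rcases Nat.even_or_odd r with h' | h' <;>
      simp [h'.neg_one_pow]
  rw [Fin.sum_univ_succ, Fin.sum_univ_castSucc]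
  simp only [key]
  unfold extend
  rw [coboundary_apply]
  simp only [smul_add, Finset.smul_sum]
  rw [add_assoc]
  congr 1
  · have : Fin.init (Fin.tail (Fin.contractNth (Fin.castSucc (0 : Fin (m + 2))) (· * ·) b)) =
        Fin.tail (Fin.init (Fin.tail b)) := by
      ext r; simp [Fin.init, Fin.tail, Fin.contractNth]
    simp only [this, Fin.contractNth, Fin.init, Fin.tail]
    simp only [Fin.val_zero, pow_zero, one_smul, Fin.castSucc_zero, lt_self_iff_false, if_false,
      if_true, Fin.val_last, Nat.succ_ne_zero, not_lt_zero, mul_smul, Fin.succ_last]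
    simp
    rw [smul_comm (b 1)]
  · congr 1
    · refine Finset.sum_congr rfl fun i _ => ?_
      have : Fin.init (Fin.tail (Fin.contractNth (Fin.castSucc (i.castSucc.succ : Fin (m + 2))) (· * ·) b)) =
        Fin.contractNth i.castSucc (· * ·) (Fin.init (Fin.tail b)) := by
        ext r; simp [Fin.init, Fin.tail, Fin.contractNth]
      rw [this]
      have h2 : Fin.contractNth (Fin.castSucc (i.castSucc.succ : Fin (m + 2))) (· * ·) b 0 = b 0 := by
        simp [Fin.contractNth]
      have h3 : Fin.contractNth (Fin.castSucc (i.castSucc.succ : Fin (m + 2))) (· * ·) b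
          (Fin.last (m + 1)) = b (Fin.last _) := by
        rw [Fin.contractNth_apply_of_gt]
        · simp
        · simp
      rw [h2, h3]
      simp [smul_comm _ ((-1 : k) ^ _)]
    · have : Fin.init (Fin.tail (Fin.contractNth (Fin.castSucc ((Fin.last m).succ : Fin (m + 2))) (· * ·) b)) =
        Fin.init (Fin.init (Fin.tail b)) := by
        ext r
        have := r.2
        simp only [Fin.init, Fin.tail]
        rw [Fin.contractNth_apply_of_lt]
        · rfl
        · simp
      rw [this]
      have h2 : Fin.contractNth (Fin.castSucc ((Fin.last m).succ : Fin (m + 2))) (· * ·) b 0 = b 0 := by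
        simp [Fin.contractNth]
      have h3 : Fin.contractNth (Fin.castSucc ((Fin.last m).succ : Fin (m + 2))) (· * ·) b
          (Fin.last (m + 1)) = b (Fin.last _).castSucc * b (Fin.last _) := by
        rw [Fin.contractNth_apply_of_eq]
        · simp
        · simp
      rw [h2, h3]
      simp [smul_comm _ ((-1 : k) ^ _), mul_smul, Fin.init, Fin.tail]
      rfl

theorem coboundary_coboundary {m : ℕ} (f : Cochain k A X m) :
    coboundary k A X (m + 1) (coboundary k A X m f) = 0 := by
  ext t
  have h : coboundary k A X (m + 1) (coboundary k A X m f) t =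
      extend (coboundary k A X (m + 1) (coboundary k A X m f)) (Fin.cons 1 (Fin.snoc t 1)) := by
    have : Fin.init (Fin.tail (Fin.cons 1 (Fin.snoc t 1) : Fin (m + 4) → A)) = t := by
      simp [Fin.tail_cons]
    have h1 : (Fin.cons 1 (Fin.snoc t 1) : Fin (m + 4) → A) (Fin.last _) = 1 := by
      rw [← Fin.succ_last, Fin.cons_succ, Fin.snoc_last]
    rw [extend, this, h1, Fin.cons_zero, op_one, one_smul, one_smul]
  rw [h, extend_coboundary]
  simp only [extend_coboundary, Finset.smul_sum, smul_smul, ← pow_add]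
  rw [sum_contract_contract]
  rfl

variable (k A X) in
/-- Hochschild cocycles. -/
def cocycles (l : ℕ) : Submodule k (Cochain k A X l) := LinearMap.ker (coboundary k A X l)

variable (k A X) in
/-- Hochschild coboundaries. -/
def coboundaries : ∀ l : ℕ, Submodule k (Cochain k A X l)
  | 0 => ⊥
  | l + 1 => LinearMap.range (coboundary k A X l)

variable (k A X) in
/-- Hochschild cohomology `HH^l(A, X)`. -/
abbrev HH (l : ℕ) : Type _ :=
  cocycles k A X l ⧸ (coboundaries k A X l).submoduleOf (cocycles k A X l)

/-- The class of a cocycle. -/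
def HH.mk {l : ℕ} (f : cocycles k A X l) : HH k A X l := Submodule.Quotient.mk f

end Hochschild

/-! The first page of the spectral sequence of a decreasing filtration `F` of a cochain complex
`(C, d)`. The first index of a term is the filtration degree, the second one the total degree. -/

namespace FilteredComplex

variable {k : Type*} [CommRing k] {C : ℕ → Type*} [∀ m, AddCommGroup (C m)] [∀ m, Module k (C m)]

/-- `{x ∈ F^p C^m | d x ∈ F^{p+1} C^{m+1}}`. -/
def cycles₁ (d : ∀ m, C m →ₗ[k] C (m + 1)) (F : ℕ → ∀ m, Submodule k (C m)) (p m : ℕ) :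
    Submodule k (C m) :=
  F p m ⊓ (F (p + 1) (m + 1)).comap (d m)

/-- `F^{p+1} C^m + d (F^p C^{m-1})`. -/
def boundaries₁ (d : ∀ m, C m →ₗ[k] C (m + 1)) (F : ℕ → ∀ m, Submodule k (C m)) (p : ℕ) :
    ∀ m, Submodule k (C m)
  | 0 => F (p + 1) 0
  | m + 1 => F (p + 1) (m + 1) ⊔ (F p m).map (d m)

/-- `E_1^{p, m-p} = H^m(F^p / F^{p+1})`. -/
abbrev E₁ (d : ∀ m, C m →ₗ[k] C (m + 1)) (F : ℕ → ∀ m, Submodule k (C m)) (p m : ℕ) : Type _ :=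
  cycles₁ d F p m ⧸ (boundaries₁ d F p m).submoduleOf (cycles₁ d F p m)

variable (d : ∀ m, C m →ₗ[k] C (m + 1)) (F : ℕ → ∀ m, Submodule k (C m))

/-- The class of a cycle. -/
def E₁.mk {p m : ℕ} (x : cycles₁ d F p m) : E₁ d F p m := Submodule.Quotient.mk x

/-- The differential `d_1 : [x] ↦ [d x]`. -/
def d₁ (hd : ∀ m x, d (m + 1) (d m x) = 0) (p m : ℕ) : E₁ d F p m →ₗ[k] E₁ d F (p + 1) (m + 1) :=
  Submodule.mapQ _ _
    ((d m).restrict fun x hx => ⟨hx.2, by simp [hd]⟩ :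
      cycles₁ d F p m →ₗ[k] cycles₁ d F (p + 1) (m + 1)) <| by
    rintro ⟨x, hx⟩ hx'
    change x ∈ boundaries₁ d F p m at hx'
    change d m x ∈ boundaries₁ d F (p + 1) (m + 1)
    refine Submodule.mem_sup_right ?_
    cases m with
    | zero => exact ⟨x, hx', rfl⟩
    | succ m =>
      obtain ⟨y, hy, z, ⟨z, -, rfl⟩, rfl⟩ := Submodule.mem_sup.1 hx'
      exact ⟨y, hy, by simp [hd]⟩

end FilteredComplex

namespace BarResolution

open scoped ModuleCat

/-- For a `k`-algebra `S` and an algebra map `ι : B → S`, a coaction `Δ : S → B ⊗ S` that turns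
`B ⊗ N` into an `S`-module for each `S`-module `N`, in such a way that `b ⊗ n ↦ ι(b) n` is
`S`-linear. -/
structure Induction (k B S : Type u) [Field k] [Ring B] [Algebra k B] [Ring S] [Algebra k S] where
  ι : B →ₐ[k] S
  Δ : S →ₐ[k] B ⊗[k] S
  law : ∀ s b, TensorProduct.lift ((LinearMap.mul k S).comp ι.toLinearMap) (Δ s * (b ⊗ₜ 1)) = s * ι b

section

variable {k B S : Type u} [Field k] [Ring B] [Algebra k B] [Ring S] [Algebra k S]
  (I : Induction k B S)

/-- The underlying group of `B ⊗ N`. -/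
def Ind (_ : Induction k B S) (N : ModuleCat.{u} S) : Type u := B ⊗[k] N

instance (N : ModuleCat.{u} S) : AddCommGroup (Ind I N) :=
  inferInstanceAs (AddCommGroup (B ⊗[k] N))

/-- The element `b ⊗ n`. -/
def tm {I : Induction k B S} {N : ModuleCat.{u} S} (b : B) (n : N) : Ind I N := b ⊗ₜ[k] n

/-- `B ⊗ S` acts on `B ⊗ N`. -/
noncomputable def act (N : ModuleCat.{u} S) : B ⊗[k] S →ₐ[k] Module.End k (B ⊗[k] N) :=
  Module.endTensorEndAlgHom.comp
    (Algebra.TensorProduct.map (Algebra.lmul k B) (Algebra.lsmul k k N))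

theorem act_tmul (N : ModuleCat.{u} S) (b' b : B) (s : S) (n : N) :
    act N (b' ⊗ₜ[k] s) (b ⊗ₜ[k] n) = (b' * b) ⊗ₜ[k] (s • n) := by
  simp only [act, AlgHom.comp_apply, Algebra.TensorProduct.map_tmul]
  erw [Module.endTensorEndAlgHom_apply]
  simp

/-- The action of `S` on `B ⊗ N`: if `Δ s = ∑ b' ⊗ s'`, then `s (b ⊗ n) = ∑ b' b ⊗ s' n`. -/
noncomputable instance (N : ModuleCat.{u} S) : Module S (Ind I N) :=
  Module.compHom (B ⊗[k] N) ((act N).comp I.Δ).toRingHom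

theorem smul_def (N : ModuleCat.{u} S) (s : S) (x : Ind I N) :
    s • x = act N (I.Δ s) (show B ⊗[k] N from x) := rfl

theorem tm_induction {I : Induction k B S} {N : ModuleCat.{u} S} {P : Ind I N → Prop} (x : Ind I N) (h0 : P 0)
    (h1 : ∀ b n, P (tm b n)) (h2 : ∀ x y, P x → P y → P (x + y)) : P x :=
  TensorProduct.induction_on (motive := P) x h0 h1 h2

/-- `b ⊗ n ↦ ι(b) n`. -/
noncomputable def epsAux (N : ModuleCat.{u} S) : B ⊗[k] N →ₗ[k] N :=
  TensorProduct.lift ((Algebra.lsmul k k N).toLinearMap.comp I.ι.toLinearMap)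

theorem epsAux_act (N : ModuleCat.{u} S) (z : B ⊗[k] S) (b : B) (n : N) :
    epsAux I N (act N z (b ⊗ₜ n)) =
      TensorProduct.lift ((LinearMap.mul k S).comp I.ι.toLinearMap) (z * (b ⊗ₜ 1)) • n := by
  induction z with
  | zero => simp
  | add x y hx hy => simp [add_mul, add_smul, hx, hy]
  | tmul b' s => rw [act_tmul]; simp [epsAux, mul_smul]

/-- The `S`-linear map `B ⊗ N → N`, `b ⊗ n ↦ ι(b) n`. -/
noncomputable def eps (N : ModuleCat.{u} S) : Ind I N →ₗ[S] N where
  toFun x := epsAux I N x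
  map_add' x y := map_add (epsAux I N) x y
  map_smul' s x := by
    rw [smul_def]
    induction x using tm_induction with
    | h0 =>
      change epsAux I N (act N (I.Δ s) (0 : B ⊗[k] N)) = s • epsAux I N (0 : B ⊗[k] N)
      simp
    | h2 x y hx hy =>
      change epsAux I N (act N (I.Δ s) ((show B ⊗[k] N from x) + (show B ⊗[k] N from y))) =
        s • epsAux I N ((show B ⊗[k] N from x) + (show B ⊗[k] N from y))
      rw [map_add, map_add, map_add, smul_add]
      exact congrArg₂ _ hx hy
    | h1 b n =>
      refine (epsAux_act I N _ b n).trans ?_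
      rw [I.law]
      simp [tm, epsAux, mul_smul]

theorem eps_tm (N : ModuleCat.{u} S) (b : B) (n : N) : eps I N (tm b n) = I.ι b • n := by
  change epsAux I N (b ⊗ₜ n) = _
  simp [epsAux]

/-- `S`-linear maps are `k`-linear. -/
def linK {N N' : ModuleCat.{u} S} (f : N →ₗ[S] N') : N →ₗ[k] N' where
  toFun := f
  map_add' := map_add f
  map_smul' r x := map_smul f (algebraMap k S r) x

theorem lTensor_act {N N' : ModuleCat.{u} S} (f : N →ₗ[S] N') (z : B ⊗[k] S) (x : B ⊗[k] N) :
    (linK f).lTensor B (act N z x) = act N' z ((linK f).lTensor B x) := by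
  induction z with
  | zero => simp
  | add z w hz hw => simp [hz, hw]
  | tmul b s =>
    induction x with
    | zero => simp
    | add x y hx hy => simp only [map_add, hx, hy]
    | tmul b' n => simp [act_tmul, linK]

/-- `b ⊗ n ↦ b ⊗ f(n)`. -/
noncomputable def indMap {N N' : ModuleCat.{u} S} (f : N →ₗ[S] N') : Ind I N →ₗ[S] Ind I N' where
  toFun x := (linK f).lTensor B x
  map_add' x y := map_add ((linK f).lTensor B) x y
  map_smul' s x := lTensor_act f (I.Δ s) x

theorem indMap_tm {N N' : ModuleCat.{u} S} (f : N →ₗ[S] N') (b : B) (n : N) :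
    indMap I f (tm b n) = tm b (f n) := by
  change (linK f).lTensor B (b ⊗ₜ n) = b ⊗ₜ f n
  simp [linK]

theorem ind_ext {N : ModuleCat.{u} S} {P : Type*} [AddCommGroup P] {f g : Ind I N →+ P}
    (h : ∀ b n, f (tm b n) = g (tm b n)) : f = g := by
  ext x
  induction x using tm_induction with
  | h0 => simp
  | h1 b n => exact h b n
  | h2 x y hx hy => simp [hx, hy]

theorem ind_ext' {N : ModuleCat.{u} S} {P : Type*} [AddCommGroup P] [Module S P] {f g : Ind I N →ₗ[S] P}
    (h : ∀ b n, f (tm b n) = g (tm b n)) : f = g :=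
  LinearMap.toAddMonoidHom_injective (ind_ext I h)

/-- The functor `N ↦ B ⊗ N` on `S`-modules. -/
noncomputable def F : ModuleCat.{u} S ⥤ ModuleCat.{u} S where
  obj N := ModuleCat.of S (Ind I N)
  map f := ModuleCat.ofHom (indMap I f.hom)
  map_id N := by
    ext1
    exact ind_ext' I fun b n => by simp [indMap_tm]
  map_comp f g := by
    ext1
    exact ind_ext' I fun b n => by simp [indMap_tm]

instance : (F I).Additive where
  map_add {N N'} f g := by
    ext1
    exact ind_ext' I fun b n => by
      change indMap I (f.hom + g.hom) (tm b n) = indMap I f.hom (tm b n) + indMap I g.hom (tm b n)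
      rw [indMap_tm, indMap_tm, indMap_tm]
      exact TensorProduct.tmul_add _ _ _

/-- The augmentation `B ⊗ N → N`, `b ⊗ n ↦ ι(b) n`. -/
noncomputable def aug (N : ModuleCat.{u} S) : (F I).obj N ⟶ N := ModuleCat.ofHom (eps I N)

theorem aug_naturality {N N' : ModuleCat.{u} S} (f : N ⟶ N') :
    (F I).map f ≫ aug I N' = aug I N ≫ f := by
  ext1
  exact ind_ext' I fun b n => by
    change eps I N' (indMap I f.hom (tm b n)) = f.hom (eps I N (tm b n))
    rw [indMap_tm, eps_tm, eps_tm, map_smul]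

/-- `N ↦ B ⊗ ⋯ ⊗ B ⊗ N`, with `q` factors `B`. -/
noncomputable def pow : ℕ → (ModuleCat.{u} S ⥤ ModuleCat.{u} S)
  | 0 => 𝟭 _
  | q + 1 => pow q ⋙ F I

instance pow_additive (q : ℕ) : (pow I q).Additive := by
  induction q with
  | zero => exact inferInstanceAs (𝟭 (ModuleCat.{u} S)).Additive
  | succ q ih => exact inferInstanceAs (pow I q ⋙ F I).Additive

/-- The element `b₁ ⊗ ⋯ ⊗ b_q ⊗ n`. -/
noncomputable def word : ∀ {q : ℕ} (_ : Fin q → B) {N : ModuleCat.{u} S} (_ : N), (pow I q).obj N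
  | 0, _, _, n => n
  | _ + 1, b, _, n => tm (I := I) (b 0) (word (Fin.tail b) n)

/-- The bar differential `B ⊗ B^{⊗ q} ⊗ N → B^{⊗ q} ⊗ N`,
`b₀ ⊗ ⋯ ⊗ b_q ⊗ n ↦ ∑_{i < q} (-1)^i b₀ ⊗ ⋯ ⊗ bᵢ bᵢ₊₁ ⊗ ⋯ ⊗ n + (-1)^q b₀ ⊗ ⋯ ⊗ b_{q-1} ⊗ b_q n`. -/
noncomputable def bar (N : ModuleCat.{u} S) :
    ∀ q : ℕ, (F I).obj ((pow I q).obj N) ⟶ (pow I q).obj N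
  | 0 => aug I N
  | q + 1 => aug I ((F I).obj ((pow I q).obj N)) - (F I).map (bar N q)

theorem bar_step {Y : ModuleCat.{u} S} (b : (F I).obj Y ⟶ Y)
    (h : (aug I ((F I).obj Y) - (F I).map b) ≫ b = 0) :
    (aug I ((F I).obj ((F I).obj Y)) - (F I).map (aug I ((F I).obj Y) - (F I).map b)) ≫
      (aug I ((F I).obj Y) - (F I).map b) = 0 := by
  generalize ha : aug I ((F I).obj Y) - (F I).map b = a at *
  rw [Preadditive.sub_comp, sub_eq_zero, ← aug_naturality]
  conv_rhs => rw [← ha, Preadditive.comp_sub, ← Functor.map_comp, ha, h, Functor.map_zero, sub_zero]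

theorem bar_bar (N : ModuleCat.{u} S) (q : ℕ) :
    (aug I ((F I).obj ((pow I q).obj N)) - (F I).map (bar I N q)) ≫ bar I N q = 0 := by
  induction q with
  | zero =>
    rw [Preadditive.sub_comp, sub_eq_zero]
    exact (aug_naturality I (aug I N)).symm
  | succ q ih => exact bar_step I _ ih

theorem bar_naturality_step {Y Y' : ModuleCat.{u} S} (b : (F I).obj Y ⟶ Y)
    (b' : (F I).obj Y' ⟶ Y') (f : Y ⟶ Y') (h : (F I).map f ≫ b' = b ≫ f) :
    (F I).map ((F I).map f) ≫ (aug I ((F I).obj Y') - (F I).map b') =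
      (aug I ((F I).obj Y) - (F I).map b) ≫ (F I).map f := by
  rw [Preadditive.comp_sub, Preadditive.sub_comp, aug_naturality, ← Functor.map_comp,
    ← Functor.map_comp, h]

theorem bar_naturality (q : ℕ) {N N' : ModuleCat.{u} S} (f : N ⟶ N') :
    (F I).map ((pow I q).map f) ≫ bar I N' q = bar I N q ≫ (pow I q).map f := by
  induction q with
  | zero => exact aug_naturality I f
  | succ q ih => exact bar_naturality_step I _ _ _ ih

/-- The map `y ↦ 1 ⊗ y`. -/
noncomputable def unitMap (N : ModuleCat.{u} S) : N →+ (F I).obj N where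
  toFun n := tm (I := I) 1 n
  map_zero' := TensorProduct.tmul_zero _ _
  map_add' := TensorProduct.tmul_add _

theorem unitMap_naturality {N N' : ModuleCat.{u} S} (f : N ⟶ N') (y : N) :
    (F I).map f (unitMap I N y) = unitMap I N' (f y) :=
  indMap_tm I f.hom 1 y

theorem aug_unitMap (N : ModuleCat.{u} S) (y : N) : aug I N (unitMap I N y) = y := by
  change eps I _ (tm 1 y) = _
  rw [eps_tm, map_one, one_smul]

theorem bar_unitMap_step {Y : ModuleCat.{u} S} (b : (F I).obj Y ⟶ Y) (y : (F I).obj Y) :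
    (aug I ((F I).obj Y) - (F I).map b) (unitMap I ((F I).obj Y) y) = y - unitMap I Y (b y) := by
  have h1 := aug_unitMap I _ y
  have h2 := unitMap_naturality I b y
  exact congrArg₂ (· - ·) h1 h2

theorem bar_succ_unitMap (q : ℕ) (N : ModuleCat.{u} S) (y : (F I).obj ((pow I q).obj N)) :
    bar I N (q + 1) (unitMap I ((F I).obj ((pow I q).obj N)) y) =
      y - unitMap I _ (bar I N q y) :=
  bar_unitMap_step I _ y

end

section

variable (k L R : Type u) [Field k] [Ring L] [Algebra k L] [Ring R] [Algebra k R]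

/-- For a module `N` over `L ⊗ R`: `L ⊗ N` with `L` acting on `L` and `R` on `N`. -/
noncomputable def left : Induction k L (L ⊗[k] R) where
  ι := Algebra.TensorProduct.includeLeft
  Δ := Algebra.TensorProduct.map (AlgHom.id k L) Algebra.TensorProduct.includeRight
  law s b := by
    induction s with
    | zero => simp
    | add x y hx hy => simp only [map_add, add_mul, hx, hy]
    | tmul x y => simp

/-- For a module `N` over `L ⊗ R`: `R ⊗ N` with `R` acting on `R` and `L` on `N`. -/
noncomputable def right : Induction k R (L ⊗[k] R) where
  ι := Algebra.TensorProduct.includeRight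
  Δ := (Algebra.TensorProduct.map (AlgHom.id k R) Algebra.TensorProduct.includeLeft).comp
    (Algebra.TensorProduct.comm k L R).toAlgHom
  law s b := by
    induction s with
    | zero => simp
    | add x y hx hy => simp only [map_add, add_mul, hx, hy]
    | tmul x y => simp

end


section

variable {k L R : Type u} [Field k] [Ring L] [Algebra k L] [Ring R] [Algebra k R]

/-- `N` as a module over `R`. -/
noncomputable abbrev rightMod (N : ModuleCat.{u} (L ⊗[k] R)) : Module R N :=
  Module.compHom N (Algebra.TensorProduct.includeRight : R →ₐ[k] L ⊗[k] R).toRingHom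

theorem right_smul_tm (N : ModuleCat.{u} (L ⊗[k] R)) (s : L) (r r' : R) (n : N) :
    (s ⊗ₜ[k] r : L ⊗[k] R) • (tm r' n : Ind (right k L R) N) =
      tm (r * r') ((s ⊗ₜ[k] (1 : R) : L ⊗[k] R) • n) := by
  rw [smul_def]
  have : (right k L R).Δ (s ⊗ₜ r) = r ⊗ₜ (s ⊗ₜ 1) := by simp [right]
  rw [this]
  exact act_tmul N r r' _ n

theorem left_smul_tm (N : ModuleCat.{u} (L ⊗[k] R)) (s s' : L) (r : R) (n : N) :
    (s ⊗ₜ[k] r : L ⊗[k] R) • (tm s' n : Ind (left k L R) N) =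
      tm (s * s') (((1 : L) ⊗ₜ[k] r : L ⊗[k] R) • n) := by
  rw [smul_def]
  have : (left k L R).Δ (s ⊗ₜ r) = s ⊗ₜ (1 ⊗ₜ r) := by simp [left]
  rw [this]
  exact act_tmul N s s' _ n

attribute [local instance] rightMod

theorem rightMod_smul_def (N : ModuleCat.{u} (L ⊗[k] R)) (r : R) (n : N) :
    r • n = ((1 : L) ⊗ₜ[k] r : L ⊗[k] R) • n := rfl

instance (N : ModuleCat.{u} (L ⊗[k] R)) : IsScalarTower k R N := ⟨fun a r n => by
  rw [rightMod_smul_def, rightMod_smul_def, TensorProduct.tmul_smul, smul_assoc]⟩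

theorem projective_F_right (N : ModuleCat.{u} (L ⊗[k] R)) :
    Module.Projective R ((F (right k L R)).obj N) := by
  let e : (R ⊗[k] N) ≃ₗ[R] ((F (right k L R)).obj N) :=
    { (AddEquiv.refl _ : (R ⊗[k] N) ≃+ (R ⊗[k] N)) with
      map_smul' := fun r x => by
        change (r • x : R ⊗[k] N) = act N ((right k L R).Δ (1 ⊗ₜ r)) x
        have : (right k L R).Δ (1 ⊗ₜ r) = r ⊗ₜ (1 ⊗ₜ 1) := by simp [right]
        rw [this]
        induction x with
        | zero => simp
        | add x y hx hy => simp only [smul_add, map_add, hx, hy]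
        | tmul r' n =>
          rw [act_tmul, TensorProduct.smul_tmul', ← Algebra.TensorProduct.one_def, one_smul]
          rfl }
  exact Module.Projective.of_equiv e

theorem projective_F_left (N : ModuleCat.{u} (L ⊗[k] R)) (hN : Module.Projective R N) :
    Module.Projective R ((F (left k L R)).obj N) := by
  let e : (N ⊗[k] L) ≃ₗ[R] ((F (left k L R)).obj N) :=
    { (TensorProduct.comm k N L).toAddEquiv with
      map_smul' := fun r x => by
        change TensorProduct.comm k N L (r • x : N ⊗[k] L) =
          act N ((left k L R).Δ (1 ⊗ₜ r)) (TensorProduct.comm k N L x)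
        have : (left k L R).Δ (1 ⊗ₜ r) = 1 ⊗ₜ (1 ⊗ₜ r) := by simp [left]
        rw [this]
        induction x with
        | zero => simp
        | add x y hx hy => simp only [smul_add, map_add, hx, hy]
        | tmul n s =>
          rw [TensorProduct.comm_tmul, act_tmul, TensorProduct.smul_tmul', one_mul]
          rfl }
  exact Module.Projective.of_equiv e

theorem projective_pow_left (N : ModuleCat.{u} (L ⊗[k] R)) (hN : Module.Projective R N) (q : ℕ) :
    Module.Projective R ((pow (left k L R) q).obj N) := by
  induction q with
  | zero => exact hN
  | succ q ih => exact projective_F_left _ ih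

/-- `R`-linear maps `N → X` extend to `L ⊗ R`-linear maps `L ⊗ N → X`. -/
noncomputable def extendAux {N : ModuleCat.{u} (L ⊗[k] R)} {X : ModuleCat.{u} (L ⊗[k] R)}
    (g : N →ₗ[R] X) : L ⊗[k] N →ₗ[k] X :=
  TensorProduct.lift (LinearMap.mk₂ k (fun s n => (s ⊗ₜ[k] (1 : R) : L ⊗[k] R) • g n)
    (fun s t n => by rw [TensorProduct.add_tmul, add_smul])
    (fun c s n => by rw [← TensorProduct.smul_tmul', smul_assoc])
    (fun s m n => by rw [map_add, smul_add])
    (fun c s n => by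
      have : g (c • n) = c • g n := by
        rw [← algebraMap_smul R c n, map_smul, algebraMap_smul]
      rw [this, smul_comm]))

theorem extendAux_tmul {N : ModuleCat.{u} (L ⊗[k] R)} {X : ModuleCat.{u} (L ⊗[k] R)}
    (g : N →ₗ[R] X) (s : L) (n : N) :
    extendAux g (s ⊗ₜ n) = (s ⊗ₜ[k] (1 : R) : L ⊗[k] R) • g n := rfl

theorem extendAux_act {N : ModuleCat.{u} (L ⊗[k] R)} {X : ModuleCat.{u} (L ⊗[k] R)}
    (g : N →ₗ[R] X) (s : L ⊗[k] R) (x : L ⊗[k] N) :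
    extendAux g (act N ((left k L R).Δ s) x) = s • extendAux g x := by
  induction s with
  | zero => simp
  | add s t hs ht => simp only [map_add, LinearMap.add_apply, hs, ht, add_smul]
  | tmul s r =>
    have : (left k L R).Δ (s ⊗ₜ r) = s ⊗ₜ (1 ⊗ₜ r) := by simp [left]
    rw [this]
    induction x with
    | zero => simp
    | add x y hx hy => simp only [map_add, hx, hy, smul_add]
    | tmul t n =>
      rw [act_tmul, extendAux_tmul, extendAux_tmul, ← rightMod_smul_def, map_smul,
        rightMod_smul_def, smul_smul, smul_smul]
      simp

theorem projective_F (N : ModuleCat.{u} (L ⊗[k] R)) (hN : Module.Projective R N) :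
    Projective ((F (left k L R)).obj N) := by
  refine ⟨fun {E X} f p hp => ?_⟩
  have hp' := (ModuleCat.epi_iff_surjective p).1 hp
  let f' : N →ₗ[R] X :=
    { toFun := fun n => f (tm (I := left k L R) 1 n)
      map_add' := fun a b => by
        exact (congrArg f (TensorProduct.tmul_add _ _ _)).trans (map_add f.hom _ _)
      map_smul' := fun r n => by
        rw [RingHom.id_apply, rightMod_smul_def, rightMod_smul_def]
        refine Eq.trans (congrArg f ?_) (map_smul f.hom _ _)
        have := left_smul_tm N 1 1 r n
        rw [one_mul] at this
        exact this.symm }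
  let p' : E →ₗ[R] X :=
    { toFun := p
      map_add' := map_add p.hom
      map_smul' := fun r x => map_smul p.hom _ x }
  obtain ⟨g, hg⟩ := Module.projective_lifting_property p' f' hp'
  let G : Ind (left k L R) N →ₗ[L ⊗[k] R] E :=
    { toFun := fun x => extendAux g x
      map_add' := fun x y => map_add (extendAux g) x y
      map_smul' := fun s x => extendAux_act g s x }
  refine ⟨ModuleCat.ofHom G, ?_⟩
  ext1
  refine ind_ext' _ fun s n => ?_
  have h1 : p (g n) = f (tm (I := left k L R) 1 n) := LinearMap.congr_fun hg n
  have h2 : f (tm (I := left k L R) s n) = (s ⊗ₜ[k] (1 : R) : L ⊗[k] R) • p (g n) := by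
    rw [h1]
    refine Eq.trans (congrArg f ?_) (map_smul f.hom _ _)
    have := left_smul_tm N s 1 1 n
    rw [mul_one, ← Algebra.TensorProduct.one_def, one_smul] at this
    exact this.symm
  refine Eq.trans ?_ h2.symm
  exact map_smul p.hom (s ⊗ₜ[k] (1 : R) : L ⊗[k] R) (g n)

variable (M : ModuleCat.{u} (L ⊗[k] R))

/-- `L ⊗ L^{⊗ q} ⊗ M ⊗ R^{⊗ p} ⊗ R`. -/
noncomputable def P (q p : ℕ) : ModuleCat.{u} (L ⊗[k] R) :=
  (F (left k L R)).obj ((pow (left k L R) q).obj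
    ((F (right k L R)).obj ((pow (right k L R) p).obj M)))

instance (q p : ℕ) : Projective (P M q p) :=
  projective_F _ (projective_pow_left _ (projective_F_right _) q)

/-- The bar differential on the factors `L`. -/
noncomputable def dL (q p : ℕ) : P M (q + 1) p ⟶ P M q p :=
  bar (left k L R) ((F (right k L R)).obj ((pow (right k L R) p).obj M)) (q + 1)

/-- The bar differential on the factors `R`. -/
noncomputable def dR (q p : ℕ) : P M q (p + 1) ⟶ P M q p :=
  (F (left k L R)).map ((pow (left k L R) q).map (bar (right k L R) M (p + 1)))

theorem dL_dL (q p : ℕ) (x : P M (q + 1 + 1) p) : dL M q p (dL M (q + 1) p x) = 0 :=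
  ConcreteCategory.congr_hom (bar_bar (left k L R) _ (q + 1)) x

theorem map_map_zero {q : ℕ} {A B C : ModuleCat.{u} (L ⊗[k] R)} (f : A ⟶ B) (g : B ⟶ C)
    (h : f ≫ g = 0) (x : (F (left k L R)).obj ((pow (left k L R) q).obj A)) :
    (F (left k L R)).map ((pow (left k L R) q).map g)
      ((F (left k L R)).map ((pow (left k L R) q).map f) x) = 0 := by
  have : (F (left k L R)).map ((pow (left k L R) q).map f) ≫
      (F (left k L R)).map ((pow (left k L R) q).map g) = 0 := by
    rw [← Functor.map_comp, ← Functor.map_comp, h, Functor.map_zero, Functor.map_zero]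
  exact ConcreteCategory.congr_hom this x

theorem dR_dR (q p : ℕ) (x : P M q (p + 1 + 1)) : dR M q p (dR M q (p + 1) x) = 0 :=
  map_map_zero (q := q) (bar (right k L R) M (p + 1 + 1)) (bar (right k L R) M (p + 1))
    (bar_bar (right k L R) M (p + 1)) x

theorem dL_dR (q p : ℕ) (x : P M (q + 1) (p + 1)) :
    dL M q p (dR M (q + 1) p x) = dR M q p (dL M q (p + 1) x) :=
  ConcreteCategory.congr_hom (bar_naturality (left k L R) (q + 1) (bar (right k L R) M (p + 1))) x

/-- Degree `l` of the bar resolution: the sum of the `L ⊗ L^{⊗ q} ⊗ M ⊗ R^{⊗ p} ⊗ R` with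
`q + p = l`. -/
abbrev X (l : ℕ) : Type u := ∀ x : Finset.HasAntidiagonal.antidiagonal l, P M x.1.1 x.1.2

/-- The total differential `d_L + (-1)^l d_R`. -/
noncomputable def d (l : ℕ) : X M (l + 1) →ₗ[L ⊗[k] R] X M l where
  toFun f x :=
    dL M x.1.1 x.1.2 (f ⟨(x.1.1 + 1, x.1.2), by
      have := Finset.HasAntidiagonal.mem_antidiagonal.1 x.2
      rw [Finset.HasAntidiagonal.mem_antidiagonal]; omega⟩) +
    ((-1 : ℤ) ^ l) • dR M x.1.1 x.1.2 (f ⟨(x.1.1, x.1.2 + 1), by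
      have := Finset.HasAntidiagonal.mem_antidiagonal.1 x.2
      rw [Finset.HasAntidiagonal.mem_antidiagonal]; omega⟩)
  map_add' f g := by
    ext x
    simp only [Pi.add_apply, map_add, smul_add]
    abel
  map_smul' c f := by
    ext x
    simp only [Pi.smul_apply, smul_add, RingHom.id_apply]
    rw [smul_comm c]
    exact congrArg₂ _ (map_smul (dL M _ _).hom _ _) (congrArg _ (map_smul (dR M _ _).hom _ _))

theorem d_d (l : ℕ) (f : X M (l + 1 + 1)) : d M l (d M (l + 1) f) = 0 := by
  ext x
  change dL M _ _ (dL M _ _ _ + ((-1 : ℤ) ^ (l + 1)) • dR M _ _ _) +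
    ((-1 : ℤ) ^ l) • dR M _ _ (dL M _ _ _ + ((-1 : ℤ) ^ (l + 1)) • dR M _ _ _) = 0
  rw [map_add, map_add, map_zsmul, map_zsmul, dL_dL, dR_dR, dL_dR, pow_succ]
  simp

/-- The augmentation `l ⊗ m ⊗ r ↦ l m r`. -/
noncomputable def augM : P M 0 0 ⟶ M :=
  aug (left k L R) ((F (right k L R)).obj M) ≫ aug (right k L R) M

/-- The augmentation in degree `0`. -/
noncomputable def ε : X M 0 →ₗ[L ⊗[k] R] M :=
  (augM M).hom.comp (LinearMap.proj
    (φ := fun x : Finset.HasAntidiagonal.antidiagonal 0 => P M x.1.1 x.1.2)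
    ⟨(0, 0), Finset.HasAntidiagonal.mem_antidiagonal.2 rfl⟩)

theorem augM_dL (x : P M 1 0) : augM M (dL M 0 0 x) = 0 := by
  have h := ConcreteCategory.congr_hom (bar_bar (left k L R) ((F (right k L R)).obj M) 0) x
  exact (congrArg (aug (right k L R) M) h).trans (map_zero _)

theorem aug_dR (p : ℕ) (x : P M 0 (p + 1)) :
    aug (left k L R) ((F (right k L R)).obj ((pow (right k L R) p).obj M)) (dR M 0 p x) =
      bar (right k L R) M (p + 1)
        (aug (left k L R) ((F (right k L R)).obj ((pow (right k L R) (p + 1)).obj M)) x) :=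
  ConcreteCategory.congr_hom (aug_naturality (left k L R) (bar (right k L R) M (p + 1))) x

theorem aug_dL (p : ℕ) (x : P M 1 p) :
    aug (left k L R) ((F (right k L R)).obj ((pow (right k L R) p).obj M)) (dL M 0 p x) = 0 :=
  ConcreteCategory.congr_hom
    (bar_bar (left k L R) ((F (right k L R)).obj ((pow (right k L R) p).obj M)) 0) x

theorem augM_dR (x : P M 0 1) : augM M (dR M 0 0 x) = 0 := by
  refine (congrArg (aug (right k L R) M) (aug_dR M 0 x)).trans ?_
  exact ConcreteCategory.congr_hom (bar_bar (right k L R) M 0) _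

theorem ε_d (f : X M 1) : ε M (d M 0 f) = 0 := by
  change augM M (dL M 0 0 _ + ((-1 : ℤ) ^ 0) • dR M 0 0 _) = 0
  rw [map_add, map_zsmul, augM_dL, augM_dR]
  simp

/-- `y ↦ 1 ⊗ y`. -/
noncomputable def sL (q p : ℕ) : P M q p →+ P M (q + 1) p := unitMap (left k L R) (P M q p)

theorem dL_sL_succ (q p : ℕ) (y : P M (q + 1) p) :
    dL M (q + 1) p (sL M (q + 1) p y) = y - sL M q p (dL M q p y) :=
  bar_succ_unitMap (left k L R) (q + 1) _ y

/-- `y ↦ 1 ⊗ y`. -/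
noncomputable def sL' (p : ℕ) :
    (F (right k L R)).obj ((pow (right k L R) p).obj M) →+ P M 0 p :=
  unitMap (left k L R) ((F (right k L R)).obj ((pow (right k L R) p).obj M))

/-- `l ⊗ y ↦ l y`. -/
noncomputable def augL (p : ℕ) :
    P M 0 p →+ (F (right k L R)).obj ((pow (right k L R) p).obj M) :=
  (aug (left k L R) ((F (right k L R)).obj ((pow (right k L R) p).obj M))).hom.toAddMonoidHom

/-- `y ↦ y ⊗ 1`. -/
noncomputable def sR (p : ℕ) :
    (F (right k L R)).obj ((pow (right k L R) p).obj M) →+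
      (F (right k L R)).obj ((pow (right k L R) (p + 1)).obj M) :=
  unitMap (right k L R) ((F (right k L R)).obj ((pow (right k L R) p).obj M))

theorem dL_sL_zero (p : ℕ) (y : P M 0 p) :
    dL M 0 p (sL M 0 p y) = y - sL' M p (augL M p y) :=
  bar_succ_unitMap (left k L R) 0 _ y

theorem dR_sL (q p : ℕ) (y : P M q (p + 1)) :
    dR M (q + 1) p (sL M q (p + 1) y) = sL M q p (dR M q p y) :=
  unitMap_naturality (left k L R)
    ((F (left k L R)).map ((pow (left k L R) q).map (bar (right k L R) M (p + 1)))) y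

theorem dR_sL' (p : ℕ) (y : (F (right k L R)).obj ((pow (right k L R) (p + 1)).obj M)) :
    dR M 0 p (sL' M (p + 1) y) = sL' M p (bar (right k L R) M (p + 1) y) :=
  unitMap_naturality (left k L R) (bar (right k L R) M (p + 1)) y

/-- A null-homotopy of the augmented complex. -/
noncomputable def homotopy (l : ℕ) (f : X M l) : X M (l + 1) := fun x =>
  match x with
  | ⟨(q + 1, p), h⟩ => sL M q p (f ⟨(q, p), by
      have := Finset.HasAntidiagonal.mem_antidiagonal.1 h
      rw [Finset.HasAntidiagonal.mem_antidiagonal]; omega⟩)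
  | ⟨(0, p + 1), h⟩ => ((-1 : ℤ) ^ l) • sL' M (p + 1) (sR M p (augL M p (f ⟨(0, p), by
      have := Finset.HasAntidiagonal.mem_antidiagonal.1 h
      rw [Finset.HasAntidiagonal.mem_antidiagonal]; omega⟩)))
  | ⟨(0, 0), h⟩ => 0

theorem neg_one_smul_smul {G : Type*} [AddCommGroup G] (l : ℕ) (x : G) :
    ((-1 : ℤ) ^ l) • ((-1 : ℤ) ^ l) • x = x := by
  rw [smul_smul, ← mul_pow]; simp

theorem exact_succ (l : ℕ) (f : X M (l + 1)) (hf : d M l f = 0) :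
    d M (l + 1) (homotopy M (l + 1) f) = f := by
  funext ⟨⟨q, p⟩, h⟩
  have h' := Finset.HasAntidiagonal.mem_antidiagonal.1 h
  simp only at h'
  cases q with
  | succ q =>
    have h0 := congrFun hf ⟨(q, p), Finset.HasAntidiagonal.mem_antidiagonal.2 (by omega)⟩
    change dL M (q + 1) p (sL M (q + 1) p (f ⟨(q + 1, p), h⟩)) +
      ((-1 : ℤ) ^ (l + 1)) • dR M (q + 1) p (sL M q (p + 1) (f ⟨(q, p + 1), _⟩)) = _
    change dL M q p (f ⟨(q + 1, p), _⟩) + ((-1 : ℤ) ^ l) • dR M q p (f ⟨(q, p + 1), _⟩) = 0 at h0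
    rw [dL_sL_succ, dR_sL, eq_neg_of_add_eq_zero_left h0, map_neg, map_zsmul, pow_succ]
    simp
  | zero =>
    obtain rfl : p = l + 1 := by omega
    have h0 := congrFun hf ⟨(0, l), Finset.HasAntidiagonal.mem_antidiagonal.2 (by omega)⟩
    change dL M 0 (l + 1) (sL M 0 (l + 1) (f ⟨(0, l + 1), h⟩)) +
      ((-1 : ℤ) ^ (l + 1)) • dR M 0 (l + 1) (((-1 : ℤ) ^ (l + 1)) •
        sL' M (l + 1 + 1) (sR M (l + 1) (augL M (l + 1) (f ⟨(0, l + 1), h⟩)))) = _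
    change dL M 0 l (f ⟨(1, l), _⟩) + ((-1 : ℤ) ^ l) • dR M 0 l (f ⟨(0, l + 1), _⟩) = 0 at h0
    have h1 : augL M l (dR M 0 l (f ⟨(0, l + 1), h⟩)) = 0 := by
      have h2 := congrArg (augL M l) h0
      rw [map_add, map_zsmul, map_zero] at h2
      have h3 : augL M l (dL M 0 l (f ⟨(1, l), Finset.HasAntidiagonal.mem_antidiagonal.2 (by omega)⟩)) = 0 :=
        aug_dL M l _
      rw [h3, zero_add] at h2
      have h4 := congrArg (fun x => ((-1 : ℤ) ^ l) • x) h2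
      simp only [neg_one_smul_smul, smul_zero] at h4
      exact h4
    rw [dL_sL_zero, map_zsmul, neg_one_smul_smul, dR_sL']
    have h5 : bar (right k L R) M (l + 1 + 1) (sR M (l + 1) (augL M (l + 1) (f ⟨(0, l + 1), h⟩))) =
        augL M (l + 1) (f ⟨(0, l + 1), h⟩) - sR M l (bar (right k L R) M (l + 1)
          (augL M (l + 1) (f ⟨(0, l + 1), h⟩))) :=
      bar_succ_unitMap (right k L R) (l + 1) M _
    have h6 : bar (right k L R) M (l + 1) (augL M (l + 1) (f ⟨(0, l + 1), h⟩)) =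
        augL M l (dR M 0 l (f ⟨(0, l + 1), h⟩)) := (aug_dR M l _).symm
    rw [h5, h6, h1, map_zero, sub_zero, sub_add_cancel]

theorem exact_zero (f : X M 0) (hf : ε M f = 0) : d M 0 (homotopy M 0 f) = f := by
  funext ⟨⟨q, p⟩, h⟩
  have h' := Finset.HasAntidiagonal.mem_antidiagonal.1 h
  obtain rfl : q = 0 := by simp only at h'; omega
  obtain rfl : p = 0 := by simp only at h'; omega
  change dL M 0 0 (sL M 0 0 (f ⟨(0, 0), h⟩)) +
      ((-1 : ℤ) ^ 0) • dR M 0 0 (((-1 : ℤ) ^ 0) •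
        sL' M (0 + 1) (sR M 0 (augL M 0 (f ⟨(0, 0), h⟩)))) = _
  have h5 : ∀ y : (F (right k L R)).obj ((pow (right k L R) 0).obj M),
      bar (right k L R) M (0 + 1) (sR M 0 y) =
        y - unitMap (right k L R) ((pow (right k L R) 0).obj M) (aug (right k L R) M y) :=
      fun y => bar_succ_unitMap (right k L R) 0 M y
  have h6 : aug (right k L R) M (augL M 0 (f ⟨(0, 0), h⟩)) = 0 := hf
  have h7 : bar (right k L R) M (0 + 1) (sR M 0 (augL M 0 (f ⟨(0, 0), h⟩))) =
      augL M 0 (f ⟨(0, 0), h⟩) :=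
    (h5 _).trans ((congrArg (fun z => augL M 0 (f ⟨(0, 0), h⟩) -
      unitMap (right k L R) ((pow (right k L R) 0).obj M) z) h6).trans
        ((congrArg (augL M 0 (f ⟨(0, 0), h⟩) - ·) (map_zero _)).trans (sub_zero _)))
  rw [dL_sL_zero, map_zsmul, neg_one_smul_smul, dR_sL', h7, sub_add_cancel]

theorem ε_surjective : Function.Surjective (ε M) := fun m => by
  refine ⟨fun x => match x with
    | ⟨(0, 0), _⟩ => sL' M 0 (unitMap (right k L R) M m)
    | _ => 0, ?_⟩
  change aug (right k L R) M (aug (left k L R) _ (unitMap (left k L R) _ (unitMap (right k L R) M m))) = m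
  rw [aug_unitMap, aug_unitMap]

instance (l : ℕ) : Projective (ModuleCat.of (L ⊗[k] R) (X M l)) := by
  have h (q p : ℕ) : Module.Projective (L ⊗[k] R) (P M q p) := inferInstance
  have : Module.Projective (L ⊗[k] R) (X M l) :=
    Module.Projective.of_equiv (DirectSum.linearEquivFunOnFintype (L ⊗[k] R) _
      (fun x : Finset.HasAntidiagonal.antidiagonal l => P M x.1.1 x.1.2))
  exact ModuleCat.projective_of_categoryTheory_projective _

/-- The bar complex. -/
noncomputable def barComplex : ChainComplex (ModuleCat.{u} (L ⊗[k] R)) ℕ :=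
  ChainComplex.of (fun l => ModuleCat.of (L ⊗[k] R) (X M l)) (fun l => ModuleCat.ofHom (d M l))
    (fun l => by ext1; exact LinearMap.ext (d_d M l))

theorem barComplex_d (l : ℕ) :
    (barComplex M).d (l + 1) l = ModuleCat.ofHom (d M l) := by
  simp [barComplex, ChainComplex.of_d]

/-- The augmentation of the bar complex. -/
noncomputable def barπ : barComplex M ⟶ (ChainComplex.single₀ _).obj M :=
  (ChainComplex.toSingle₀Equiv _ _).symm ⟨ModuleCat.ofHom (ε M), by
    rw [barComplex_d]
    ext1
    exact LinearMap.ext (ε_d M)⟩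

theorem barπ_f_zero : (barπ M).f 0 = ModuleCat.ofHom (ε M) :=
  ChainComplex.toSingle₀Equiv_symm_apply_f_zero _ _

theorem quasiIso_barπ : QuasiIso (barπ M) := ⟨fun n => by
  cases n with
  | zero =>
    rw [ChainComplex.quasiIsoAt₀_iff, ShortComplex.quasiIso_iff_of_zeros' _ rfl rfl rfl]
    constructor
    · rw [ShortComplex.moduleCat_exact_iff]
      intro x hx
      have hx' : ε M x = 0 :=
        (ConcreteCategory.congr_hom (barπ_f_zero M) x).symm.trans hx
      exact ⟨homotopy M 0 x, (ConcreteCategory.congr_hom (barComplex_d M 0) _).trans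
        (exact_zero M x hx')⟩
    · rw [ModuleCat.epi_iff_surjective]
      intro m
      obtain ⟨x, hx⟩ := ε_surjective M m
      exact ⟨x, (ConcreteCategory.congr_hom (barπ_f_zero M) x).trans hx⟩
  | succ n =>
    rw [quasiIsoAt_iff_exactAt' _ _ (ChainComplex.exactAt_succ_single_obj _ _),
      HomologicalComplex.exactAt_iff' _ (n + 2) (n + 1) n (by simp) (by simp),
      ShortComplex.moduleCat_exact_iff]
    intro x hx
    have hx' : d M n x = 0 := (ConcreteCategory.congr_hom (barComplex_d M n) x).symm.trans hx
    exact ⟨homotopy M (n + 1) x, (ConcreteCategory.congr_hom (barComplex_d M (n + 1)) _).trans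
      (exact_succ M n x hx')⟩⟩

/-- The bar resolution. -/
noncomputable def barResolution : ProjectiveResolution M where
  complex := barComplex M
  projective n := inferInstanceAs (Projective (ModuleCat.of (L ⊗[k] R) (X M n)))
  π := barπ M
  quasiIso := quasiIso_barπ M

end

end BarResolution

/-- A `k`-algebra `A i` for each `i`, an `A j`-`A i`-bimodule `M j i` for each `i < j` (the values
of `M` at the other pairs play no role), and associative products `M l j ⊗ M j i → M l i`
of bimodules, balanced over `A j`. -/
structure TriangularData (k : Type u) [Field k] (n : ℕ) where
  A : Fin n → Type u
  M : Fin n → Fin n → Type u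
  [ring : ∀ i, Ring (A i)]
  [algebra : ∀ i, Algebra k (A i)]
  [addCommGroup : ∀ j i, AddCommGroup (M j i)]
  [module : ∀ j i, Module k (M j i)]
  [leftModule : ∀ j i, Module (A j) (M j i)]
  [rightModule : ∀ j i, Module (A i)ᵐᵒᵖ (M j i)]
  [smulCommClass : ∀ j i, SMulCommClass (A j) (A i)ᵐᵒᵖ (M j i)]
  [leftTower : ∀ j i, IsScalarTower k (A j) (M j i)]
  [rightTower : ∀ j i, IsScalarTower k (A i)ᵐᵒᵖ (M j i)]
  mu : ∀ {l j i : Fin n}, i < j → j < l → M l j →ₗ[k] M j i →ₗ[k] M l i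
  mu_smul_left : ∀ {l j i : Fin n} (hij : i < j) (hjl : j < l) (a : A l) (x : M l j) (y : M j i),
    mu hij hjl (a • x) y = a • mu hij hjl x y
  mu_smul_right : ∀ {l j i : Fin n} (hij : i < j) (hjl : j < l) (a : A i) (x : M l j) (y : M j i),
    mu hij hjl x (op a • y) = op a • mu hij hjl x y
  mu_balanced : ∀ {l j i : Fin n} (hij : i < j) (hjl : j < l) (a : A j) (x : M l j) (y : M j i),
    mu hij hjl (op a • x) y = mu hij hjl x (a • y)
  mu_assoc : ∀ {m l j i : Fin n} (hij : i < j) (hjl : j < l) (hlm : l < m)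
    (x : M m l) (y : M l j) (z : M j i),
    mu hij (hjl.trans hlm) (mu hjl hlm x y) z = mu (hij.trans hjl) hlm x (mu hij hjl y z)

namespace TriangularData

variable {k : Type u} [Field k] {n : ℕ} (D : TriangularData k n)

attribute [instance] ring algebra addCommGroup module leftModule rightModule smulCommClass
  leftTower rightTower

/-- The pairs `(j, i)` with `i < j`. -/
abbrev Pair (n : ℕ) : Type := {p : Fin n × Fin n // p.2 < p.1}

/-- The triangular algebra: lower triangular matrices with diagonal entries `t.diag i ∈ A i` and
entries `t.off ⟨(j, i), _⟩ ∈ M j i` in row `j` and column `i`, for `i < j`. -/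
@[ext]
structure Alg where
  diag : ∀ i, D.A i
  off : ∀ p : Pair n, D.M p.1.1 p.1.2

namespace Alg

variable {D}

instance : Zero D.Alg := ⟨⟨0, 0⟩⟩
instance : One D.Alg := ⟨⟨1, 0⟩⟩
instance : Add D.Alg := ⟨fun s t => ⟨s.diag + t.diag, s.off + t.off⟩⟩
instance : Neg D.Alg := ⟨fun s => ⟨-s.diag, -s.off⟩⟩
instance : SMul k D.Alg := ⟨fun r s => ⟨r • s.diag, r • s.off⟩⟩

/-- Matrix multiplication. -/
instance : Mul D.Alg :=
  ⟨fun s t =>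
    { diag := s.diag * t.diag
      off := fun p => s.diag p.1.1 • t.off p + op (t.diag p.1.2) • s.off p +
        ∑ l : {l : Fin n // p.1.2 < l ∧ l < p.1.1},
          D.mu l.2.1 l.2.2 (s.off ⟨(p.1.1, l), l.2.2⟩) (t.off ⟨(l, p.1.2), l.2.1⟩) }⟩

@[simp] theorem diag_zero : (0 : D.Alg).diag = 0 := rfl
@[simp] theorem off_zero : (0 : D.Alg).off = 0 := rfl
@[simp] theorem diag_one : (1 : D.Alg).diag = 1 := rfl
@[simp] theorem off_one : (1 : D.Alg).off = 0 := rfl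
@[simp] theorem diag_add (s t : D.Alg) : (s + t).diag = s.diag + t.diag := rfl
@[simp] theorem off_add (s t : D.Alg) : (s + t).off = s.off + t.off := rfl
@[simp] theorem diag_neg (s : D.Alg) : (-s).diag = -s.diag := rfl
@[simp] theorem off_neg (s : D.Alg) : (-s).off = -s.off := rfl
@[simp] theorem diag_smul (r : k) (s : D.Alg) : (r • s).diag = r • s.diag := rfl
@[simp] theorem off_smul (r : k) (s : D.Alg) : (r • s).off = r • s.off := rfl
@[simp] theorem diag_mul (s t : D.Alg) : (s * t).diag = s.diag * t.diag := rfl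
theorem off_mul (s t : D.Alg) (p : Pair n) :
    (s * t).off p = s.diag p.1.1 • t.off p + op (t.diag p.1.2) • s.off p +
        ∑ l : {l : Fin n // p.1.2 < l ∧ l < p.1.1},
          D.mu l.2.1 l.2.2 (s.off ⟨(p.1.1, l), l.2.2⟩) (t.off ⟨(l, p.1.2), l.2.1⟩) := rfl

instance : AddCommGroup D.Alg where
  add_assoc _ _ _ := by ext <;> simp [add_assoc]
  zero_add _ := by ext <;> simp
  add_zero _ := by ext <;> simp
  add_comm _ _ := by ext <;> simp [add_comm]
  neg_add_cancel _ := by ext <;> simp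
  nsmul := nsmulRec
  zsmul := zsmulRec

instance : Module k D.Alg where
  one_smul _ := by ext <;> simp
  mul_smul _ _ _ := by ext <;> simp [mul_smul]
  smul_zero _ := by ext <;> simp
  smul_add _ _ _ := by ext <;> simp
  add_smul _ _ _ := by ext <;> simp [add_smul]
  zero_smul _ := by ext <;> simp

theorem mul_assoc' (s t r : D.Alg) : s * t * r = s * (t * r) := by
  ext p
  · simp [mul_assoc]
  obtain ⟨⟨j, i⟩, hij⟩ := p
  simp only [off_mul, diag_mul, Pi.mul_apply, map_add, map_sum, LinearMap.add_apply,
    LinearMap.sum_apply, smul_add, Finset.smul_sum, Finset.sum_add_distrib, mu_smul_left,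
    mu_smul_right, mu_balanced, mu_assoc, op_mul, mul_smul, smul_comm (s.diag j) (op (r.diag i))]
  have key : (∑ x : {l : Fin n // i < l ∧ l < j}, ∑ y : {l : Fin n // x.1 < l ∧ l < j},
      D.mu (x.2.1.trans y.2.1) y.2.2 (s.off ⟨(j, y.1), y.2.2⟩)
        (D.mu x.2.1 y.2.1 (t.off ⟨(y.1, x.1), y.2.1⟩) (r.off ⟨(x.1, i), x.2.1⟩))) =
      ∑ y : {l : Fin n // i < l ∧ l < j}, ∑ x : {l : Fin n // i < l ∧ l < y.1},
      D.mu y.2.1 y.2.2 (s.off ⟨(j, y.1), y.2.2⟩)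
        (D.mu x.2.1 x.2.2 (t.off ⟨(y.1, x.1), x.2.2⟩) (r.off ⟨(x.1, i), x.2.1⟩)) := by
    rw [← Fintype.sum_sigma', ← Fintype.sum_sigma']
    refine Finset.sum_bij' (fun z _ => ⟨⟨z.2.1, z.1.2.1.trans z.2.2.1, z.2.2.2⟩,
      ⟨z.1.1, z.1.2.1, z.2.2.1⟩⟩) (fun z _ => ⟨⟨z.2.1, z.2.2.1, z.2.2.2.trans z.1.2.2⟩,
      ⟨z.1.1, z.2.2.2, z.1.2.2⟩⟩) ?_ ?_ ?_ ?_ ?_ <;> simp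
  rw [key]
  abel

instance : Ring D.Alg where
  __ := (inferInstance : AddCommGroup D.Alg)
  left_distrib s t r := by
    ext p
    · simp [mul_add]
    · simp only [off_mul, off_add, diag_add, Pi.add_apply, smul_add, map_add, MulOpposite.op_add, add_smul,
        Finset.sum_add_distrib]
      abel
  right_distrib s t r := by
    ext p
    · simp [add_mul]
    · simp only [off_mul, off_add, diag_add, Pi.add_apply, smul_add, map_add, MulOpposite.op_add, add_smul,
        Finset.sum_add_distrib, LinearMap.add_apply]
      abel
  zero_mul s := by ext p <;> simp [off_mul]
  mul_zero s := by ext p <;> simp [off_mul]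
  mul_assoc := mul_assoc'
  one_mul s := by ext p <;> simp [off_mul]
  mul_one s := by ext p <;> simp [off_mul]
  zsmul := zsmulRec
  neg_add_cancel := neg_add_cancel

instance : Algebra k D.Alg :=
  Algebra.ofModule
    (fun r s t => by
      ext p
      · simp
      · simp only [off_mul, off_smul, diag_smul, Pi.smul_apply, smul_add, map_smul,
          LinearMap.smul_apply, Finset.smul_sum, smul_assoc,
          smul_comm (op (t.diag p.1.2)) r])
    (fun r s t => by
      ext p
      · simp
      · simp only [off_mul, off_smul, diag_smul, Pi.smul_apply, smul_add, map_smul, op_smul,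
          LinearMap.smul_apply, Finset.smul_sum, smul_assoc,
          smul_comm (s.diag p.1.1) r])

end Alg

/-- The element of `A i` as a diagonal matrix. -/
def ofDiag (i : Fin n) : D.A i →ₗ[k] D.Alg where
  toFun a := ⟨Pi.single i a, 0⟩
  map_add' a b := by ext <;> simp [Pi.single_add]
  map_smul' r a := by ext <;> simp [Pi.single_smul]

/-- The element of `M j i` as a matrix concentrated in position `(j, i)`. -/
def ofOff (p : Pair n) : D.M p.1.1 p.1.2 →ₗ[k] D.Alg where
  toFun m := ⟨0, Pi.single p m⟩
  map_add' a b := by ext <;> simp [Pi.single_add]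
  map_smul' r a := by ext <;> simp [Pi.single_smul]

/-- The idempotents `e i`. -/
def e (i : Fin n) : D.Alg := D.ofDiag i 1

theorem ofDiag_mul (i : Fin n) (a b : D.A i) :
    D.ofDiag i (a * b) = D.ofDiag i a * D.ofDiag i b := by
  ext p
  · simp [ofDiag, Pi.single_mul]
  · simp [ofDiag, Alg.off_mul]

theorem ofDiag_mul_ofOff (p : Pair n) (a : D.A p.1.1) (m : D.M p.1.1 p.1.2) :
    D.ofDiag _ a * D.ofOff p m = D.ofOff p (a • m) := by
  ext q
  · simp [ofDiag, ofOff]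
  · simp [ofDiag, ofOff, Alg.off_mul]
    by_cases h : q = p
    · subst h; simp
    · simp [h]

theorem ofOff_mul_ofDiag (p : Pair n) (a : D.A p.1.2) (m : D.M p.1.1 p.1.2) :
    D.ofOff p m * D.ofDiag _ a = D.ofOff p (op a • m) := by
  ext q
  · simp [ofDiag, ofOff]
  · simp [ofDiag, ofOff, Alg.off_mul]
    by_cases h : q = p
    · subst h; simp
    · simp [h]

section Bimodule

variable (X : Type u) [AddCommGroup X] [Module k X] [Module D.Alg X] [Module D.Algᵐᵒᵖ X]
  [SMulCommClass D.Alg D.Algᵐᵒᵖ X] [IsScalarTower k D.Alg X] [IsScalarTower k D.Algᵐᵒᵖ X]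

/-- `e_j X e_i`. -/
def corner (j i : Fin n) : Submodule k X where
  carrier := {x | D.e j • x = x ∧ op (D.e i) • x = x}
  add_mem' ha hb := ⟨by rw [smul_add, ha.1, hb.1], by rw [smul_add, ha.2, hb.2]⟩
  zero_mem' := by simp
  smul_mem' r x hx := ⟨by rw [smul_comm, hx.1], by rw [smul_comm, hx.2]⟩

variable {X} {D}

theorem e_smul_ofDiag_smul (j : Fin n) (a : D.A j) (x : X) :
    D.e j • D.ofDiag j a • x = D.ofDiag j a • x := by
  rw [e, smul_smul, ← ofDiag_mul, one_mul]

theorem op_e_smul_ofDiag_smul (i : Fin n) (a : D.A i) (x : X) :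
    op (D.e i) • op (D.ofDiag i a) • x = op (D.ofDiag i a) • x := by
  rw [e, smul_smul, ← op_mul, ← ofDiag_mul, mul_one]

instance (j i : Fin n) : Module (D.A j) (D.corner X j i) where
  smul a x := ⟨D.ofDiag j a • (x : X), e_smul_ofDiag_smul j a _, by
    rw [← smul_comm, x.2.2]⟩
  one_smul x := Subtype.ext x.2.1
  mul_smul a b x := Subtype.ext (by
    change D.ofDiag j (a * b) • (x : X) = D.ofDiag j a • D.ofDiag j b • (x : X)
    rw [ofDiag_mul, mul_smul])
  smul_zero a := Subtype.ext (smul_zero (D.ofDiag j a))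
  smul_add a x y := Subtype.ext (smul_add (D.ofDiag j a) (x : X) y)
  add_smul a b x := Subtype.ext (by
    change D.ofDiag j (a + b) • (x : X) = D.ofDiag j a • (x : X) + D.ofDiag j b • (x : X)
    rw [map_add, add_smul])
  zero_smul x := Subtype.ext (by
    change D.ofDiag j 0 • (x : X) = 0
    rw [map_zero, zero_smul])

instance (j i : Fin n) : Module (D.A i)ᵐᵒᵖ (D.corner X j i) where
  smul a x := ⟨op (D.ofDiag i a.unop) • (x : X), by
    rw [smul_comm, x.2.1], op_e_smul_ofDiag_smul i _ _⟩
  one_smul x := Subtype.ext x.2.2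
  mul_smul a b x := Subtype.ext (by
    change op (D.ofDiag i (b.unop * a.unop)) • (x : X) =
      op (D.ofDiag i a.unop) • op (D.ofDiag i b.unop) • (x : X)
    rw [ofDiag_mul, op_mul, mul_smul])
  smul_zero a := Subtype.ext (smul_zero (op (D.ofDiag i a.unop)))
  smul_add a x y := Subtype.ext (smul_add (op (D.ofDiag i a.unop)) (x : X) y)
  add_smul a b x := Subtype.ext (by
    change op (D.ofDiag i (a.unop + b.unop)) • (x : X) =
      op (D.ofDiag i a.unop) • (x : X) + op (D.ofDiag i b.unop) • (x : X)
    rw [map_add, MulOpposite.op_add, add_smul])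
  zero_smul x := Subtype.ext (by
    change op (D.ofDiag i 0) • (x : X) = 0
    rw [map_zero, op_zero, zero_smul])

theorem coe_smul (j i : Fin n) (a : D.A j) (x : D.corner X j i) :
    ((a • x : D.corner X j i) : X) = D.ofDiag j a • (x : X) := rfl

theorem coe_op_smul (j i : Fin n) (a : D.A i) (x : D.corner X j i) :
    ((op a • x : D.corner X j i) : X) = op (D.ofDiag i a) • (x : X) := rfl

instance (j i : Fin n) : SMulCommClass (D.A j) (D.A i)ᵐᵒᵖ (D.corner X j i) :=
  ⟨fun a b x => Subtype.ext (smul_comm (D.ofDiag j a) (op (D.ofDiag i b.unop)) (x : X))⟩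

instance (j i : Fin n) : IsScalarTower k (D.A j) (D.corner X j i) :=
  ⟨fun r a x => Subtype.ext (by
    change D.ofDiag j (r • a) • (x : X) = r • D.ofDiag j a • (x : X)
    rw [map_smul, smul_assoc])⟩

instance (j i : Fin n) : IsScalarTower k (D.A i)ᵐᵒᵖ (D.corner X j i) :=
  ⟨fun r a x => Subtype.ext (by
    change op (D.ofDiag i (r • a.unop)) • (x : X) = r • op (D.ofDiag i a.unop) • (x : X)
    rw [map_smul, op_smul, smul_assoc])⟩

/-- The action of `M j i` on the left, `M j i × e_i X e_h → e_j X e_h`, from the action of the triangular algebra. -/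
def leftMul (p : Pair n) (h : Fin n) (m : D.M p.1.1 p.1.2) (x : D.corner X p.1.2 h) :
    D.corner X p.1.1 h :=
  ⟨D.ofOff p m • (x : X), by
    rw [e, smul_smul, ofDiag_mul_ofOff, one_smul], by rw [← smul_comm, x.2.2]⟩

/-- The right action `e_h X e_j × M j i → e_h X e_i`. -/
def rightMul (p : Pair n) (h : Fin n) (x : D.corner X h p.1.1) (m : D.M p.1.1 p.1.2) :
    D.corner X h p.1.2 :=
  ⟨op (D.ofOff p m) • (x : X), by rw [smul_comm, x.2.1], by
    rw [e, smul_smul, ← op_mul, ofOff_mul_ofDiag, op_one, one_smul]⟩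

variable (D) in
theorem e_mul_e (i : Fin n) : D.e i * D.e i = D.e i := by
  rw [e, ← ofDiag_mul, one_mul]

variable (D X) in
/-- The projection `x ↦ e_j x e_i` of `X` onto `e_j X e_i`. -/
def proj (j i : Fin n) : X →ₗ[k] D.corner X j i where
  toFun x := ⟨D.e j • op (D.e i) • x, by rw [smul_smul, e_mul_e], by
    rw [← smul_comm, smul_smul (op (D.e i)), ← op_mul, e_mul_e]⟩
  map_add' x y := Subtype.ext (by simp)
  map_smul' r x := Subtype.ext (by
    simp [smul_comm _ r])

end Bimodule

end TriangularData

namespace BarResolution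

variable {k L A : Type u} [Field k] [Ring L] [Algebra k L] [Ring A] [Algebra k A]

/-- The element `1 ⊗ b₁ ⊗ ⋯ ⊗ b_q ⊗ m ⊗ a₁ ⊗ ⋯ ⊗ a_p ⊗ 1` of the bar resolution of an
`L`-`A`-bimodule `M` in degree `q + p`. Since right `A`-modules are left `Aᵐᵒᵖ`-modules, the
factors `a₁, …, a_p` are added to `m` from the left in this order. -/
noncomputable def barWord (M : ModuleCat.{u} (L ⊗[k] Aᵐᵒᵖ)) {q p : ℕ} (b : Fin q → L) (m : M)
    (a : Fin p → A) : P M q p :=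
  tm (I := left k L Aᵐᵒᵖ) 1 (word (left k L Aᵐᵒᵖ) b
    (tm (I := right k L Aᵐᵒᵖ) 1 (word (right k L Aᵐᵒᵖ) (fun i => op (a (Fin.rev i))) m) :
      (F (right k L Aᵐᵒᵖ)).obj ((pow (right k L Aᵐᵒᵖ) p).obj M)))

/-- A family of maps `L^{⊗ q} ⊗ M ⊗ A^{⊗ p} → Y`, for `q + p = l`, written on pure tensors. -/
abbrev BarCochain (M Y : ModuleCat.{u} (L ⊗[k] Aᵐᵒᵖ)) (l : ℕ) : Type u :=
  ∀ q p : ℕ, q + p = l → (Fin q → L) → M → (Fin p → A) → Y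

/-- The class `x ∈ Ext^l(M, Y)` is represented by the cochain `φ`: the bimodule map `ψ` from the
degree `l` term of the bar resolution of `M` to `Y` that corresponds to `φ`, that is, with
`ψ(1 ⊗ b₁ ⊗ ⋯ ⊗ b_q ⊗ m ⊗ a₁ ⊗ ⋯ ⊗ a_p ⊗ 1) = φ(b₁, …, b_q, m, a₁, …, a_p)`, exists (it is then
unique), is a cocycle, and `x` is its class. -/
def IsExtClass {M Y : ModuleCat.{u} (L ⊗[k] Aᵐᵒᵖ)} {l : ℕ} (φ : BarCochain M Y l)
    (x : Abelian.Ext M Y l) : Prop :=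
  ∃ (ψ : (barResolution M).complex.X l ⟶ Y)
    (hψ : (barResolution M).complex.d (l + 1) l ≫ ψ = 0),
    (∀ (q p : ℕ) (h : q + p = l) (b : Fin q → L) (m : M) (a : Fin p → A),
      ψ.hom (Pi.single (M := fun x : Finset.HasAntidiagonal.antidiagonal l => P M x.1.1 x.1.2)
        ⟨(q, p), Finset.HasAntidiagonal.mem_antidiagonal.2 h⟩ (barWord M b m a)) = φ q p h b m a) ∧
    (barResolution M).extMk ψ (l + 1) rfl hψ = x

end BarResolution

namespace TriangularData

variable {k : Type u} [Field k] {n : ℕ} (D : TriangularData k n)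

/-- The subalgebra `R` of diagonal matrices with entries in `k`. -/
def scalar (r : Fin n → k) : D.Alg := ⟨fun i => algebraMap k (D.A i) (r i), 0⟩

/-- `e_j T e_i`, which is `A j` if `j = i`, and `M j i` if `i < j`. -/
def block (j i : Fin n) : Set D.Alg := {t | D.e j * t = t ∧ t * D.e i = t}

/-- The bimodule `M j i` as a module over `A j ⊗ (A i)ᵐᵒᵖ`. -/
noncomputable def modM (p : Pair n) : ModuleCat.{u} (D.A p.1.1 ⊗[k] (D.A p.1.2)ᵐᵒᵖ) :=
  @ModuleCat.of _ _ (D.M p.1.1 p.1.2) _ TensorProduct.Algebra.module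

variable (X : Type u) [AddCommGroup X] [Module k X] [Module D.Alg X] [Module D.Algᵐᵒᵖ X]
  [SMulCommClass D.Alg D.Algᵐᵒᵖ X] [IsScalarTower k D.Alg X] [IsScalarTower k D.Algᵐᵒᵖ X]

/-- The bimodule `e_j X e_i` as a module over `A j ⊗ (A i)ᵐᵒᵖ`. -/
noncomputable def modX (p : Pair n) : ModuleCat.{u} (D.A p.1.1 ⊗[k] (D.A p.1.2)ᵐᵒᵖ) :=
  @ModuleCat.of _ _ (D.corner X p.1.1 p.1.2) _ TensorProduct.Algebra.module

/-- The relative cochains `Hom_{R-R}(T^{⊗_R m}, X)`, as `R`-balanced `R`-bilinear multilinear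
maps on `T^m`; for `m = 0` they are `X^R = {x | r x = x r for r ∈ R}`. -/
def relative (m : ℕ) : Submodule k (Hochschild.Cochain k D.Alg X m) where
  carrier := {f |
    (∀ (r : Fin n → k) (t : Fin m → D.Alg) (i : Fin m), (i : ℕ) = 0 →
      f (Function.update t i (D.scalar r * t i)) = D.scalar r • f t) ∧
    (∀ (r : Fin n → k) (t : Fin m → D.Alg) (i : Fin m), (i : ℕ) + 1 = m →
      f (Function.update t i (t i * D.scalar r)) = op (D.scalar r) • f t) ∧
    (∀ (r : Fin n → k) (t : Fin m → D.Alg) (i j : Fin m), (i : ℕ) + 1 = j →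
      f (Function.update t i (t i * D.scalar r)) = f (Function.update t j (D.scalar r * t j))) ∧
    (∀ (r : Fin n → k) (t : Fin m → D.Alg), m = 0 → D.scalar r • f t = op (D.scalar r) • f t)}
  add_mem' := by
    rintro f g ⟨h1, h2, h3, h4⟩ ⟨h1', h2', h3', h4'⟩
    refine ⟨fun r t i h => ?_, fun r t i h => ?_, fun r t i j h => ?_, fun r t h => ?_⟩
    · simp only [add_apply, smul_add, h1 r t i h, h1' r t i h]
    · simp only [add_apply, smul_add, h2 r t i h, h2' r t i h]
    · simp only [add_apply, h3 r t i j h, h3' r t i j h]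
    · simp only [add_apply, smul_add, h4 r t h, h4' r t h]
  zero_mem' := by simp
  smul_mem' := by
    rintro c f ⟨h1, h2, h3, h4⟩
    refine ⟨fun r t i h => ?_, fun r t i h => ?_, fun r t i j h => ?_, fun r t h => ?_⟩
    · simp only [smul_apply, h1 r t i h, smul_comm _ c]
    · simp only [smul_apply, h2 r t i h, smul_comm _ c]
    · simp only [smul_apply, h3 r t i j h]
    · rw [smul_apply, smul_comm, h4 r t h, smul_comm]

/-- The length of the trajectory of `m` consecutive paths `v (i + 1) → v i` in the quiver
`1 → 2 → ⋯ → n`: the number of these paths that have nonzero length. -/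
def length {m : ℕ} (v : Fin (m + 1) → Fin n) : ℕ :=
  (Finset.univ.filter fun i : Fin m => v i.castSucc ≠ v i.succ).card

/-- The filtration of the relative cochains by the length of trajectories: `F^t` consists of the
cochains that vanish on the summands `M_τ` of `T^{⊗_R m}` with `|τ| < t`. A trajectory is given by
its vertices `v 0 ≥ v 1 ≥ ⋯ ≥ v m`, and its summand is spanned by the tensors
`t₁ ⊗ ⋯ ⊗ t_m` with `tᵢ ∈ e_{v (i - 1)} T e_{v i}`. -/
def filtration (t m : ℕ) : Submodule k (Hochschild.Cochain k D.Alg X m) :=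
  D.relative X m ⊓
  { carrier := {f | ∀ v : Fin (m + 1) → Fin n, Antitone v → length v < t →
      ∀ x : Fin m → D.Alg, (∀ i, x i ∈ D.block (v i.castSucc) (v i.succ)) → f x = 0}
    add_mem' := fun hf hg v hv hl x hx => by
      rw [add_apply, hf v hv hl x hx, hg v hv hl x hx, add_zero]
    zero_mem' := fun _ _ _ _ _ => rfl
    smul_mem' := fun c f hf v hv hl x hx => by
      rw [smul_apply, hf v hv hl x hx, smul_zero] }

/-- The term `E_1^{t, m - t}` of the spectral sequence of the filtration. -/
abbrev E₁ (t m : ℕ) : Type u :=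
  FilteredComplex.E₁ (Hochschild.coboundary k D.Alg X) (D.filtration X) t m

/-- The differential `E_1^{t, m - t} → E_1^{t + 1, m - t}`. -/
def d₁ (t m : ℕ) : D.E₁ X t m →ₗ[k] D.E₁ X (t + 1) (m + 1) :=
  FilteredComplex.d₁ _ _ (fun _ f => Hochschild.coboundary_coboundary f) t m

/-- `HH^l(A j, e_j X e_j)`. -/
abbrev HH (l : ℕ) (j : Fin n) : Type u := Hochschild.HH k (D.A j) (D.corner X j j) l

/-- `Ext^l(M j i, e_j X e_i)` in the category of `A j`-`A i`-bimodules. -/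
abbrev Ext (l : ℕ) (p : Pair n) : Type u := Abelian.Ext (D.modM p) (D.modX X p) l

variable {X} {D}

/-- The restriction `A j^{⊗ l} → e_j X e_j` of a cochain (for `l = 0`, the component of `f()` in
`e_j X e_j`). -/
def restrictDiag {l : ℕ} (f : Hochschild.Cochain k D.Alg X l) (j : Fin n) :
    Hochschild.Cochain k (D.A j) (D.corner X j j) l :=
  (D.proj X j j).compMultilinearMap (f.compLinearMap fun _ => D.ofDiag j)

/-- The restrictions `A j^{⊗ q} ⊗ M j i ⊗ A i^{⊗ r} → e_j X e_i`, `q + r = l`, of a cochain of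
degree `l + 1`. -/
def restrictOff {l : ℕ} (f : Hochschild.Cochain k D.Alg X (l + 1)) (p : Pair n) :
    BarResolution.BarCochain (D.modM p) (D.modX X p) l := fun q r h b m a =>
  D.proj X p.1.1 p.1.2 (f (Fin.append (Fin.append (fun i => D.ofDiag p.1.1 (b i))
    (fun _ : Fin 1 => D.ofOff p m)) (fun i => D.ofDiag p.1.2 (a i)) ∘
      Fin.cast (by omega : l + 1 = q + 1 + r)))

/-- The cup product `θ ⌣ f : M j i ⊗ A i^{⊗ l} → e_j X e_i`,
`(m, a₁, …, a_l) ↦ θ(m) f(a₁, …, a_l)`. -/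
noncomputable def cupLeft {l : ℕ} (p : Pair n) (θ : D.modM p ⟶ D.modM p)
    (f : Hochschild.Cochain k (D.A p.1.2) (D.corner X p.1.2 p.1.2) l) :
    BarResolution.BarCochain (D.modM p) (D.modX X p) l
  | 0, _, h, _, m, a => leftMul p p.1.2 (θ.hom m) (f (a ∘ Fin.cast (by omega)))
  | _ + 1, _, _, _, _, _ => 0

/-- The cup product `f ⌣ θ : A j^{⊗ l} ⊗ M j i → e_j X e_i`,
`(b₁, …, b_l, m) ↦ f(b₁, …, b_l) θ(m)`. -/
noncomputable def cupRight {l : ℕ} (p : Pair n) (f : Hochschild.Cochain k (D.A p.1.1) (D.corner X p.1.1 p.1.1) l)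
    (θ : D.modM p ⟶ D.modM p) : BarResolution.BarCochain (D.modM p) (D.modX X p) l
  | _, 0, h, b, m, _ => rightMul p p.1.1 (f (b ∘ Fin.cast (by omega))) (θ.hom m)
  | _, _ + 1, _, _, _, _ => 0

end TriangularData

/-! The first two graded pieces of the filtration are familiar complexes. A sequence of length 0 is
constant, and its summand is `A j ⊗ ⋯ ⊗ A j`; a decreasing sequence of length 1 drops exactly once,
from `j` to some `i < j`, and its summand consists of words `b₁, …, b_q, m, a₁, …, a_r` with a
single entry in `M j i`. So `F⁰/F¹` is the product of the Hochschild complexes of the `A j`, and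
`F¹/F²` is the product over the pairs of the complexes of bimodule maps from the bar resolution of
`M j i` to `e_j X e_i`, shifted by one degree.

To make this precise, each step of the filtration is described as a kernel of restrictions
(`mem_filtration_one`, `mem_filtration_two`). The restrictions are compatible with the
differentials: `restrictDiag_coboundary` holds for all cochains, and `offHom_coboundary` holds on
`F¹`, where the outer faces without a counterpart in the bar resolution vanish. Every family of
cochains on the pieces is a restriction, since it can be extended by zero to the triangular algebra
(`extendDiagSum`, `offExtendSum`). Given these facts, a cycle has trivial class in `E₁` exactly if
its restrictions have trivial classes, and all classes occur; this yields `diagEquiv` and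
`offEquiv`.

The bar resolution enters through words: the terms `P M q p` are spanned by pure tensors, bimodule
maps out of them are multilinear maps (`barLift`), and the differential on words is an alternating
sum of contractions. The right algebra acts through its opposite, so its factors are stored in
reversed order; with the sign `(-1)^l` of the total differential, the terms match those of the
Hochschild coboundary.

For `d₁`, cocycles `g j` are extended to the triangular algebra along the diagonal entries and the
coboundary is evaluated on a word with one entry `m` in `M j i`. All inner contractions vanish,
because the strictly triangular matrices form an ideal and the extension depends only on diagonals.
The first face survives only if `m` stands first and gives `m f(a)`; the last face survives only if
`m` stands last and gives `f(b) m` with the sign `(-1)^(l+1)`. This is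
`restrictOff_coboundary_extendDiagSum`.

The two cup product maps on cohomology are taken to be the components of `d₁`, up to that sign.
Linearity, independence of representatives and the cocycle property then come with `d₁`, and what
has to be shown is only that these components are represented by the cup product cochains. -/

set_option linter.unusedSectionVars false

/-! ### Ext classes given by cocycles on a projective resolution: degree 0 and scalars. -/

namespace CategoryTheory.ProjectiveResolution

open CochainComplex HomComplex Abelian

universe w v u'

variable {C : Type u'} [Category.{v} C] [Abelian C] [HasExt.{w} C]
  {X Y : C} (R : ProjectiveResolution X) {n : ℕ}

/-- There are no coboundaries in degree 0: a bounding cochain would start at the term of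
cohomological degree 1 of the resolution, and that term is zero. -/
theorem extMk_zero_eq_zero_iff (f : R.complex.X 0 ⟶ Y) (m : ℕ) (hm : 0 + 1 = m)
    (hf : R.complex.d m 0 ≫ f = 0) : R.extMk f m hm hf = 0 ↔ f = 0 := by
  simp only [← R.extEquivCohomologyClass.apply_eq_iff_eq,
    extEquivCohomologyClass_extMk, extEquivCohomologyClass_zero,
    CohomologyClass.mk_eq_zero_iff]
  rw [Cocycle.toSingleMk_mem_coboundaries_iff _ _ _ _ _ 1 (by simp)]
  have h0 : Limits.IsZero (R.cochainComplex.X 1) :=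
    CochainComplex.isZero_of_isStrictlyLE _ 0 _
  constructor
  · rintro ⟨g, hg⟩
    rw [h0.eq_of_src g 0, Limits.comp_zero] at hg
    rw [← cancel_epi (R.cochainComplexXIso (-(0 : ℕ)) 0 rfl).hom, ← hg, Limits.comp_zero]
  · rintro rfl
    exact ⟨0, by simp⟩

theorem smul_extMk {k : Type*} [Ring k] [Linear k C] (r : k) (f : R.complex.X n ⟶ Y) (m : ℕ)
    (hm : n + 1 = m) (hf : R.complex.d m n ≫ f = 0) :
    r • R.extMk f m hm hf = R.extMk (r • f) m hm (by rw [Linear.comp_smul, hf, smul_zero]) := by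
  rw [Ext.smul_eq_comp_mk₀, extMk_comp_mk₀]
  congr 1
  simp

end CategoryTheory.ProjectiveResolution

/-! ### Words in the one-sided bar construction and the bar differential on them. -/

namespace BarResolution

open scoped ModuleCat

section Words

variable {k B S : Type u} [Field k] [Ring B] [Algebra k B] [Ring S] [Algebra k S]
  (I : Induction k B S) {N : ModuleCat.{u} S} {Y : Type*} [AddCommGroup Y] [Module k Y]

/-- Two `k`-structures meet on `B ⊗ N`: the one of the tensor product and the one obtained from the
`S`-action along `k → S`. They agree because the coaction is a map of `k`-algebras. -/
theorem smul_ind_eq (r : k) (x : B ⊗[k] N) :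
    (r • (show (F I).obj N from x) : (F I).obj N) = (r • x : B ⊗[k] N) := by
  change act N (I.Δ (algebraMap k S r)) x = _
  rw [AlgHom.commutes, AlgHom.commutes]
  rfl

/-- `k`-linear maps out of `B ⊗ N`. -/
noncomputable def indLift (g : B →ₗ[k] N →ₗ[k] Y) : (F I).obj N →ₗ[k] Y where
  toFun x := TensorProduct.lift g x
  map_add' x y := map_add (TensorProduct.lift g) x y
  map_smul' r x := (congrArg (TensorProduct.lift g) (smul_ind_eq I r x)).trans
    ((TensorProduct.lift g).map_smul r (show B ⊗[k] N from x))

/-- The map `b ↦ n ↦ b ⊗ n`. -/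
noncomputable def tmₗ (N : ModuleCat.{u} S) : B →ₗ[k] N →ₗ[k] (F I).obj N :=
  LinearMap.mk₂ k (fun b n => tm (I := I) b n)
    (fun b b' n => TensorProduct.add_tmul b b' n)
    (fun r b n => (TensorProduct.smul_tmul' r b n).symm.trans (smul_ind_eq I r (b ⊗ₜ n)).symm)
    (fun b n n' => TensorProduct.tmul_add b n n')
    (fun r b n => (TensorProduct.tmul_smul r b n).trans (smul_ind_eq I r (b ⊗ₜ n)).symm)

theorem indLift_tmₗ (g : B →ₗ[k] N →ₗ[k] Y) (b : B) (n : N) :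
    indLift I g (tmₗ I N b n) = g b n :=
  TensorProduct.lift.tmul _ _

theorem addHom_ext_tmₗ {G : Type*} [AddCommGroup G] {f g : (F I).obj N →+ G}
    (h : ∀ b n, f (tmₗ I N b n) = g (tmₗ I N b n)) : f = g :=
  ind_ext I h

theorem linearMap_ext_tmₗ {f g : (F I).obj N →ₗ[k] Y}
    (h : ∀ b n, f (tmₗ I N b n) = g (tmₗ I N b n)) : f = g :=
  LinearMap.toAddMonoidHom_injective (addHom_ext_tmₗ I h)

variable (k B S N Y) in
/-- Prefixing a factor `B`, on `k`-linear maps. -/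
noncomputable def indLiftₗ : (B →ₗ[k] N →ₗ[k] Y) →ₗ[k] ((F I).obj N →ₗ[k] Y) where
  toFun := indLift I
  map_add' f g := linearMap_ext_tmₗ I fun b n => by simp only [indLift_tmₗ, LinearMap.add_apply]
  map_smul' r g := linearMap_ext_tmₗ I fun b n => by
    simp only [indLift_tmₗ, LinearMap.smul_apply, RingHom.id_apply]

/-- `tmₗ` on `B ⊗ ⋯ ⊗ B ⊗ N`. -/
noncomputable def consₗ (N : ModuleCat.{u} S) (q : ℕ) :
    B →ₗ[k] (pow I q).obj N →ₗ[k] (pow I (q + 1)).obj N :=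
  tmₗ I ((pow I q).obj N)

/-- `word` as a multilinear map. -/
noncomputable def wordₗ (N : ModuleCat.{u} S) :
    ∀ q : ℕ, MultilinearMap k (fun _ : Fin q => B) (N →ₗ[k] (pow I q).obj N)
  | 0 => MultilinearMap.constOfIsEmpty k _ LinearMap.id
  | q + 1 => LinearMap.uncurryLeft (M := fun _ => B)
      { toFun := fun b => (LinearMap.llcomp k N ((pow I q).obj N) ((pow I (q + 1)).obj N)
          (consₗ I N q b)).compMultilinearMap (wordₗ N q)
        map_add' := fun b b' => by
          rw [map_add, map_add]; rfl
        map_smul' := fun r b => by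
          rw [map_smul, map_smul]; rfl }

theorem wordₗ_succ {q : ℕ} (b : Fin (q + 1) → B) (n : N) :
    wordₗ I N (q + 1) b n = consₗ I N q (b 0) (wordₗ I N q (Fin.tail b) n) := by
  rw [wordₗ]
  rfl

theorem tmₗ_wordₗ (s : B) {q : ℕ} (b : Fin q → B) (n : N) :
    tmₗ I ((pow I q).obj N) s (wordₗ I N q b n) = wordₗ I N (q + 1) (Fin.cons s b) n :=
  (wordₗ_succ I (Fin.cons s b) n).symm

theorem wordₗ_zero (b : Fin 0 → B) (n : N) : wordₗ I N 0 b n = n := by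
  rw [wordₗ]
  rfl

theorem wordₗ_apply {q : ℕ} (b : Fin q → B) (n : N) : wordₗ I N q b n = word I b n := by
  induction q with
  | zero => exact wordₗ_zero I b n
  | succ q ih =>
    rw [wordₗ_succ, ih]
    rfl

variable (k B S N Y) in
/-- `k`-linear maps out of `B ⊗ ⋯ ⊗ B ⊗ N`. -/
noncomputable def wordLift : ∀ q : ℕ, MultilinearMap k (fun _ : Fin q => B) (N →ₗ[k] Y) →ₗ[k]
    ((pow I q).obj N →ₗ[k] Y)
  | 0 =>
    { toFun := fun φ => φ 0
      map_add' := fun _ _ => rfl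
      map_smul' := fun _ _ => rfl }
  | q + 1 => indLiftₗ k B S I ((pow I q).obj N) Y ∘ₗ
    { toFun := fun φ => wordLift q ∘ₗ φ.curryLeft
      map_add' := fun φ φ' => LinearMap.ext fun b =>
        (wordLift q).map_add (φ.curryLeft b) (φ'.curryLeft b)
      map_smul' := fun r φ => LinearMap.ext fun b =>
        (wordLift q).map_smul r (φ.curryLeft b) }

theorem wordLift_wordₗ {q : ℕ} (φ : MultilinearMap k (fun _ : Fin q => B) (N →ₗ[k] Y))
    (b : Fin q → B) (n : N) : wordLift k B S I N Y q φ (wordₗ I N q b n) = φ b n := by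
  induction q with
  | zero =>
    rw [wordLift, wordₗ_zero, Subsingleton.elim b 0]
    rfl
  | succ q ih =>
    rw [wordLift, wordₗ_succ]
    refine (indLift_tmₗ I _ _ _).trans ((ih (φ.curryLeft (b 0)) (Fin.tail b)).trans ?_)
    rw [MultilinearMap.curryLeft_apply, Fin.cons_self_tail]

/-- Stated for additive maps, so that it also applies to composites with the action of a fixed ring
element, which need not be linear. -/
theorem addHom_ext_wordₗ {G : Type*} [AddCommGroup G] {q : ℕ} {f g : (pow I q).obj N →+ G}
    (h : ∀ b n, f (wordₗ I N q b n) = g (wordₗ I N q b n)) : f = g := by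
  induction q with
  | zero =>
    ext n
    have h0 := wordₗ_zero I (N := N) 0 n
    exact (congrArg f h0).symm.trans ((h 0 n).trans (congrArg g h0))
  | succ q ih =>
    refine addHom_ext_tmₗ I fun b y => ?_
    have := ih (f := f.comp (tmₗ I ((pow I q).obj N) b).toAddMonoidHom)
      (g := g.comp (tmₗ I ((pow I q).obj N) b).toAddMonoidHom) fun t n => by
        have := h (Fin.cons b t) n
        rw [wordₗ_succ] at this
        exact this
    exact DFunLike.congr_fun this y

theorem smul_tmₗ_of_coact {s s' : S} (b : B) (hs : I.Δ s = b ⊗ₜ s') (b' : B) (n : N) :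
    s • tmₗ I N b' n = tmₗ I N (b * b') (s' • n) := by
  refine (smul_def I N s _).trans ?_
  rw [hs]
  exact act_tmul N b b' s' n

/-- An element whose coaction has trivial `B`-part commutes past all factors `B` and reaches `N`.
This is how one algebra acts through the tensor factors of the other. -/
theorem smul_wordₗ {q : ℕ} {s : S} (hs : I.Δ s = 1 ⊗ₜ s) (b : Fin q → B) (n : N) :
    s • wordₗ I N q b n = wordₗ I N q b (s • n) := by
  induction q with
  | zero => rw [wordₗ_zero, wordₗ_zero]; rfl
  | succ q ih =>
    rw [wordₗ_succ, wordₗ_succ, ← ih]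
    exact (smul_tmₗ_of_coact I 1 hs _ _).trans (by rw [one_mul]; rfl)

theorem aug_tmₗ (b : B) (n : N) : aug I N (tmₗ I N b n) = I.ι b • n := eps_tm I N b n

theorem F_map_tmₗ {N' : ModuleCat.{u} S} (f : N ⟶ N') (b : B) (n : N) :
    (F I).map f (tmₗ I N b n) = tmₗ I N' b (f n) := indMap_tm I f.hom b n

theorem pow_map_wordₗ {N' : ModuleCat.{u} S} (f : N ⟶ N') {q : ℕ} (b : Fin q → B) (n : N) :
    (pow I q).map f (wordₗ I N q b n) = wordₗ I N' q b (f n) := by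
  induction q with
  | zero => rw [wordₗ_zero, wordₗ_zero]; rfl
  | succ q ih =>
    rw [wordₗ_succ, wordₗ_succ, ← ih]
    exact F_map_tmₗ I _ _ _

/-- The condition `hI` says that `ι b` acts on `B ⊗ N` by multiplying the outermost factor only, so
the augmentation multiplies the first two factors of a word. The recursion in `bar` subtracts the
differential of the remaining word, which shifts the contractions by one and reverses their signs.
-/
theorem bar_wordₗ (hI : ∀ b, I.Δ (I.ι b) = b ⊗ₜ 1) {q : ℕ} (b : Fin (q + 1) → B) (n : N) :
    bar I N q (wordₗ I N (q + 1) b n) =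
      ∑ i : Fin q, ((-1 : k) ^ (i : ℕ)) • wordₗ I N q (Fin.contractNth i.castSucc (· * ·) b) n +
        ((-1 : k) ^ q) • wordₗ I N q (Fin.init b) (I.ι (b (Fin.last q)) • n) := by
  induction q with
  | zero =>
    rw [Fin.sum_univ_zero, zero_add ((_ : k) • _), pow_zero, one_smul, wordₗ_zero, wordₗ_succ,
      wordₗ_zero]
    exact aug_tmₗ I _ _
  | succ q ih =>
    have h2 : aug I ((F I).obj ((pow I q).obj N)) (wordₗ I N (q + 1 + 1) b n) =
        wordₗ I N (q + 1) (Fin.contractNth (Fin.castSucc 0) (· * ·) b) n := by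
      rw [wordₗ_succ, wordₗ_succ, wordₗ_succ]
      refine (aug_tmₗ I _ _).trans ((smul_tmₗ_of_coact I _ (hI _) _ _).trans ?_)
      rw [one_smul]
      rfl
    have h3 : (F I).map (bar I N q) (wordₗ I N (q + 1 + 1) b n) =
        consₗ I N q (b 0) (bar I N q (wordₗ I N (q + 1) (Fin.tail b) n)) := by
      rw [wordₗ_succ]
      exact F_map_tmₗ I _ _ _
    have h1 : bar I N (q + 1) (wordₗ I N (q + 1 + 1) b n) =
        wordₗ I N (q + 1) (Fin.contractNth (Fin.castSucc 0) (· * ·) b) n -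
          consₗ I N q (b 0) (bar I N q (wordₗ I N (q + 1) (Fin.tail b) n)) :=
      congrArg₂ (fun x y : (pow I (q + 1)).obj N => x - y) h2 h3
    rw [h1, ih, Fin.sum_univ_succ, map_add, map_sum]
    refine (sub_eq_add_neg _ _).trans (Eq.trans ?_ (add_assoc _ _ _).symm)
    congr 1
    · rw [Fin.val_zero, pow_zero, one_smul]
    · rw [neg_add, ← Finset.sum_neg_distrib]
      congr 1
      · refine Finset.sum_congr rfl fun i _ => ?_
        have : Fin.tail (Fin.contractNth i.succ.castSucc (· * ·) b) =
            Fin.contractNth i.castSucc (· * ·) (Fin.tail b) := by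
          ext r
          simp [Fin.tail, Fin.contractNth]
        rw [map_smul, wordₗ_succ, Fin.val_succ, pow_succ, mul_neg_one, neg_smul, this]
        rfl
      · rw [map_smul, wordₗ_succ, pow_succ, mul_neg_one, neg_smul]
        rfl

/-- The bar differential, with values in `B ⊗ (B ⊗ ⋯ ⊗ B ⊗ N)`. -/
noncomputable def barSucc (N : ModuleCat.{u} S) (q : ℕ) :
    (F I).obj ((pow I (q + 1)).obj N) ⟶ (F I).obj ((pow I q).obj N) :=
  bar I N (q + 1)

/-- Words with leading factor `1` generate the bar term as a module. On such a word the contraction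
at the leading place creates no product: it makes `b 0` the new outer factor, and this term later
becomes a face with a module action. -/
theorem barSucc_tmₗ (hI : ∀ b, I.Δ (I.ι b) = b ⊗ₜ 1) {q : ℕ} (b : Fin (q + 1) → B) (n : N) :
    barSucc I N q (tmₗ I ((pow I (q + 1)).obj N) 1 (wordₗ I N (q + 1) b n)) =
      tmₗ I ((pow I q).obj N) (b 0) (wordₗ I N q (Fin.tail b) n) +
      ∑ i : Fin q, ((-1 : k) ^ (i + 1 : ℕ)) • tmₗ I ((pow I q).obj N) 1
        (wordₗ I N q (Fin.contractNth i.castSucc (· * ·) b) n) +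
      ((-1 : k) ^ (q + 1)) • tmₗ I ((pow I q).obj N) 1
        (wordₗ I N q (Fin.init b) (I.ι (b (Fin.last q)) • n)) := by
  have h0 : Fin.contractNth (Fin.castSucc 0) (· * ·) (Fin.cons 1 b : Fin (q + 2) → B) =
      Fin.cons (b 0) (Fin.tail b) := by
    ext r
    cases r using Fin.cases <;> simp [Fin.contractNth, Fin.tail]
  have h1 : ∀ i : Fin q, Fin.contractNth i.succ.castSucc (· * ·) (Fin.cons 1 b : Fin (q + 2) → B) =
      Fin.cons 1 (Fin.contractNth i.castSucc (· * ·) b) := by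
    intro i
    ext r
    cases r using Fin.cases <;> simp [Fin.contractNth]
  have h2 : Fin.init (Fin.cons 1 b : Fin (q + 2) → B) = Fin.cons 1 (Fin.init b) := by
    ext r
    cases r using Fin.cases <;> rfl
  have h := bar_wordₗ I hI (Fin.cons 1 b : Fin (q + 2) → B) n
  rw [Fin.sum_univ_succ, h0, h2, Fin.val_zero, pow_zero, one_smul] at h
  simp only [h1, ← tmₗ_wordₗ] at h
  exact h

variable (k B S) in
/-- `g` extends to `b ⊗ n ↦ ι(b) g(n)`. -/
noncomputable def indExtend (N Z : ModuleCat.{u} S) : (N →ₗ[k] Z) →ₗ[k] ((F I).obj N →ₗ[k] Z) :=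
  indLiftₗ k B S I N Z ∘ₗ
    LinearMap.mk₂ k (fun g b => (Algebra.lsmul k k Z (I.ι b)) ∘ₗ g)
      (fun g g' b => by ext n; simp) (fun r g b => by ext n; simp [smul_comm (I.ι b) r])
      (fun g b b' => by ext n; simp) (fun r g b => by ext n; simp)

theorem indExtend_tmₗ {Z : ModuleCat.{u} S} (g : N →ₗ[k] Z) (b : B) (n : N) :
    indExtend k B S I N Z g (tmₗ I N b n) = I.ι b • g n :=
  indLift_tmₗ I _ b n

end Words

/-! ### Bimodule maps out of the terms of the two-sided bar resolution. -/

section Lift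

variable {k L R : Type u} [Field k] [Ring L] [Algebra k L] [Ring R] [Algebra k R]
  (M : ModuleCat.{u} (L ⊗[k] R)) {Y : ModuleCat.{u} (L ⊗[k] R)}

/-- The element `s ⊗ b₁ ⊗ ⋯ ⊗ b_q ⊗ r ⊗ a₁ ⊗ ⋯ ⊗ a_p ⊗ m`. -/
noncomputable def genWord {q p : ℕ} (s : L) (b : Fin q → L) (r : R) (a : Fin p → R) (m : M) :
    P M q p :=
  tmₗ (left k L R) _ s (wordₗ (left k L R) _ q b
    (tmₗ (right k L R) _ r (wordₗ (right k L R) M p a m)))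

theorem addHom_ext_genWord {G : Type*} [AddCommGroup G] {q p : ℕ} {f g : P M q p →+ G}
    (h : ∀ s b r a m, f (genWord M s b r a m) = g (genWord M s b r a m)) : f = g := by
  refine addHom_ext_tmₗ _ fun s x => ?_
  refine DFunLike.congr_fun (f := f.comp (tmₗ (left k L R) _ s).toAddMonoidHom)
    (g := g.comp (tmₗ (left k L R) _ s).toAddMonoidHom) (addHom_ext_wordₗ _ fun b x => ?_) x
  refine DFunLike.congr_fun (f := (f.comp (tmₗ (left k L R) _ s).toAddMonoidHom).comp
      (wordₗ (left k L R) _ q b).toAddMonoidHom)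
    (g := (g.comp (tmₗ (left k L R) _ s).toAddMonoidHom).comp
      (wordₗ (left k L R) _ q b).toAddMonoidHom) (addHom_ext_tmₗ _ fun r x => ?_) x
  exact DFunLike.congr_fun (f := ((f.comp (tmₗ (left k L R) _ s).toAddMonoidHom).comp
      (wordₗ (left k L R) _ q b).toAddMonoidHom).comp (tmₗ (right k L R) _ r).toAddMonoidHom)
    (g := ((g.comp (tmₗ (left k L R) _ s).toAddMonoidHom).comp
      (wordₗ (left k L R) _ q b).toAddMonoidHom).comp (tmₗ (right k L R) _ r).toAddMonoidHom)
    (addHom_ext_wordₗ _ fun a m => h s b r a m) x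

theorem left_Δ_tmul (s : L) (r : R) : (left k L R).Δ (s ⊗ₜ r) = s ⊗ₜ (1 ⊗ₜ r) := by simp [left]

theorem right_Δ_tmul (s : L) (r : R) : (right k L R).Δ (s ⊗ₜ r) = r ⊗ₜ (s ⊗ₜ 1) := by simp [right]

/-- The element `s'` stops at the outer factor `L`, whereas `r'` passes through all factors `L` and
stops at the outer factor `R`. -/
theorem tmul_smul_genWord {q p : ℕ} (s' : L) (r' : R) (s : L) (b : Fin q → L) (r : R)
    (a : Fin p → R) (m : M) :
    (s' ⊗ₜ[k] r' : L ⊗[k] R) • genWord M s b r a m = genWord M (s' * s) b (r' * r) a m := by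
  refine (smul_tmₗ_of_coact _ _ (left_Δ_tmul s' r') _ _).trans ?_
  rw [smul_wordₗ _ (left_Δ_tmul 1 r'), smul_tmₗ_of_coact _ _ (right_Δ_tmul 1 r'),
    ← Algebra.TensorProduct.one_def, one_smul]
  rfl

variable {M} in
/-- The `k`-linear map `s ⊗ b₁ ⊗ ⋯ ⊗ a_p ⊗ m ↦ s r φ(b, a, m)`. -/
noncomputable def barLiftₗ (q p : ℕ) :
    MultilinearMap k (fun _ : Fin q => L) (MultilinearMap k (fun _ : Fin p => R) (M →ₗ[k] Y)) →ₗ[k]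
      (P M q p →ₗ[k] Y) :=
  indExtend k L (L ⊗[k] R) (left k L R) _ Y ∘ₗ wordLift k L (L ⊗[k] R) (left k L R) _ Y q ∘ₗ
    LinearMap.compMultilinearMapₗ k
      (indExtend k R (L ⊗[k] R) (right k L R) _ Y ∘ₗ wordLift k R (L ⊗[k] R) (right k L R) M Y p)

theorem barLiftₗ_genWord {q p : ℕ}
    (φ : MultilinearMap k (fun _ : Fin q => L) (MultilinearMap k (fun _ : Fin p => R) (M →ₗ[k] Y)))
    (s : L) (b : Fin q → L) (r : R) (a : Fin p → R) (m : M) :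
    barLiftₗ q p φ (genWord M s b r a m) = (s ⊗ₜ[k] r : L ⊗[k] R) • φ b a m := by
  have h1 := indExtend_tmₗ (right k L R) (wordLift k R _ (right k L R) M Y p (φ b)) r
    (wordₗ (right k L R) M p a m)
  rw [wordLift_wordₗ] at h1
  have h2 := wordLift_wordₗ (left k L R) (LinearMap.compMultilinearMapₗ k
    (indExtend k R (L ⊗[k] R) (right k L R) _ Y ∘ₗ wordLift k R (L ⊗[k] R) (right k L R) M Y p) φ)
    b (tmₗ (right k L R) _ r (wordₗ (right k L R) M p a m))
  refine (indExtend_tmₗ (left k L R) _ s _).trans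
    ((congrArg (fun y : Y => (left k L R).ι s • y) (h2.trans h1)).trans ?_)
  rw [smul_smul]
  congr 1
  simp [left, right]

variable {M} in
/-- The bimodule map with `1 ⊗ b₁ ⊗ ⋯ ⊗ a_p ⊗ 1 ↦ φ(b, a, m)`. -/
noncomputable def barLift (q p : ℕ) :
    MultilinearMap k (fun _ : Fin q => L) (MultilinearMap k (fun _ : Fin p => R) (M →ₗ[k] Y)) →ₗ[k]
      (P M q p →ₗ[L ⊗[k] R] Y) where
  toFun φ :=
    { toFun := barLiftₗ q p φ
      map_add' := map_add _
      map_smul' := fun c x => by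
        -- For a fixed scalar both sides are additive in `x`, so words suffice; after that both are
        -- additive in the scalar, so pure tensors suffice.
        refine DFunLike.congr_fun (f := (barLiftₗ q p φ).toAddMonoidHom.comp
          (DistribSMul.toAddMonoidHom _ c)) (g := (DistribSMul.toAddMonoidHom Y c).comp
            (barLiftₗ q p φ).toAddMonoidHom) (addHom_ext_genWord M fun s b r a m => ?_) x
        change barLiftₗ q p φ (c • genWord M s b r a m) = c • barLiftₗ q p φ (genWord M s b r a m)
        induction c with
        | zero => simp
        | add c c' h h' => rw [add_smul, map_add, h, h', add_smul]
        | tmul s' r' =>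
          rw [tmul_smul_genWord, barLiftₗ_genWord, barLiftₗ_genWord, smul_smul,
            Algebra.TensorProduct.tmul_mul_tmul] }
  map_add' φ φ' := LinearMap.ext fun x => by
    change barLiftₗ q p (φ + φ') x = barLiftₗ q p φ x + barLiftₗ q p φ' x
    rw [map_add, LinearMap.add_apply]
  map_smul' c φ := LinearMap.ext fun x => by
    change barLiftₗ q p (c • φ) x = c • barLiftₗ q p φ x
    rw [map_smul, LinearMap.smul_apply]

theorem barLift_genWord {q p : ℕ}
    (φ : MultilinearMap k (fun _ : Fin q => L) (MultilinearMap k (fun _ : Fin p => R) (M →ₗ[k] Y)))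
    (s : L) (b : Fin q → L) (r : R) (a : Fin p → R) (m : M) :
    barLift q p φ (genWord M s b r a m) = (s ⊗ₜ[k] r : L ⊗[k] R) • φ b a m :=
  barLiftₗ_genWord M φ s b r a m

theorem linearMap_ext_genWord {q p : ℕ} {f g : P M q p →ₗ[L ⊗[k] R] Y}
    (h : ∀ b a m, f (genWord M 1 b 1 a m) = g (genWord M 1 b 1 a m)) : f = g := by
  refine LinearMap.toAddMonoidHom_injective (addHom_ext_genWord M fun s b r a m => ?_)
  have : genWord M s b r a m = (s ⊗ₜ[k] r : L ⊗[k] R) • genWord M 1 b 1 a m := by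
    rw [tmul_smul_genWord, mul_one, mul_one]
  change f _ = g _
  rw [this, map_smul, map_smul, h]

/-- Restriction of a `k`-linear map to the elements `1 ⊗ b₁ ⊗ ⋯ ⊗ a_p ⊗ 1`. -/
noncomputable def restrictWord (q p : ℕ) (ψ : P M q p →ₗ[k] Y) : MultilinearMap k
    (fun _ : Fin q => L) (MultilinearMap k (fun _ : Fin p => R) (M →ₗ[k] Y)) :=
  let Z := (F (right k L R)).obj ((pow (right k L R) p).obj M)
  let K : (Z →ₗ[k] Y) →ₗ[k] MultilinearMap k (fun _ : Fin p => R) (M →ₗ[k] Y) :=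
    { toFun := fun u => (LinearMap.llcomp k M _ Y
        (u ∘ₗ tmₗ (right k L R) _ 1)).compMultilinearMap (wordₗ (right k L R) M p)
      map_add' := fun _ _ => rfl
      map_smul' := fun _ _ => rfl }
  (K ∘ₗ LinearMap.llcomp k Z _ Y (ψ ∘ₗ tmₗ (left k L R) _ 1)).compMultilinearMap
    (wordₗ (left k L R) Z q)

end Lift

/-! ### The two bar differentials on words with outer factors `1`. -/

section Differential

variable {k L R : Type u} [Field k] [Ring L] [Algebra k L] [Ring R] [Algebra k R]
  (M : ModuleCat.{u} (L ⊗[k] R))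

theorem left_hI (s : L) : (left k L R).Δ ((left k L R).ι s) = s ⊗ₜ 1 := by
  simp [left, Algebra.TensorProduct.one_def]

theorem right_hI (r : R) : (right k L R).Δ ((right k L R).ι r) = r ⊗ₜ 1 := by
  simp [right, Algebra.TensorProduct.one_def]

theorem dL_genWord {q p : ℕ} (b : Fin (q + 1) → L) (a : Fin p → R) (m : M) :
    dL M q p (genWord M 1 b 1 a m) = genWord M (b 0) (Fin.tail b) 1 a m +
      ∑ i : Fin q, ((-1 : k) ^ (i + 1 : ℕ)) •
        genWord M 1 (Fin.contractNth i.castSucc (· * ·) b) 1 a m +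
      ((-1 : k) ^ (q + 1)) •
        genWord M 1 (Fin.init b) 1 a ((b (Fin.last q) ⊗ₜ[k] (1 : R) : L ⊗[k] R) • m) := by
  -- The last factor of `L` is absorbed by everything to its right; the action of `L` on that part
  -- moves past the factors `R` and ends at `m`.
  have h2 : (left k L R).ι (b (Fin.last q)) •
      tmₗ (right k L R) _ 1 (wordₗ (right k L R) M p a m) =
      tmₗ (right k L R) _ 1 (wordₗ (right k L R) M p a
        ((b (Fin.last q) ⊗ₜ[k] (1 : R) : L ⊗[k] R) • m)) := by
    refine (smul_tmₗ_of_coact _ _ (right_Δ_tmul (b (Fin.last q)) 1) _ _).trans ?_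
    rw [smul_wordₗ _ (right_Δ_tmul (b (Fin.last q)) 1), one_mul]
  have h1 := barSucc_tmₗ (left k L R) left_hI b
    (tmₗ (right k L R) _ 1 (wordₗ (right k L R) M p a m))
  rw [h2] at h1
  exact h1

/-- The differential on the factors `R` is the one-sided bar differential with the functors for the
`L`-factors applied to it, so it acts inside the word and leaves the entries `b` alone. -/
theorem dR_genWord {q p : ℕ} (b : Fin q → L) (a : Fin (p + 1) → R) (m : M) :
    dR M q p (genWord M 1 b 1 a m) = genWord M 1 b (a 0) (Fin.tail a) m +
      ∑ i : Fin p, ((-1 : k) ^ (i + 1 : ℕ)) •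
        genWord M 1 b 1 (Fin.contractNth i.castSucc (· * ·) a) m +
      ((-1 : k) ^ (p + 1)) •
        genWord M 1 b 1 (Fin.init a) (((1 : L) ⊗ₜ[k] a (Fin.last p) : L ⊗[k] R) • m) := by
  have h2 : dR M q p (genWord M 1 b 1 a m) = tmₗ (left k L R) _ 1 (wordₗ (left k L R) _ q b
      (barSucc (right k L R) M p (tmₗ (right k L R) _ 1 (wordₗ (right k L R) M (p + 1) a m)))) :=
    (F_map_tmₗ _ _ _ _).trans (congrArg (tmₗ (left k L R) _ 1)
      (pow_map_wordₗ (left k L R) (barSucc (right k L R) M p) b _))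
  rw [h2, barSucc_tmₗ _ right_hI]
  simp only [map_add, map_sum, map_smul]
  rfl

end Differential

end BarResolution

/-! ### Contractions of a sequence `b₁, …, b_q, m, a₁, …, a_p`. -/

section Sandwich

variable {T : Type*} {N q p : ℕ}

/-- The sequence `b₁, …, b_q, m, a₁, …, a_p`. -/
def sandwich (h : N = q + 1 + p) (b : Fin q → T) (m : T) (a : Fin p → T) : Fin N → T :=
  Fin.append (Fin.append b (fun _ : Fin 1 => m)) a ∘ Fin.cast h

theorem sandwich_apply (h : N = q + 1 + p) (b : Fin q → T) (m : T) (a : Fin p → T) (s : Fin N) :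
    sandwich h b m a s = if h₁ : (s : ℕ) < q then b ⟨s, h₁⟩ else
      if h₂ : q < (s : ℕ) then a ⟨s - (q + 1), by omega⟩ else m := by
  subst h
  simp only [sandwich, Function.comp_apply, Fin.append, Fin.addCases, Fin.val_cast, Fin.val_castLT]
  split_ifs <;> first | omega | rfl | (simp; done) | (simp; rfl)

theorem sandwich_of_lt (h : N = q + 1 + p) (b : Fin q → T) (m : T) (a : Fin p → T) {s : Fin N}
    (hs : (s : ℕ) < q) : sandwich h b m a s = b ⟨s, hs⟩ := by
  rw [sandwich_apply, dif_pos hs]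

theorem sandwich_of_eq (h : N = q + 1 + p) (b : Fin q → T) (m : T) (a : Fin p → T) {s : Fin N}
    (hs : (s : ℕ) = q) : sandwich h b m a s = m := by
  rw [sandwich_apply, dif_neg (by omega), dif_neg (by omega)]

theorem sandwich_of_gt (h : N = q + 1 + p) (b : Fin q → T) (m : T) (a : Fin p → T) {s : Fin N}
    (hs : q < (s : ℕ)) : sandwich h b m a s = a ⟨s - (q + 1), by omega⟩ := by
  rw [sandwich_apply, dif_neg (by omega), dif_pos hs]

theorem sandwich_update_left (h : N = q + 1 + p) (b : Fin q → T) (m : T) (a : Fin p → T)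
    (i : Fin q) (x : T) : sandwich h (Function.update b i x) m a =
      Function.update (sandwich h b m a) ⟨i, by omega⟩ x := by
  ext s
  simp only [sandwich_apply, Function.update_apply, Fin.ext_iff]
  split_ifs <;> first | rfl | omega

theorem sandwich_update_mid (h : N = q + 1 + p) (b : Fin q → T) (m : T) (a : Fin p → T) (x : T) :
    sandwich h b x a = Function.update (sandwich h b m a) ⟨q, by omega⟩ x := by
  ext s
  simp only [sandwich_apply, Function.update_apply, Fin.ext_iff]
  split_ifs <;> first | rfl | omega

theorem sandwich_update_right (h : N = q + 1 + p) (b : Fin q → T) (m : T) (a : Fin p → T)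
    (i : Fin p) (x : T) : sandwich h b m (Function.update a i x) =
      Function.update (sandwich h b m a) ⟨q + 1 + i, by omega⟩ x := by
  ext s
  simp only [sandwich_apply, Function.update_apply, Fin.ext_iff]
  split_ifs <;> first | rfl | omega

theorem tail_sandwich_succ (h : N + 1 = q + 1 + 1 + p) (b : Fin (q + 1) → T) (m : T)
    (a : Fin p → T) : Fin.tail (sandwich h b m a) = sandwich (by omega) (Fin.tail b) m a := by
  ext s
  simp only [Fin.tail, sandwich_apply, Fin.val_succ]
  split_ifs <;> first | rfl | omega | (congr 1; ext; simp)

theorem init_sandwich_succ (h : N + 1 = q + 1 + (p + 1)) (b : Fin q → T) (m : T)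
    (a : Fin (p + 1) → T) :
    Fin.init (sandwich h b m a) = sandwich (by omega) b m (Fin.init a) := by
  ext s
  simp only [Fin.init, sandwich_apply, Fin.val_castSucc]
  split_ifs <;> rfl

theorem tail_sandwich_zero (h : N + 1 = 0 + 1 + p) (b : Fin 0 → T) (m : T) (a : Fin p → T) :
    Fin.tail (sandwich h b m a) = a ∘ Fin.cast (by omega) := by
  ext s
  simp only [Fin.tail, sandwich_apply, Fin.val_succ]
  split_ifs <;> first | rfl | omega

theorem init_sandwich_zero (h : N + 1 = q + 1 + 0) (b : Fin q → T) (m : T) (a : Fin 0 → T) :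
    Fin.init (sandwich h b m a) = b ∘ Fin.cast (by omega) := by
  ext s
  simp only [Fin.init, sandwich_apply, Fin.val_castSucc]
  split_ifs <;> first | rfl | omega

variable [Semigroup T]

theorem contractNth_sandwich_left (h : N + 1 = q + 1 + 1 + p) (b : Fin (q + 1) → T) (m : T)
    (a : Fin p → T) (i : Fin N) (j : Fin q) (hj : (i : ℕ) = j) :
    Fin.contractNth i.castSucc (· * ·) (sandwich h b m a) =
      sandwich (by omega) (Fin.contractNth j.castSucc (· * ·) b) m a := by
  ext s
  simp only [Fin.contractNth, sandwich_apply, Fin.val_castSucc, Fin.val_succ]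
  split_ifs <;> first | rfl | omega | (congr 1; ext; simp)

theorem contractNth_sandwich_left_last (h : N + 1 = q + 1 + 1 + p) (b : Fin (q + 1) → T) (m : T)
    (a : Fin p → T) (i : Fin N) (hi : (i : ℕ) = q) :
    Fin.contractNth i.castSucc (· * ·) (sandwich h b m a) =
      sandwich (by omega) (Fin.init b) (b (Fin.last q) * m) a := by
  ext s
  simp only [Fin.contractNth, sandwich_apply, Fin.val_castSucc, Fin.val_succ]
  split_ifs <;> first | rfl | omega | (congr 1; ext; simp) | (congr 2; ext; simp; omega)

theorem contractNth_sandwich_right_first (h : N + 1 = q + 1 + (p + 1)) (b : Fin q → T) (m : T)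
    (a : Fin (p + 1) → T) (i : Fin N) (hi : (i : ℕ) = q) :
    Fin.contractNth i.castSucc (· * ·) (sandwich h b m a) =
      sandwich (by omega) b (m * a 0) (Fin.tail a) := by
  ext s
  simp only [Fin.contractNth, sandwich_apply, Fin.val_castSucc, Fin.val_succ]
  split_ifs <;> first | rfl | omega | skip
  · congr 2; ext; simp; omega
  · simp only [Fin.tail]; congr 1; ext; simp; omega

theorem contractNth_sandwich_right (h : N + 1 = q + 1 + (p + 1)) (b : Fin q → T) (m : T)
    (a : Fin (p + 1) → T) (i : Fin N) (j : Fin p) (hj : (i : ℕ) = q + 1 + j) :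
    Fin.contractNth i.castSucc (· * ·) (sandwich h b m a) =
      sandwich (by omega) b m (Fin.contractNth j.castSucc (· * ·) a) := by
  ext s
  simp only [Fin.contractNth, sandwich_apply, Fin.val_castSucc, Fin.val_succ]
  split_ifs <;> first | rfl | omega | skip
  · congr 2; ext; simp; omega
  · congr 1; ext; simp; omega

end Sandwich

/-! ### Reversal of sequences in the opposite ring. -/

section RevOp

variable {A : Type*} {p : ℕ}

/-- The reversed sequence, in the opposite ring. -/
def revOp (a : Fin p → A) : Fin p → Aᵐᵒᵖ := fun i => op (a (Fin.rev i))

theorem revOp_zero (a : Fin (p + 1) → A) : revOp a 0 = op (a (Fin.last p)) := by simp [revOp]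

theorem revOp_last (a : Fin (p + 1) → A) : revOp a (Fin.last p) = op (a 0) := by simp [revOp]

theorem tail_revOp (a : Fin (p + 1) → A) : Fin.tail (revOp a) = revOp (Fin.init a) := by
  ext s
  simp [Fin.tail, Fin.init, revOp, Fin.rev_succ]

theorem init_revOp (a : Fin (p + 1) → A) : Fin.init (revOp a) = revOp (Fin.tail a) := by
  ext s
  simp [Fin.tail, Fin.init, revOp, Fin.rev_castSucc]

/-- Reversal moves the pair of adjacent places `i, i + 1` to the mirror pair, and the opposite
multiplication restores the order of its two factors. -/
theorem contractNth_revOp [Semigroup A] (a : Fin (p + 1) → A) (i : Fin p) :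
    Fin.contractNth i.castSucc (· * ·) (revOp a) =
      revOp (Fin.contractNth (Fin.rev i).castSucc (· * ·) a) := by
  ext s
  have hi := i.2
  have hs := s.2
  simp only [Fin.contractNth, revOp, Fin.val_castSucc, Fin.val_rev]
  split_ifs <;> first | omega | skip
  · congr 2; ext; simp; omega
  · rw [← op_mul]
    congr 2 <;> congr 1 <;> ext <;> simp
    all_goals omega
  · congr 2; ext; simp

theorem revOp_surjective (r : Fin p → Aᵐᵒᵖ) : ∃ a, revOp a = r :=
  ⟨fun i => unop (r (Fin.rev i)), by ext s; simp [revOp]⟩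

end RevOp

/-! ### The total bar complex and its maps to a bimodule. -/

namespace BarResolution

open scoped ModuleCat

section Total

variable {k L R : Type u} [Field k] [Ring L] [Algebra k L] [Ring R] [Algebra k R]
  (M : ModuleCat.{u} (L ⊗[k] R)) {Y : ModuleCat.{u} (L ⊗[k] R)}

/-- The index `(q, p)` of a summand in degree `l`. -/
abbrev bidegree {l : ℕ} (q p : ℕ) (h : q + p = l) : Finset.HasAntidiagonal.antidiagonal l :=
  ⟨(q, p), Finset.HasAntidiagonal.mem_antidiagonal.2 h⟩

/-- The differential is defined by reading the coordinates of its argument at shifted indices. For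
computations on words it is needed as a map out of a single summand instead. -/
theorem d_single_left {l : ℕ} (q p : ℕ) (h : q + 1 + p = l + 1) (y : P M (q + 1) p) :
    (fun x : Finset.HasAntidiagonal.antidiagonal l =>
      dL M x.1.1 x.1.2 ((Pi.single (bidegree (q + 1) p h) y : X M (l + 1))
        (bidegree (x.1.1 + 1) x.1.2 (by
          have := Finset.HasAntidiagonal.mem_antidiagonal.1 x.2
          omega)))) = Pi.single (M := fun x : Finset.HasAntidiagonal.antidiagonal l => P M x.1.1 x.1.2) (bidegree q p (by omega)) (dL M q p y) := by
  funext ⟨⟨q', p'⟩, hx⟩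
  by_cases hq : (q', p') = (q, p)
  · obtain ⟨rfl, rfl⟩ := Prod.mk.inj hq
    rw [Pi.single_eq_same]
    exact (Pi.single_eq_same (M := fun x : Finset.HasAntidiagonal.antidiagonal l =>
      P M x.1.1 x.1.2) (bidegree q' p' _) (dL M q' p' y)).symm
  · have hq' : bidegree q' p' (Finset.HasAntidiagonal.mem_antidiagonal.1 hx) ≠ bidegree q p (by omega) :=
      fun h => hq (congrArg Subtype.val h)
    rw [Pi.single_eq_of_ne hq', Pi.single_eq_of_ne (fun h => hq (by simpa [bidegree] using h)), map_zero]

theorem d_single_right {l : ℕ} (q p : ℕ) (h : q + (p + 1) = l + 1) (y : P M q (p + 1)) :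
    (fun x : Finset.HasAntidiagonal.antidiagonal l =>
      dR M x.1.1 x.1.2 ((Pi.single (bidegree q (p + 1) h) y : X M (l + 1))
        (bidegree x.1.1 (x.1.2 + 1) (by
          have := Finset.HasAntidiagonal.mem_antidiagonal.1 x.2
          omega)))) = Pi.single (M := fun x : Finset.HasAntidiagonal.antidiagonal l => P M x.1.1 x.1.2) (bidegree q p (by omega)) (dR M q p y) := by
  funext ⟨⟨q', p'⟩, hx⟩
  by_cases hq : (q', p') = (q, p)
  · obtain ⟨rfl, rfl⟩ := Prod.mk.inj hq
    rw [Pi.single_eq_same]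
    exact (Pi.single_eq_same (M := fun x : Finset.HasAntidiagonal.antidiagonal l =>
      P M x.1.1 x.1.2) (bidegree q' p' _) (dR M q' p' y)).symm
  · have hq' : bidegree q' p' (Finset.HasAntidiagonal.mem_antidiagonal.1 hx) ≠ bidegree q p (by omega) :=
      fun h => hq (congrArg Subtype.val h)
    rw [Pi.single_eq_of_ne hq', Pi.single_eq_of_ne (fun h => hq (by simpa [bidegree] using h)), map_zero]

theorem d_single_succ_succ {l : ℕ} (q p : ℕ) (h : q + 1 + (p + 1) = l + 1)
    (y : P M (q + 1) (p + 1)) :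
    d M l (Pi.single (bidegree (q + 1) (p + 1) h) y) =
      Pi.single (bidegree q (p + 1) (by omega)) (dL M q (p + 1) y) +
      ((-1 : ℤ) ^ l) • Pi.single (bidegree (q + 1) p (by omega)) (dR M (q + 1) p y) := by
  rw [← d_single_left M q (p + 1) h y, ← d_single_right M (q + 1) p h y]
  rfl

/-- On the edge of the double complex only one of the two differentials contributes: the other one
reads coordinates whose second index is positive, and these are zero. -/
theorem d_single_succ_zero {l : ℕ} (y : P M (l + 1) 0) :
    d M l (Pi.single (bidegree (l + 1) 0 rfl) y) =
      Pi.single (bidegree l 0 rfl) (dL M l 0 y) := by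
  rw [← d_single_left M l 0 rfl y]
  funext x
  refine (congrArg (_ + ·) ?_).trans (add_zero _)
  rw [Pi.single_eq_of_ne (by simp [Subtype.ext_iff]), map_zero, smul_zero]

theorem d_single_zero_succ {l : ℕ} (y : P M 0 (l + 1)) :
    d M l (Pi.single (bidegree 0 (l + 1) (by omega)) y) =
      ((-1 : ℤ) ^ l) • Pi.single (bidegree 0 l (by omega)) (dR M 0 l y) := by
  rw [← d_single_right M 0 l (by omega) y]
  funext x
  refine (congrArg (· + _) ?_).trans (zero_add _)
  rw [Pi.single_eq_of_ne (by simp [Subtype.ext_iff]), map_zero]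

variable (Y) in
/-- Families of multilinear maps on `L^q × M × R^p`, `q + p = l`. -/
abbrev MultiCochain (l : ℕ) : Type u := ∀ x : Finset.HasAntidiagonal.antidiagonal l,
  MultilinearMap k (fun _ : Fin x.1.1 => L)
    (MultilinearMap k (fun _ : Fin x.1.2 => R) (M →ₗ[k] Y))

variable {M}

/-- The map on the degree `l` term of the bar resolution that corresponds to a cochain. -/
noncomputable def barHom (l : ℕ) : MultiCochain M Y l →ₗ[k] (X M l →ₗ[L ⊗[k] R] Y) where
  toFun φ := ∑ x, barLift x.1.1 x.1.2 (φ x) ∘ₗ LinearMap.proj x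
  map_add' φ φ' := by
    simp only [Pi.add_apply, map_add, LinearMap.add_comp, Finset.sum_add_distrib]
  map_smul' c φ := by
    simp only [Pi.smul_apply, map_smul, RingHom.id_apply, Finset.smul_sum]
    rfl

theorem barHom_single {l : ℕ} (φ : MultiCochain M Y l) (x : Finset.HasAntidiagonal.antidiagonal l)
    (y : P M x.1.1 x.1.2) : barHom l φ (Pi.single x y) = barLift x.1.1 x.1.2 (φ x) y := by
  simp only [barHom, LinearMap.coe_mk, AddHom.coe_mk, LinearMap.sum_apply, LinearMap.comp_apply,
    LinearMap.proj_apply]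
  rw [Finset.sum_eq_single x (fun x' _ hx => by rw [Pi.single_eq_of_ne hx, map_zero])
    (fun h => absurd (Finset.mem_univ x) h), Pi.single_eq_same]

theorem hom_ext_genWord {l : ℕ} {f g : X M l →ₗ[L ⊗[k] R] Y}
    (h : ∀ (q p : ℕ) (h : q + p = l) b a m, f (Pi.single (bidegree q p h) (genWord M 1 b 1 a m)) =
      g (Pi.single (bidegree q p h) (genWord M 1 b 1 a m))) : f = g :=
  LinearMap.pi_ext' fun x => linearMap_ext_genWord M fun b a m =>
    h x.1.1 x.1.2 (Finset.HasAntidiagonal.mem_antidiagonal.1 x.2) b a m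

/-- The cochain that corresponds to a map on the degree `l` term of the bar resolution. -/
noncomputable def restrictHom {l : ℕ} (ψ : X M l →ₗ[L ⊗[k] R] Y) : MultiCochain M Y l := fun x =>
  restrictWord M x.1.1 x.1.2 ((ψ.comp (LinearMap.single (L ⊗[k] R)
    (fun x : Finset.HasAntidiagonal.antidiagonal l => P M x.1.1 x.1.2) x)).restrictScalars k)

/-- Maps out of the bar term are determined by their values on the words with outer factors `1`.
Hence every map comes from a multilinear cochain and can be extended to the triangular algebra. -/
theorem barHom_restrictHom {l : ℕ} (ψ : X M l →ₗ[L ⊗[k] R] Y) :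
    barHom l (restrictHom ψ) = ψ := by
  refine hom_ext_genWord fun q p h b a m => ?_
  rw [barHom_single, barLift_genWord, ← Algebra.TensorProduct.one_def, one_smul]
  rfl

end Total

theorem barWord_eq {k L A : Type u} [Field k] [Ring L] [Algebra k L] [Ring A] [Algebra k A]
    (M : ModuleCat.{u} (L ⊗[k] Aᵐᵒᵖ)) {q p : ℕ} (b : Fin q → L) (m : M) (a : Fin p → A) :
    barWord M b m a = genWord M 1 b 1 (revOp a) m := by
  rw [genWord, wordₗ_apply, wordₗ_apply]
  rfl

end BarResolution

/-! ### Interaction of contractions with moving a scalar between neighbouring entries. -/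

section Contract

variable {T : Type*} [Semigroup T] {m : ℕ} (b : Fin (m + 3) → T) (r : T)

theorem contractNth_update_castSucc_of_lt (i : Fin (m + 1)) (j : Fin (m + 2)) (h : (i : ℕ) < j) :
    Fin.contractNth j.castSucc (· * ·)
        (Function.update b i.castSucc.castSucc (b i.castSucc.castSucc * r)) =
      Function.update (Fin.contractNth j.castSucc (· * ·) b) i.castSucc
        (Fin.contractNth j.castSucc (· * ·) b i.castSucc * r) := by
  funext s
  simp only [Fin.contractNth, Function.update_apply, Fin.ext_iff, Fin.val_castSucc, Fin.val_succ]
  split_ifs <;> first | rfl | omega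

theorem contractNth_update_succ_of_lt (i : Fin (m + 1)) (j : Fin (m + 2)) (h : (i : ℕ) < j) :
    Fin.contractNth j.castSucc (· * ·)
        (Function.update b i.castSucc.succ (r * b i.castSucc.succ)) =
      Function.update (Fin.contractNth j.castSucc (· * ·) b) i.succ
        (r * Fin.contractNth j.castSucc (· * ·) b i.succ) := by
  funext s
  simp only [Fin.contractNth, Function.update_apply, Fin.ext_iff, Fin.val_castSucc, Fin.val_succ]
  split_ifs <;> first | rfl | omega | skip
  obtain rfl : s = i.succ := Fin.ext (by simp; omega)
  exact mul_assoc _ _ _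

theorem contractNth_update_eq (i : Fin (m + 2)) :
    Fin.contractNth i.castSucc (· * ·) (Function.update b i.castSucc (b i.castSucc * r)) =
      Fin.contractNth i.castSucc (· * ·) (Function.update b i.succ (r * b i.succ)) := by
  funext s
  simp only [Fin.contractNth, Function.update_apply, Fin.ext_iff, Fin.val_castSucc, Fin.val_succ]
  split_ifs <;> first | rfl | omega | skip
  obtain rfl : s = i := Fin.ext (by omega)
  exact mul_assoc _ _ _

theorem contractNth_update_castSucc_of_gt (i : Fin (m + 1)) (j : Fin (m + 2)) (h : (j : ℕ) ≤ i) :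
    Fin.contractNth j.castSucc (· * ·)
        (Function.update b i.succ.castSucc (b i.succ.castSucc * r)) =
      Function.update (Fin.contractNth j.castSucc (· * ·) b) i.castSucc
        (Fin.contractNth j.castSucc (· * ·) b i.castSucc * r) := by
  funext s
  simp only [Fin.contractNth, Function.update_apply, Fin.ext_iff, Fin.val_castSucc, Fin.val_succ]
  split_ifs <;> first | rfl | omega | skip
  obtain rfl : s = i.castSucc := Fin.ext (by simp; omega)
  exact (mul_assoc _ _ _).symm

theorem contractNth_update_succ_of_gt (i : Fin (m + 1)) (j : Fin (m + 2)) (h : (j : ℕ) ≤ i) :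
    Fin.contractNth j.castSucc (· * ·)
        (Function.update b i.succ.succ (r * b i.succ.succ)) =
      Function.update (Fin.contractNth j.castSucc (· * ·) b) i.succ
        (r * Fin.contractNth j.castSucc (· * ·) b i.succ) := by
  funext s
  simp only [Fin.contractNth, Function.update_apply, Fin.ext_iff, Fin.val_castSucc, Fin.val_succ]
  split_ifs <;> first | rfl | omega

end Contract

section ConsSnoc

variable {T : Type*} {m : ℕ} (x y z : T) (t : Fin m → T)

theorem cons_snoc_last : (Fin.cons x (Fin.snoc t y) : Fin (m + 2) → T) (Fin.last m).succ = y := by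
  rw [Fin.cons_succ, Fin.snoc_last]

theorem cons_snoc_castSucc_succ (i : Fin m) :
    (Fin.cons x (Fin.snoc t y) : Fin (m + 2) → T) i.castSucc.succ = t i := by
  rw [Fin.cons_succ, Fin.snoc_castSucc]

theorem update_cons_snoc_last :
    Function.update (Fin.cons x (Fin.snoc t y) : Fin (m + 2) → T) (Fin.last m).succ z =
      Fin.cons x (Fin.snoc t z) := by
  rw [← Fin.cons_update, Fin.update_snoc_last]

theorem update_cons_snoc_castSucc_succ (i : Fin m) :
    Function.update (Fin.cons x (Fin.snoc t y) : Fin (m + 2) → T) i.castSucc.succ z =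
      Fin.cons x (Fin.snoc (Function.update t i z) y) := by
  rw [← Fin.cons_update, Fin.snoc_update]

end ConsSnoc

/-! ### Relative cochains, restriction to the diagonal algebras, and the first step of the
filtration. -/

namespace TriangularData

open Hochschild

variable {k : Type u} [Field k] {n : ℕ} {D : TriangularData k n}
  {X : Type u} [AddCommGroup X] [Module k X] [Module D.Alg X] [Module D.Algᵐᵒᵖ X]
  [SMulCommClass D.Alg D.Algᵐᵒᵖ X] [IsScalarTower k D.Alg X] [IsScalarTower k D.Algᵐᵒᵖ X]

/-- The idempotents belong to `R`; this turns statements about the action of `R` into statements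
about corners and blocks. -/
theorem scalar_single (j : Fin n) : D.scalar (Pi.single j 1) = D.e j := by
  ext i
  · by_cases h : i = j
    · subst h; simp [scalar, e, ofDiag]
    · simp [scalar, e, ofDiag, h]
  · rfl

theorem scalar_mul_diag (r : Fin n → k) (t : D.Alg) (j : Fin n) :
    (D.scalar r * t).diag j = r j • t.diag j := by
  simp [scalar, Algebra.smul_def]

theorem mul_scalar_diag (r : Fin n → k) (t : D.Alg) (j : Fin n) :
    (t * D.scalar r).diag j = r j • t.diag j := by
  simp [scalar, Algebra.smul_def, Algebra.commutes]

theorem scalar_mul_off (r : Fin n → k) (t : D.Alg) (p : Pair n) :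
    (D.scalar r * t).off p = r p.1.1 • t.off p := by
  simp [scalar, Alg.off_mul]

theorem mul_scalar_off (r : Fin n → k) (t : D.Alg) (p : Pair n) :
    (t * D.scalar r).off p = r p.1.2 • t.off p := by
  have : op (algebraMap k (D.A p.1.2) (r p.1.2)) = algebraMap k (D.A p.1.2)ᵐᵒᵖ (r p.1.2) := rfl
  simp only [scalar, Alg.off_mul, this, Pi.zero_apply, smul_zero, map_zero,
    Finset.sum_const_zero, add_zero, zero_add, algebraMap_smul]

theorem scalar_mul_ofDiag (r : Fin n → k) (j : Fin n) (a : D.A j) :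
    D.scalar r * D.ofDiag j a = r j • D.ofDiag j a := by
  ext i
  · rw [scalar_mul_diag]
    by_cases h : i = j
    · subst h; simp [ofDiag]
    · simp [ofDiag, h]
  · rw [scalar_mul_off]; simp [ofDiag]

theorem ofDiag_mul_scalar (r : Fin n → k) (j : Fin n) (a : D.A j) :
    D.ofDiag j a * D.scalar r = r j • D.ofDiag j a := by
  ext i
  · rw [mul_scalar_diag]
    by_cases h : i = j
    · subst h; simp [ofDiag]
    · simp [ofDiag, h]
  · rw [mul_scalar_off]; simp [ofDiag]

theorem scalar_smul_corner (r : Fin n → k) {j i : Fin n} (x : D.corner X j i) :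
    D.scalar r • (x : X) = r j • (x : X) := by
  rw [← x.2.1, e, smul_smul, scalar_mul_ofDiag, smul_assoc]

theorem op_scalar_smul_corner (r : Fin n → k) {j i : Fin n} (x : D.corner X j i) :
    op (D.scalar r) • (x : X) = r i • (x : X) := by
  rw [← x.2.2, e, smul_smul, ← op_mul, ofDiag_mul_scalar, op_smul, smul_assoc]

/-- Balancedness of a relative cochain, in terms of `(b₀, …, b_{m+1}) ↦ b₀ f(b₁, …, b_m) b_{m+1}`. -/
def IsBalanced {m : ℕ} (f : Cochain k D.Alg X m) : Prop :=
  ∀ (r : Fin n → k) (b : Fin (m + 2) → D.Alg) (i : Fin (m + 1)),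
    extend f (Function.update b i.castSucc (b i.castSucc * D.scalar r)) =
      extend f (Function.update b i.succ (D.scalar r * b i.succ))

theorem extend_cons_snoc {m : ℕ} (f : Cochain k D.Alg X m) (x y : D.Alg) (t : Fin m → D.Alg) :
    extend f (Fin.cons x (Fin.snoc t y) : Fin (m + 2) → D.Alg) = x • op y • f t := by
  have h1 : (Fin.cons x (Fin.snoc t y) : Fin (m + 2) → D.Alg) (Fin.last _) = y := by
    rw [← Fin.succ_last, Fin.cons_succ, Fin.snoc_last]
  rw [extend, h1, Fin.cons_zero, Fin.tail_cons, Fin.init_snoc]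

/-- In terms of the extended expression `b₀ f(b₁, …, b_m) b_{m+1}` the coboundary is an alternating
sum of contractions, and each of them respects the balancing at place `i` separately. A contraction
elsewhere turns it into balancing for `f` at a possibly shifted place; the contraction of `i` with
its successor makes both sides equal by associativity. -/
theorem IsBalanced.coboundary {m : ℕ} {f : Cochain k D.Alg X m} (hf : IsBalanced f) :
    IsBalanced (Hochschild.coboundary k D.Alg X m f) := by
  intro r b i
  rw [extend_coboundary, extend_coboundary]
  refine Finset.sum_congr rfl fun j _ => congrArg _ ?_
  rcases lt_trichotomy (i : ℕ) j with h | h | h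
  · obtain ⟨i, rfl⟩ : ∃ i' : Fin (m + 1), i = i'.castSucc := ⟨⟨i, by omega⟩, rfl⟩
    rw [contractNth_update_castSucc_of_lt b _ i j h, contractNth_update_succ_of_lt b _ i j h]
    exact hf r _ i
  · obtain rfl : i = j := Fin.ext h
    rw [contractNth_update_eq]
  · obtain ⟨i, rfl⟩ : ∃ i' : Fin (m + 1), i = i'.succ :=
      ⟨⟨i - 1, by omega⟩, by ext; simp; omega⟩
    rw [contractNth_update_castSucc_of_gt b _ i j (by simp at h; omega),
      contractNth_update_succ_of_gt b _ i j (by simp at h; omega)]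
    exact hf r _ i

theorem extend_update_zero {m : ℕ} (f : Cochain k D.Alg X m) (r : Fin n → k) (x y : D.Alg)
    (t : Fin m → D.Alg) :
    extend f (Function.update (Fin.cons x (Fin.snoc t y) : Fin (m + 2) → D.Alg) (Fin.castSucc 0)
      ((Fin.cons x (Fin.snoc t y) : Fin (m + 2) → D.Alg) (Fin.castSucc 0) * D.scalar r)) =
      x • op y • D.scalar r • f t := by
  rw [Fin.castSucc_zero, Fin.cons_zero, Fin.update_cons_zero, extend_cons_snoc, mul_smul,
    smul_comm (D.scalar r)]

theorem extend_update_last {m : ℕ} (f : Cochain k D.Alg X m) (r : Fin n → k) (x y : D.Alg)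
    (t : Fin m → D.Alg) :
    extend f (Function.update (Fin.cons x (Fin.snoc t y) : Fin (m + 2) → D.Alg) (Fin.last m).succ
      (D.scalar r * (Fin.cons x (Fin.snoc t y) : Fin (m + 2) → D.Alg) (Fin.last m).succ)) =
      x • op y • op (D.scalar r) • f t := by
  rw [cons_snoc_last, update_cons_snoc_last, extend_cons_snoc, op_mul, mul_smul]

theorem extend_update_castSucc {m : ℕ} (f : Cochain k D.Alg X m) (r : Fin n → k) (x y : D.Alg)
    (t : Fin m → D.Alg) (i : Fin m) :
    extend f (Function.update (Fin.cons x (Fin.snoc t y) : Fin (m + 2) → D.Alg) i.succ.castSucc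
      ((Fin.cons x (Fin.snoc t y) : Fin (m + 2) → D.Alg) i.succ.castSucc * D.scalar r)) =
      x • op y • f (Function.update t i (t i * D.scalar r)) := by
  rw [← Fin.succ_castSucc, cons_snoc_castSucc_succ, update_cons_snoc_castSucc_succ,
    extend_cons_snoc]

theorem extend_update_succ {m : ℕ} (f : Cochain k D.Alg X m) (r : Fin n → k) (x y : D.Alg)
    (t : Fin m → D.Alg) (i : Fin m) :
    extend f (Function.update (Fin.cons x (Fin.snoc t y) : Fin (m + 2) → D.Alg) i.castSucc.succ
      (D.scalar r * (Fin.cons x (Fin.snoc t y) : Fin (m + 2) → D.Alg) i.castSucc.succ)) =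
      x • op y • f (Function.update t i (D.scalar r * t i)) := by
  rw [cons_snoc_castSucc_succ, update_cons_snoc_castSucc_succ, extend_cons_snoc]

/-- The conditions at the left end, at the right end, between neighbours and in degree 0 are one and
the same condition once the two outer arguments are included. Setting these outer arguments to `1`
recovers each condition. -/
theorem mem_relative_iff {m : ℕ} (f : Cochain k D.Alg X m) : f ∈ D.relative X m ↔ IsBalanced f := by
  constructor
  · rintro ⟨h1, h2, h3, h4⟩ r b i
    obtain ⟨x, b, rfl⟩ : ∃ x b', b = Fin.cons x b' := ⟨b 0, Fin.tail b, (Fin.cons_self_tail b).symm⟩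
    obtain ⟨t, y, rfl⟩ : ∃ t y, b = Fin.snoc t y :=
      ⟨Fin.init b, b (Fin.last m), (Fin.snoc_init_self b).symm⟩
    cases m with
    | zero =>
      obtain rfl : i = 0 := Fin.eq_zero i
      rw [extend_update_zero, h4 r t rfl]
      exact (extend_update_last f r x y t).symm
    | succ m =>
      cases i using Fin.cases with
      | zero =>
        rw [extend_update_zero, ← h1 r t 0 rfl]
        exact (extend_update_succ f r x y t 0).symm
      | succ i =>
        rw [extend_update_castSucc]
        cases i using Fin.lastCases with
        | last =>
          rw [h2 r t _ rfl]
          exact (extend_update_last f r x y t).symm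
        | cast i =>
          rw [h3 r t i.castSucc i.succ (by simp)]
          exact (extend_update_succ f r x y t i.succ).symm
  · intro hf
    have key := fun r t => hf r (Fin.cons 1 (Fin.snoc t 1))
    have one (x : X) : (1 : D.Alg) • op (1 : D.Alg) • x = x := by rw [op_one, one_smul, one_smul]
    refine ⟨fun r t i hi => ?_, fun r t i hi => ?_, fun r t i j hij => ?_, fun r t hm => ?_⟩
    · obtain ⟨m, rfl⟩ : ∃ m', m = m' + 1 := ⟨m - 1, by omega⟩
      obtain rfl : i = 0 := Fin.ext hi
      have h := key r t 0
      rw [extend_update_zero, one] at h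
      exact (h.trans ((extend_update_succ f r 1 1 t 0).trans (one _))).symm
    · obtain ⟨m, rfl⟩ : ∃ m', m = m' + 1 := ⟨m - 1, by omega⟩
      obtain rfl : i = Fin.last m := Fin.ext (by simpa using hi)
      have h := key r t (Fin.last m).succ
      rw [extend_update_castSucc, one] at h
      exact h.trans ((extend_update_last f r 1 1 t).trans (one _))
    · obtain ⟨m, rfl⟩ : ∃ m', m = m' + 1 := ⟨m - 1, by omega⟩
      have h := key r t i.succ
      rw [extend_update_castSucc, one] at h
      have e : i.succ = j.castSucc := Fin.ext (by simpa using hij)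
      rw [e, extend_update_succ, one] at h
      exact h
    · subst hm
      have h := key r t 0
      rw [extend_update_zero, one] at h
      exact h.trans ((extend_update_last f r 1 1 t).trans (one _))

theorem coboundary_mem_relative {m : ℕ} {f : Cochain k D.Alg X m} (hf : f ∈ D.relative X m) :
    coboundary k D.Alg X m f ∈ D.relative X (m + 1) := by
  rw [mem_relative_iff] at hf ⊢
  exact hf.coboundary

/-- A cochain that is supported on the summand of the sequence `v`. -/
structure IsHomogeneous {m : ℕ} (v : Fin (m + 1) → Fin n) (f : Cochain k D.Alg X m) : Prop where
  left : ∀ (r : Fin n → k) t (i : Fin m),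
    f (Function.update t i (D.scalar r * t i)) = r (v i.castSucc) • f t
  right : ∀ (r : Fin n → k) t (i : Fin m),
    f (Function.update t i (t i * D.scalar r)) = r (v i.succ) • f t
  mem_corner : ∀ t, f t ∈ D.corner X (v 0) (v (Fin.last m))

/-- In every slot `R` acts through the character `r ↦ r (v s)` of a vertex, and each balancing
condition compares two actions at the same vertex. -/
theorem IsHomogeneous.mem_relative {m : ℕ} {v : Fin (m + 1) → Fin n} {f : Cochain k D.Alg X m}
    (hf : IsHomogeneous v f) : f ∈ D.relative X m := by
  have hl := fun r t => scalar_smul_corner r ⟨f t, hf.mem_corner t⟩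
  have hr := fun r t => op_scalar_smul_corner r ⟨f t, hf.mem_corner t⟩
  refine ⟨fun r t i hi => ?_, fun r t i hi => ?_, fun r t i j hij => ?_, fun r t hm => ?_⟩
  · rw [hf.left, hl, show i.castSucc = 0 from Fin.ext hi]
  · rw [hf.right, hr, show i.succ = Fin.last m from Fin.ext hi]
  · rw [hf.left, hf.right, show i.succ = j.castSucc from Fin.ext hij]
  · subst hm
    exact (hl r t).trans (hr r t).symm

theorem mem_corner_of_mem_relative {m : ℕ} {f : Cochain k D.Alg X (m + 1)}
    (hf : f ∈ D.relative X (m + 1)) {t : Fin (m + 1) → D.Alg} {j i : Fin n}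
    (hj : D.e j * t 0 = t 0) (hi : t (Fin.last m) * D.e i = t (Fin.last m)) :
    f t ∈ D.corner X j i := by
  obtain ⟨h1, h2, -, -⟩ := hf
  constructor
  · have := h1 (Pi.single j 1) t 0 rfl
    rw [scalar_single, hj, Function.update_eq_self] at this
    exact this.symm
  · have := h2 (Pi.single i 1) t (Fin.last m) rfl
    rw [scalar_single, hi, Function.update_eq_self] at this
    exact this.symm

theorem coe_proj_of_mem {j i : Fin n} {x : X} (hx : x ∈ D.corner X j i) :
    (D.proj X j i x : X) = x := by
  change D.e j • op (D.e i) • x = x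
  rw [hx.2, hx.1]

theorem proj_coe {j i : Fin n} (x : D.corner X j i) : D.proj X j i (x : X) = x :=
  Subtype.ext (coe_proj_of_mem x.2)

theorem ofDiag_mul_e (j : Fin n) (a : D.A j) : D.ofDiag j a * D.e j = D.ofDiag j a := by
  rw [e, ← ofDiag_mul, mul_one]

theorem e_mul_ofDiag (j : Fin n) (a : D.A j) : D.e j * D.ofDiag j a = D.ofDiag j a := by
  rw [e, ← ofDiag_mul, one_mul]

theorem proj_ofDiag_smul (j i : Fin n) (a : D.A j) (x : X) :
    D.proj X j i (D.ofDiag j a • x) = a • D.proj X j i x := by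
  apply Subtype.ext
  change D.e j • op (D.e i) • D.ofDiag j a • x = D.ofDiag j a • D.e j • op (D.e i) • x
  rw [← smul_comm (D.ofDiag j a), smul_smul, smul_smul, e_mul_ofDiag, ofDiag_mul_e]

theorem proj_op_ofDiag_smul (j i : Fin n) (a : D.A i) (x : X) :
    D.proj X j i (op (D.ofDiag i a) • x) = op a • D.proj X j i x := by
  apply Subtype.ext
  change D.e j • op (D.e i) • op (D.ofDiag i a) • x =
    op (D.ofDiag i a) • D.e j • op (D.e i) • x
  rw [← smul_comm (D.e j) (op (D.ofDiag i a)), smul_smul (op _), smul_smul (op _), ← op_mul,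
    ← op_mul, e_mul_ofDiag, ofDiag_mul_e]

variable (D X) in
/-- `restrictDiag` as a linear map. -/
def restrictDiagₗ (l : ℕ) (j : Fin n) :
    Cochain k D.Alg X l →ₗ[k] Cochain k (D.A j) (D.corner X j j) l where
  toFun f := restrictDiag f j
  map_add' f g := by ext t; simp [restrictDiag]
  map_smul' r f := by ext t; simp [restrictDiag]

theorem restrictDiag_apply {l : ℕ} (f : Cochain k D.Alg X l) (j : Fin n) (t : Fin l → D.A j) :
    restrictDiag f j t = D.proj X j j (f fun i => D.ofDiag j (t i)) := rfl

/-- The inclusion of `A j` in the triangular algebra is multiplicative, although not unital, and `x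
↦ e_j x e_j` is linear over `A j` on both sides. Thus every face restricts to the corresponding
face, for arbitrary cochains. -/
theorem restrictDiag_coboundary {l : ℕ} (f : Cochain k D.Alg X l) (j : Fin n) :
    restrictDiag (coboundary k D.Alg X l f) j =
      coboundary k (D.A j) (D.corner X j j) l (restrictDiag f j) := by
  ext1 t
  rw [restrictDiag_apply, coboundary_apply, coboundary_apply]
  simp only [map_add, map_sum, map_smul]
  congr 1
  · congr 1
    · exact proj_ofDiag_smul j j _ _
    · refine Finset.sum_congr rfl fun i _ => ?_
      rw [restrictDiag_apply]
      congr 3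
      funext s
      simp only [Fin.contractNth]
      split_ifs
      · rfl
      · exact (D.ofDiag_mul j _ _).symm
      · rfl
  · congr 1
    exact proj_op_ofDiag_smul j j _ _

/-- The matrix entry at position `(j, j)`. -/
def diagₗ (j : Fin n) : D.Alg →ₗ[k] D.A j where
  toFun t := t.diag j
  map_add' _ _ := rfl
  map_smul' _ _ := rfl

/-- Extension of cochains of the diagonal algebras to the triangular algebra. -/
def extendDiag {l : ℕ} (j : Fin n) :
    Cochain k (D.A j) (D.corner X j j) l →ₗ[k] Cochain k D.Alg X l where
  toFun g := (D.corner X j j).subtype.compMultilinearMap (g.compLinearMap fun _ => diagₗ j)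
  map_add' _ _ := rfl
  map_smul' _ _ := rfl

theorem extendDiag_apply {l : ℕ} (j : Fin n) (g : Cochain k (D.A j) (D.corner X j j) l)
    (t : Fin l → D.Alg) : extendDiag j g t = g (fun i => (t i).diag j) := rfl

/-- The extension depends only on the entries at `(j, j)`, where multiplication by an element `r` of
`R` from either side is multiplication by `r j`. -/
theorem extendDiag_isHomogeneous {l : ℕ} (j : Fin n) (g : Cochain k (D.A j) (D.corner X j j) l) :
    IsHomogeneous (fun _ => j) (extendDiag j g) := by
  refine ⟨fun r t i => ?_, fun r t i => ?_, fun t => (g _).2⟩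
  all_goals
    rw [extendDiag_apply, extendDiag_apply]
    have h : ∀ x : D.Alg, (fun s => (Function.update t i x s).diag j) =
        Function.update (fun s => (t s).diag j) i (x.diag j) := fun x => by
      funext s
      by_cases hs : s = i
      · subst hs; simp
      · simp [hs]
    rw [h]
    first | rw [scalar_mul_diag] | rw [mul_scalar_diag]
    rw [MultilinearMap.map_update_smul, Function.update_eq_self]
    rfl

theorem proj_of_mem_of_ne {j i : Fin n} (h : j ≠ i) (j' i' : Fin n) {x : X}
    (hx : x ∈ D.corner X i i') : D.proj X j j' x = 0 := by
  apply Subtype.ext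
  change D.e j • op (D.e j') • x = 0
  have := scalar_smul_corner (Pi.single j 1) ⟨x, hx⟩
  rw [scalar_single, Pi.single_eq_of_ne h.symm, zero_smul] at this
  rw [smul_comm, this, smul_zero]

variable (D X) in
/-- Extension by the diagonal. -/
def extendDiagSum (l : ℕ) :
    (∀ j, Cochain k (D.A j) (D.corner X j j) l) →ₗ[k] Cochain k D.Alg X l :=
  ∑ j, extendDiag j ∘ₗ LinearMap.proj j

theorem extendDiagSum_apply {l : ℕ} (g : ∀ j, Cochain k (D.A j) (D.corner X j j) l) (t : Fin l → D.Alg) :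
    D.extendDiagSum X l g t = ∑ j, (g j (fun i => (t i).diag j) : X) := by
  simp [extendDiagSum, extendDiag_apply]

theorem extendDiagSum_mem_relative {l : ℕ} (g : ∀ j, Cochain k (D.A j) (D.corner X j j) l) :
    D.extendDiagSum X l g ∈ D.relative X l := by
  simp only [extendDiagSum, LinearMap.sum_apply, LinearMap.comp_apply]
  exact Submodule.sum_mem _ fun j _ => (extendDiag_isHomogeneous j _).mem_relative

theorem restrictDiag_extendDiagSum {l : ℕ} (g : ∀ j, Cochain k (D.A j) (D.corner X j j) l)
    (j : Fin n) : restrictDiag (D.extendDiagSum X l g) j = g j := by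
  ext1 t
  rw [restrictDiag_apply, extendDiagSum_apply, map_sum, Finset.sum_eq_single j]
  · rw [proj_coe]
    congr 1
    funext i
    simp [ofDiag]
  · intro i _ hi
    exact proj_of_mem_of_ne hi.symm _ _ (g i _).2
  · simp

theorem ofDiag_mem_block (j : Fin n) (a : D.A j) : D.ofDiag j a ∈ D.block j j :=
  ⟨e_mul_ofDiag j a, ofDiag_mul_e j a⟩

theorem ofOff_mem_block (p : Pair n) (m : D.M p.1.1 p.1.2) : D.ofOff p m ∈ D.block p.1.1 p.1.2 :=
  ⟨by rw [e, ofDiag_mul_ofOff, one_smul], by rw [e, ofOff_mul_ofDiag, op_one, one_smul]⟩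

theorem diag_of_mem_block {j i : Fin n} {t : D.Alg} (ht : t ∈ D.block j i) (s : Fin n)
    (hs : s ≠ j ∨ s ≠ i) : t.diag s = 0 := by
  rcases hs with hs | hs
  · rw [← ht.1, ← scalar_single, scalar_mul_diag, Pi.single_eq_of_ne hs, zero_smul]
  · rw [← ht.2, ← scalar_single, mul_scalar_diag, Pi.single_eq_of_ne hs, zero_smul]

theorem off_of_mem_block {j i : Fin n} {t : D.Alg} (ht : t ∈ D.block j i) (p : Pair n)
    (hp : p.1.1 ≠ j ∨ p.1.2 ≠ i) : t.off p = 0 := by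
  rcases hp with hs | hs
  · rw [← ht.1, ← scalar_single, scalar_mul_off, Pi.single_eq_of_ne hs, zero_smul]
  · rw [← ht.2, ← scalar_single, mul_scalar_off, Pi.single_eq_of_ne hs, zero_smul]

theorem eq_ofDiag_of_mem_block {j : Fin n} {t : D.Alg} (ht : t ∈ D.block j j) :
    t = D.ofDiag j (t.diag j) := by
  ext s
  · by_cases hs : s = j
    · subst hs; simp [ofDiag]
    · rw [diag_of_mem_block ht s (Or.inl hs)]
      simp [ofDiag, hs]
  · rw [off_of_mem_block ht s]
    · rfl
    -- A pair has distinct indices, so it cannot sit at position `(j, j)`.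
    · by_contra! h
      exact s.2.ne (h.2.trans h.1.symm)

theorem eq_ofOff_of_mem_block {p : Pair n} {t : D.Alg} (ht : t ∈ D.block p.1.1 p.1.2) :
    t = D.ofOff p (t.off p) := by
  ext s
  · rw [diag_of_mem_block ht s]
    · rfl
    · by_contra! h
      exact p.2.ne (h.2.symm.trans h.1)
  · by_cases hs : s = p
    · subst hs; simp [ofOff]
    · rw [off_of_mem_block ht s]
      · simp [ofOff, hs]
      · by_contra! h
        exact hs (Subtype.ext (Prod.ext h.1 h.2))

theorem eq_const_of_length_eq_zero {m : ℕ} {v : Fin (m + 1) → Fin n} (hv : length v = 0) :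
    ∀ i, v i = v 0 := by
  have h : ∀ i : Fin m, v i.castSucc = v i.succ := by
    simpa [length, Finset.filter_eq_empty_iff] using hv
  intro i
  induction i using Fin.induction with
  | zero => rfl
  | succ i ih => rw [← h, ih]

theorem mem_filtration_zero {l : ℕ} {f : Cochain k D.Alg X l} :
    f ∈ D.filtration X 0 l ↔ f ∈ D.relative X l :=
  ⟨fun h => h.1, fun h => ⟨h, fun _ _ hv => absurd hv (Nat.not_lt_zero _)⟩⟩

theorem sum_e : ∑ j, D.e j = 1 := by
  have h : (∑ j, D.e j).diag = ∑ j, (D.e j).diag :=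
    map_sum (⟨⟨Alg.diag, rfl⟩, fun _ _ => rfl⟩ : D.Alg →+ ∀ i, D.A i) _ _
  have h' : (∑ j, D.e j).off = ∑ j, (D.e j).off :=
    map_sum (⟨⟨Alg.off, rfl⟩, fun _ _ => rfl⟩ : D.Alg →+ ∀ p : Pair n, D.M p.1.1 p.1.2) _ _
  ext s
  · rw [h]
    simp [e, ofDiag, Finset.sum_apply]
  · rw [h']
    simp [e, ofDiag]

/-- Sequences of length 0 are constant, and the block of `j, j` is `A j`. What remains is to see
that the projection to `e_j X e_j` in the definition of the restriction loses nothing. -/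
theorem mem_filtration_one {l : ℕ} {f : Cochain k D.Alg X l} :
    f ∈ D.filtration X 1 l ↔ f ∈ D.relative X l ∧ ∀ j, restrictDiag f j = 0 := by
  constructor
  · rintro ⟨h, hf⟩
    refine ⟨h, fun j => ?_⟩
    ext1 t
    rw [restrictDiag_apply, hf (fun _ => j) antitone_const (by simp [length]) _
      fun i => ofDiag_mem_block j (t i), map_zero]
    rfl
  · rintro ⟨h, hf⟩
    refine ⟨h, fun v _ hl x hx => ?_⟩
    have hv := eq_const_of_length_eq_zero (Nat.lt_one_iff.1 hl)
    obtain ⟨j, rfl⟩ : ∃ j, v = fun _ => j := ⟨v 0, funext hv⟩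
    have hx' : x = fun i => D.ofDiag j ((x i).diag j) :=
      funext fun i => eq_ofDiag_of_mem_block (hx i)
    cases l with
    | zero =>
      -- In degree 0 the restriction sees only `e_i x e_i`. The value commutes with `R`, so this is
      -- `e_i x`, and these components sum to `x`.
      have h1 : ∀ i, D.e i • f x = 0 := fun i => by
        have h2 := h.2.2.2 (Pi.single i 1) x rfl
        rw [scalar_single] at h2
        have h3 := DFunLike.congr_fun (hf i) (fun i => i.elim0)
        rw [restrictDiag_apply, Subsingleton.elim (fun i : Fin 0 => _) x] at h3
        have h4 : D.e i • op (D.e i) • f x = 0 := congrArg Subtype.val h3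
        rwa [← h2, smul_smul, e_mul_e] at h4
      rw [← one_smul D.Alg (f x), ← sum_e, Finset.sum_smul, Finset.sum_eq_zero fun i _ => h1 i]
    | succ l =>
      -- In positive degree the value already lies in `e_j X e_j`, since the outer arguments absorb
      -- `e_j`.
      have h1 := mem_corner_of_mem_relative h (hx 0).1 (hx (Fin.last l)).2
      have h2 := DFunLike.congr_fun (hf j) (fun i => (x i).diag j)
      rw [restrictDiag_apply, ← hx'] at h2
      rw [← coe_proj_of_mem h1, h2]
      rfl

end TriangularData

/-! ### Isomorphisms from a quotient to a finite direct sum. -/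

namespace LinearMap

variable {k V W : Type*} [CommRing k] [AddCommGroup V] [Module k V] [AddCommGroup W] [Module k W]

/-- The isomorphism `V ⧸ B ≃ W` that is induced by a surjective map with kernel `B`. -/
noncomputable def quotEquivOfKerEq (g : V →ₗ[k] W) (B : Submodule k V) (hg : LinearMap.ker g = B)
    (hs : Function.Surjective g) : (V ⧸ B) ≃ₗ[k] W :=
  (Submodule.quotEquivOfEq B (LinearMap.ker g) hg.symm).trans (g.quotKerEquivOfSurjective hs)

variable {ι : Type*} [Fintype ι] {V' : ι → Type*} [∀ i, AddCommGroup (V' i)] [∀ i, Module k (V' i)]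

/-- The isomorphism `V ⧸ B ≃ ⨁ V' i` that is induced by a jointly surjective family of maps with
common kernel `B`. -/
noncomputable def quotEquivDirectSum (g : ∀ i, V →ₗ[k] V' i) (B : Submodule k V)
    (hg : ∀ x, (∀ i, g i x = 0) ↔ x ∈ B) (hs : ∀ w : ∀ i, V' i, ∃ x, ∀ i, g i x = w i) :
    (V ⧸ B) ≃ₗ[k] ⨁ i, V' i := by
  classical
  exact ((LinearMap.pi g).quotEquivOfKerEq B (by
      ext x
      rw [← hg, LinearMap.mem_ker, funext_iff]
      rfl) fun w => (hs w).imp fun _ => funext).trans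
    (DirectSum.linearEquivFunOnFintype k ι V').symm

theorem quotEquivDirectSum_mk (g : ∀ i, V →ₗ[k] V' i) (B : Submodule k V)
    (hg : ∀ x, (∀ i, g i x = 0) ↔ x ∈ B) (hs : ∀ w : ∀ i, V' i, ∃ x, ∀ i, g i x = w i)
    (x : V) (i : ι) :
    quotEquivDirectSum g B hg hs (Submodule.Quotient.mk x) i = g i x := by
  classical
  exact congrFun ((DirectSum.linearEquivFunOnFintype k ι V').apply_symm_apply _) i

end LinearMap

/-! ### The term `E_1^{0,l}` as a sum of Hochschild cohomologies. -/

namespace TriangularData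

open Hochschild

variable {k : Type u} [Field k] {n : ℕ} (D : TriangularData k n)
  (X : Type u) [AddCommGroup X] [Module k X] [Module D.Alg X] [Module D.Algᵐᵒᵖ X]
  [SMulCommClass D.Alg D.Algᵐᵒᵖ X] [IsScalarTower k D.Alg X] [IsScalarTower k D.Algᵐᵒᵖ X]

/-- The cochains in `F^t` whose coboundary lies in `F^{t+1}`. -/
abbrev cycles (t m : ℕ) : Submodule k (Cochain k D.Alg X m) :=
  FilteredComplex.cycles₁ (coboundary k D.Alg X) (D.filtration X) t m

/-- The sum of `F^{t+1}` and the coboundaries of elements of `F^t`. -/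
abbrev boundaries (t m : ℕ) : Submodule k (Cochain k D.Alg X m) :=
  FilteredComplex.boundaries₁ (coboundary k D.Alg X) (D.filtration X) t m

variable {D X}

theorem restrictDiag_mem_cocycles {l : ℕ} (c : D.cycles X 0 l) (j : Fin n) :
    restrictDiag c.1 j ∈ cocycles k (D.A j) (D.corner X j j) l := by
  have h := (mem_filtration_one.1 c.2.2).2 j
  rw [restrictDiag_coboundary] at h
  exact h

theorem mem_cycles_zero {l : ℕ} {f : Cochain k D.Alg X l} : f ∈ D.cycles X 0 l ↔
    f ∈ D.relative X l ∧ ∀ j, restrictDiag f j ∈ cocycles k (D.A j) (D.corner X j j) l := by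
  constructor
  · exact fun h => ⟨h.1.1, fun j => restrictDiag_mem_cocycles ⟨f, h⟩ j⟩
  · rintro ⟨h, hf⟩
    exact ⟨mem_filtration_zero.2 h, mem_filtration_one.2 ⟨coboundary_mem_relative h, fun j => by
      rw [restrictDiag_coboundary]; exact hf j⟩⟩

variable (D X) in
/-- The map of a cycle to the class of its restriction. -/
def diagClass (l : ℕ) (j : Fin n) : D.cycles X 0 l →ₗ[k] D.HH X l j :=
  (Submodule.mkQ _) ∘ₗ LinearMap.codRestrict _
    (D.restrictDiagₗ X l j ∘ₗ Submodule.subtype _) fun c => restrictDiag_mem_cocycles c j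

theorem diagClass_apply {l : ℕ} (c : D.cycles X 0 l) (j : Fin n) :
    D.diagClass X l j c = HH.mk ⟨restrictDiag c.1 j, restrictDiag_mem_cocycles c j⟩ := rfl

theorem HH_mk_eq_zero {A Y : Type*} [Ring A] [Algebra k A] [AddCommGroup Y] [Module k Y]
    [Module A Y] [Module Aᵐᵒᵖ Y] [SMulCommClass A Aᵐᵒᵖ Y] [IsScalarTower k A Y]
    [IsScalarTower k Aᵐᵒᵖ Y] {l : ℕ} (f : cocycles k A Y l) :
    HH.mk f = 0 ↔ f.1 ∈ coboundaries k A Y l :=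
  Submodule.Quotient.mk_eq_zero _

theorem extendDiagSum_mem_cycles {l : ℕ} (g : ∀ j, cocycles k (D.A j) (D.corner X j j) l) :
    D.extendDiagSum X l (fun j => (g j).1) ∈ D.cycles X 0 l :=
  mem_cycles_zero.2 ⟨extendDiagSum_mem_relative _, fun j => by
    rw [restrictDiag_extendDiagSum]; exact (g j).2⟩

theorem diagClass_extendDiagSum {l : ℕ} (g : ∀ j, cocycles k (D.A j) (D.corner X j j) l)
    (j : Fin n) : D.diagClass X l j ⟨_, extendDiagSum_mem_cycles g⟩ = HH.mk (g j) := by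
  rw [diagClass_apply]
  congr 1
  exact Subtype.ext (restrictDiag_extendDiagSum _ j)

theorem diagClass_surjective {l : ℕ} (x : ∀ j, D.HH X l j) :
    ∃ c, ∀ j, D.diagClass X l j c = x j := by
  choose g hg using fun j => Submodule.Quotient.mk_surjective _ (x j)
  exact ⟨_, fun j => (diagClass_extendDiagSum g j).trans (hg j)⟩

/-- In degree 0 there is nothing to divide out besides `F¹`. In higher degrees, cochains bounding
the restrictions extend to the triangular algebra, and subtracting the coboundary of the extension
moves the cycle into `F¹`. -/
theorem diagClass_eq_zero_iff {l : ℕ} (c : D.cycles X 0 l) : (∀ j, D.diagClass X l j c = 0) ↔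
    c ∈ (D.boundaries X 0 l).submoduleOf (D.cycles X 0 l) := by
  change _ ↔ c.1 ∈ D.boundaries X 0 l
  have h0 : (∀ j, D.diagClass X l j c = 0) ↔
      ∀ j, restrictDiag c.1 j ∈ coboundaries k (D.A j) (D.corner X j j) l :=
    forall_congr' fun j => HH_mk_eq_zero _
  rw [h0]
  cases l with
  | zero =>
    change _ ↔ c.1 ∈ D.filtration X 1 0
    rw [mem_filtration_one]
    exact ⟨fun h => ⟨c.2.1.1, h⟩, fun h => h.2⟩
  | succ l =>
    change _ ↔ c.1 ∈ D.filtration X 1 (l + 1) ⊔ (D.filtration X 0 l).map (coboundary k D.Alg X l)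
    rw [Submodule.mem_sup]
    constructor
    · intro h
      choose g hg using h
      refine ⟨c.1 - coboundary k D.Alg X l (D.extendDiagSum X l g), ?_, _,
        ⟨_, mem_filtration_zero.2 (extendDiagSum_mem_relative g), rfl⟩, sub_add_cancel _ _⟩
      refine mem_filtration_one.2 ⟨sub_mem c.2.1.1
        (coboundary_mem_relative (extendDiagSum_mem_relative g)), fun j => ?_⟩
      change D.restrictDiagₗ X (l + 1) j _ = 0
      rw [map_sub]
      change restrictDiag c.1 j - restrictDiag _ j = 0
      rw [restrictDiag_coboundary, restrictDiag_extendDiagSum, hg, sub_self]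
    · rintro ⟨y, hy, _, ⟨z, -, rfl⟩, h⟩ j
      refine ⟨restrictDiag z j, ?_⟩
      rw [← restrictDiag_coboundary, ← h]
      have := (D.restrictDiagₗ X (l + 1) j).map_add y (coboundary k D.Alg X l z)
      exact (this.trans ((congrArg (· + _) ((mem_filtration_one.1 hy).2 j)).trans
        (zero_add _))).symm

variable (D X) in
/-- The isomorphism `E_1^{0,l} ≅ ⨁ HH^l(A j, e_j X e_j)`. -/
noncomputable def diagEquiv (l : ℕ) : D.E₁ X 0 l ≃ₗ[k] ⨁ j, D.HH X l j :=
  LinearMap.quotEquivDirectSum (V' := D.HH X l) (D.diagClass X l) _ diagClass_eq_zero_iff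
    diagClass_surjective

theorem diagEquiv_mk {l : ℕ} (c : D.cycles X 0 l) (j : Fin n) :
    D.diagEquiv X l (FilteredComplex.E₁.mk _ _ c) j =
      HH.mk ⟨restrictDiag c.1 j, restrictDiag_mem_cocycles c j⟩ :=
  LinearMap.quotEquivDirectSum_mk (V' := D.HH X l) _ _ _ _ c j

end TriangularData

/-! ### Restriction to words with one off-diagonal entry, as a map on the bar resolution. -/

namespace TriangularData

open Hochschild BarResolution

open scoped ModuleCat

variable {k : Type u} [Field k] {n : ℕ} {D : TriangularData k n}
  {X : Type u} [AddCommGroup X] [Module k X] [Module D.Alg X] [Module D.Algᵐᵒᵖ X]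
  [SMulCommClass D.Alg D.Algᵐᵒᵖ X] [IsScalarTower k D.Alg X] [IsScalarTower k D.Algᵐᵒᵖ X]

theorem tmul_smul_modM (p : Pair n) (a : D.A p.1.1) (b : (D.A p.1.2)ᵐᵒᵖ) (m : D.M p.1.1 p.1.2) :
    (a ⊗ₜ[k] b) • (show D.modM p from m) = (show D.modM p from a • b • m) :=
  TensorProduct.Algebra.smul_def a b m

theorem tmul_smul_modX (p : Pair n) (a : D.A p.1.1) (b : (D.A p.1.2)ᵐᵒᵖ)
    (x : D.corner X p.1.1 p.1.2) :
    (a ⊗ₜ[k] b) • (show D.modX X p from x) = (show D.modX X p from a • b • x) :=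
  TensorProduct.Algebra.smul_def a b x

/-- As an object of the module category, `M j i` gets its `k`-action through the enveloping algebra;
this agrees with the original action. -/
theorem smul_modM (p : Pair n) (r : k) (m : D.M p.1.1 p.1.2) :
    r • (show D.modM p from m) = (show D.modM p from r • m) := by
  change algebraMap k (D.A p.1.1 ⊗[k] (D.A p.1.2)ᵐᵒᵖ) r • (show D.modM p from m) = _
  rw [Algebra.TensorProduct.algebraMap_apply, tmul_smul_modM, one_smul, algebraMap_smul]

theorem smul_modX (p : Pair n) (r : k) (x : D.corner X p.1.1 p.1.2) :
    r • (show D.modX X p from x) = (show D.modX X p from r • x) := by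
  change algebraMap k (D.A p.1.1 ⊗[k] (D.A p.1.2)ᵐᵒᵖ) r • (show D.modX X p from x) = _
  rw [Algebra.TensorProduct.algebraMap_apply, tmul_smul_modX, one_smul, algebraMap_smul]

variable (D) in
/-- `ofOff` as a map on the bimodule `modM`. -/
noncomputable def offM (p : Pair n) : D.modM p →ₗ[k] D.Alg where
  toFun m := D.ofOff p m
  map_add' := map_add (D.ofOff p)
  map_smul' r m := (congrArg (D.ofOff p) (smul_modM p r m)).trans (map_smul (D.ofOff p) r _)

variable (D X) in
/-- The projection of `X` to the bimodule `modX`. -/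
def projX (p : Pair n) : X →ₗ[k] D.modX X p where
  toFun x := D.proj X p.1.1 p.1.2 x
  map_add' := map_add (D.proj X p.1.1 p.1.2)
  map_smul' r x := (map_smul (D.proj X p.1.1 p.1.2) r x).trans (smul_modX p r _).symm

theorem ofDiag_mul_offM (p : Pair n) (a : D.A p.1.1) (m : D.modM p) :
    D.ofDiag _ a * D.offM p m = D.offM p ((a ⊗ₜ[k] (1 : (D.A p.1.2)ᵐᵒᵖ)) • m) := by
  refine (ofDiag_mul_ofOff D p a m).trans (congrArg (D.ofOff p) ?_)
  exact Eq.trans (congrArg (a • ·) (one_smul _ _).symm) (tmul_smul_modM p a 1 m).symm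

theorem offM_mul_ofDiag (p : Pair n) (a : D.A p.1.2) (m : D.modM p) :
    D.offM p m * D.ofDiag _ a = D.offM p (((1 : D.A p.1.1) ⊗ₜ[k] op a) • m) := by
  refine (ofOff_mul_ofDiag D p a m).trans (congrArg (D.ofOff p) ?_)
  exact Eq.trans (one_smul _ _).symm (tmul_smul_modM p 1 (op a) m).symm

theorem projX_ofDiag_smul (p : Pair n) (a : D.A p.1.1) (x : X) :
    D.projX X p (D.ofDiag _ a • x) = (a ⊗ₜ[k] (1 : (D.A p.1.2)ᵐᵒᵖ)) • D.projX X p x := by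
  refine (proj_ofDiag_smul _ _ a x).trans ?_
  exact Eq.trans (congrArg (a • ·) (one_smul _ _).symm) (tmul_smul_modX p a 1 _).symm

theorem projX_op_ofDiag_smul (p : Pair n) (a : D.A p.1.2) (x : X) :
    D.projX X p (op (D.ofDiag _ a) • x) = ((1 : D.A p.1.1) ⊗ₜ[k] op a) • D.projX X p x := by
  refine (proj_op_ofDiag_smul _ _ a x).trans ?_
  exact Eq.trans (one_smul _ _).symm (tmul_smul_modX p 1 (op a) _).symm

/-- The word `b₁, …, b_q, m, a₁, …, a_r` in the triangular algebra. -/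
noncomputable def offWord (p : Pair n) {N q r : ℕ} (h : N = q + 1 + r) (b : Fin q → D.A p.1.1) (m : D.modM p)
    (a : Fin r → D.A p.1.2) : Fin N → D.Alg :=
  sandwich h (fun s => D.ofDiag _ (b s)) (D.offM p m) (fun s => D.ofDiag _ (a s))

theorem offWord_update_left (p : Pair n) {N q r : ℕ} (h : N = q + 1 + r) (b : Fin q → D.A p.1.1)
    (m : D.modM p) (a : Fin r → D.A p.1.2) (i : Fin q) (x : D.A p.1.1) :
    offWord p h (Function.update b i x) m a =
      Function.update (offWord p h b m a) ⟨i, by omega⟩ (D.ofDiag _ x) := by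
  rw [offWord, offWord, ← sandwich_update_left]
  congr 1
  funext s
  by_cases hs : s = i
  · subst hs; simp
  · simp [hs]

theorem offWord_update_mid (p : Pair n) {N q r : ℕ} (h : N = q + 1 + r) (b : Fin q → D.A p.1.1)
    (m x : D.modM p) (a : Fin r → D.A p.1.2) :
    offWord p h b x a = Function.update (offWord p h b m a) ⟨q, by omega⟩ (D.offM p x) :=
  sandwich_update_mid _ _ _ _ _

theorem offWord_update_right (p : Pair n) {N q r : ℕ} (h : N = q + 1 + r) (b : Fin q → D.A p.1.1)
    (m : D.modM p) (a : Fin r → D.A p.1.2) (i : Fin r) (x : D.A p.1.2) :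
    offWord p h b m (Function.update a i x) =
      Function.update (offWord p h b m a) ⟨q + 1 + i, by omega⟩ (D.ofDiag _ x) := by
  rw [offWord, offWord, ← sandwich_update_right]
  congr 1
  funext s
  by_cases hs : s = i
  · subst hs; simp
  · simp [hs]

/-- The inverse of `revOp`. -/
def unrevOp {A : Type*} {r : ℕ} (a : Fin r → Aᵐᵒᵖ) : Fin r → A := fun i => unop (a (Fin.rev i))

theorem unrevOp_revOp {A : Type*} {r : ℕ} (a : Fin r → A) : unrevOp (revOp a) = a := by
  funext s; simp [unrevOp, revOp]

theorem unrevOp_update {A : Type*} {r : ℕ} (a : Fin r → Aᵐᵒᵖ) (i : Fin r) (x : Aᵐᵒᵖ) :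
    unrevOp (Function.update a i x) = Function.update (unrevOp a) (Fin.rev i) (unop x) := by
  funext s
  by_cases hs : s = Fin.rev i
  · subst hs; simp [unrevOp]
  · have : Fin.rev s ≠ i := fun h => hs (by rw [← h, Fin.rev_rev])
    simp [unrevOp, hs, this]

/-- The restrictions of a cochain to words with one entry in `M j i`, as multilinear maps. -/
noncomputable def offMulti {l : ℕ} (p : Pair n) (f : Cochain k D.Alg X (l + 1)) :
    MultiCochain (D.modM p) (D.modX X p) l := fun x =>
  have hx : l + 1 = x.1.1 + 1 + x.1.2 := by
    have := Finset.HasAntidiagonal.mem_antidiagonal.1 x.2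
    omega
  MultilinearMap.mk' (fun b => MultilinearMap.mk' (fun a =>
    { toFun := fun m => D.projX X p (f (offWord p hx b m (unrevOp a)))
      map_add' := fun m m' => by
        rw [offWord_update_mid p hx b 0 (m + m'), offWord_update_mid p hx b 0 m,
          offWord_update_mid p hx b 0 m', map_add, MultilinearMap.map_update_add, map_add]
      map_smul' := fun c m => by
        rw [offWord_update_mid p hx b 0 (c • m), offWord_update_mid p hx b 0 m, map_smul,
          MultilinearMap.map_update_smul, map_smul, RingHom.id_apply] })
    (fun a i y z => LinearMap.ext fun m => by
      simp only [LinearMap.coe_mk, AddHom.coe_mk, LinearMap.add_apply, unrevOp_update,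
        offWord_update_right, MulOpposite.unop_add, map_add, MultilinearMap.map_update_add])
    (fun a i c y => LinearMap.ext fun m => by
      simp only [LinearMap.coe_mk, AddHom.coe_mk, LinearMap.smul_apply, unrevOp_update,
        offWord_update_right, MulOpposite.unop_smul, map_smul, MultilinearMap.map_update_smul]))
    (fun b i y z => MultilinearMap.ext fun a => LinearMap.ext fun m => by
      simp only [MultilinearMap.mk'_apply, LinearMap.coe_mk, AddHom.coe_mk, LinearMap.add_apply,
        add_apply, offWord_update_left, map_add, MultilinearMap.map_update_add])
    (fun b i c y => MultilinearMap.ext fun a => LinearMap.ext fun m => by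
      simp only [MultilinearMap.mk'_apply, LinearMap.coe_mk, AddHom.coe_mk, LinearMap.smul_apply,
        smul_apply, offWord_update_left, map_smul, MultilinearMap.map_update_smul])

theorem offMulti_apply {l : ℕ} (p : Pair n) (f : Cochain k D.Alg X (l + 1)) (q r : ℕ)
    (h : q + r = l) (b : Fin q → D.A p.1.1) (a : Fin r → (D.A p.1.2)ᵐᵒᵖ) (m : D.modM p) :
    offMulti p f (bidegree q r h) b a m = restrictOff f p q r h b m (unrevOp a) := rfl

theorem restrictOff_eq {l : ℕ} (p : Pair n) (f : Cochain k D.Alg X (l + 1)) (q r : ℕ)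
    (h : q + r = l) (b : Fin q → D.A p.1.1) (a : Fin r → D.A p.1.2) (m : D.modM p) :
    restrictOff f p q r h b m a = D.projX X p (f (offWord p (by omega) b m a)) := rfl

variable (D X) in
/-- The map on the degree `l` term of the bar resolution that corresponds to the restrictions of
a cochain. -/
noncomputable def offHom (l : ℕ) (p : Pair n) : Cochain k D.Alg X (l + 1) →ₗ[k]
    (BarResolution.X (D.modM p) l →ₗ[D.A p.1.1 ⊗[k] (D.A p.1.2)ᵐᵒᵖ] D.modX X p) :=
  barHom l ∘ₗ
    { toFun := offMulti p
      map_add' := fun f g => by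
        funext x
        ext b a m
        exact map_add (D.projX X p) _ _
      map_smul' := fun c f => by
        funext x
        ext b a m
        exact map_smul (D.projX X p) _ _ }

theorem offHom_genWord {l : ℕ} (p : Pair n) (f : Cochain k D.Alg X (l + 1)) (q r : ℕ)
    (h : q + r = l) (s : D.A p.1.1) (b : Fin q → D.A p.1.1) (s' : (D.A p.1.2)ᵐᵒᵖ)
    (a : Fin r → D.A p.1.2) (m : D.modM p) :
    D.offHom X l p f (Pi.single (bidegree q r h) (genWord (D.modM p) s b s' (revOp a) m)) =
      (s ⊗ₜ[k] s') • restrictOff f p q r h b m a := by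
  refine (barHom_single _ _ _).trans ((barLift_genWord _ _ _ _ _ _ _).trans ?_)
  refine congrArg _ ?_
  refine (offMulti_apply p f q r h b (revOp a) m).trans ?_
  rw [unrevOp_revOp]

theorem offHom_barWord {l : ℕ} (p : Pair n) (f : Cochain k D.Alg X (l + 1)) (q r : ℕ)
    (h : q + r = l) (b : Fin q → D.A p.1.1) (m : D.modM p) (a : Fin r → D.A p.1.2) :
    D.offHom X l p f (Pi.single (bidegree q r h) (barWord (D.modM p) b m a)) =
      restrictOff f p q r h b m a := by
  rw [barWord_eq, offHom_genWord, ← Algebra.TensorProduct.one_def, one_smul]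

/-- Every sequence in the opposite algebra is the reversal of one in the algebra, so it suffices to
test on words written in the order in which cochains are evaluated. -/
theorem offHom_ext {l : ℕ} (p : Pair n)
    {f g : BarResolution.X (D.modM p) l →ₗ[D.A p.1.1 ⊗[k] (D.A p.1.2)ᵐᵒᵖ] D.modX X p}
    (h : ∀ (q r : ℕ) (h : q + r = l) b a m,
      f (Pi.single (bidegree q r h) (genWord (D.modM p) 1 b 1 (revOp a) m)) =
      g (Pi.single (bidegree q r h) (genWord (D.modM p) 1 b 1 (revOp a) m))) : f = g :=
  hom_ext_genWord fun q r hq b a m => by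
    obtain ⟨a, rfl⟩ := revOp_surjective a
    exact h q r hq b a m

end TriangularData

/-! ### Comparison of the Hochschild coboundary with the bar differential. -/

theorem Fin.sum_univ_split {G : Type*} [AddCommMonoid G] {N q r : ℕ} (h : N = q + r)
    (g : Fin N → G) : ∑ i, g i =
      ∑ i : Fin q, g ⟨i, by omega⟩ + ∑ i : Fin r, g ⟨q + i, by omega⟩ := by
  subst h
  exact Fin.sum_univ_add g

theorem neg_one_pow_zsmul (k : Type*) {G : Type*} [Ring k] [AddCommGroup G] [Module k G] (l : ℕ)
    (x : G) : ((-1 : ℤ) ^ l) • x = ((-1 : k) ^ l) • x := by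
  rcases Nat.even_or_odd l with h | h <;> simp [h.neg_one_pow]

namespace TriangularData

open Hochschild BarResolution

open scoped ModuleCat

variable {k : Type u} [Field k] {n : ℕ} {D : TriangularData k n}
  {X : Type u} [AddCommGroup X] [Module k X] [Module D.Alg X] [Module D.Algᵐᵒᵖ X]
  [SMulCommClass D.Alg D.Algᵐᵒᵖ X] [IsScalarTower k D.Alg X] [IsScalarTower k D.Algᵐᵒᵖ X]

section Words

variable (p : Pair n) {N q r : ℕ}

theorem ofDiag_contractNth (j : Fin n) (b : Fin (q + 1) → D.A j) (i : Fin q) :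
    (fun s => D.ofDiag j (Fin.contractNth i.castSucc (· * ·) b s)) =
      Fin.contractNth i.castSucc (· * ·) (fun s => D.ofDiag j (b s)) := by
  funext s
  simp only [Fin.contractNth]
  split_ifs
  · rfl
  · exact D.ofDiag_mul j _ _
  · rfl

theorem offWord_zero (h : N + 1 = q + 1 + 1 + r) (b : Fin (q + 1) → D.A p.1.1) (m : D.modM p)
    (a : Fin r → D.A p.1.2) : offWord p h b m a 0 = D.ofDiag _ (b 0) :=
  sandwich_of_lt h _ _ _ (Nat.succ_pos q)

theorem offWord_last (h : N + 1 = q + 1 + (r + 1)) (b : Fin q → D.A p.1.1) (m : D.modM p)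
    (a : Fin (r + 1) → D.A p.1.2) :
    offWord p h b m a (Fin.last N) = D.ofDiag _ (a (Fin.last r)) := by
  refine (sandwich_of_gt h _ _ _ (by simp; omega)).trans ?_
  congr 2
  ext
  simp
  omega

theorem tail_offWord_succ (h : N + 1 = q + 1 + 1 + r) (b : Fin (q + 1) → D.A p.1.1)
    (m : D.modM p) (a : Fin r → D.A p.1.2) :
    Fin.tail (offWord p h b m a) = offWord p (by omega) (Fin.tail b) m a :=
  tail_sandwich_succ h _ _ _

theorem init_offWord_succ (h : N + 1 = q + 1 + (r + 1)) (b : Fin q → D.A p.1.1)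
    (m : D.modM p) (a : Fin (r + 1) → D.A p.1.2) :
    Fin.init (offWord p h b m a) = offWord p (by omega) b m (Fin.init a) :=
  init_sandwich_succ h _ _ _

theorem contractNth_offWord_left (h : N + 1 = q + 1 + 1 + r) (b : Fin (q + 1) → D.A p.1.1)
    (m : D.modM p) (a : Fin r → D.A p.1.2) (i : Fin N) (j : Fin q) (hj : (i : ℕ) = j) :
    Fin.contractNth i.castSucc (· * ·) (offWord p h b m a) =
      offWord p (by omega) (Fin.contractNth j.castSucc (· * ·) b) m a := by
  rw [offWord, contractNth_sandwich_left h _ _ _ i j hj, offWord, ofDiag_contractNth]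

theorem contractNth_offWord_left_last (h : N + 1 = q + 1 + 1 + r) (b : Fin (q + 1) → D.A p.1.1)
    (m : D.modM p) (a : Fin r → D.A p.1.2) (i : Fin N) (hi : (i : ℕ) = q) :
    Fin.contractNth i.castSucc (· * ·) (offWord p h b m a) =
      offWord p (by omega) (Fin.init b)
        ((b (Fin.last q) ⊗ₜ[k] (1 : (D.A p.1.2)ᵐᵒᵖ)) • m) a := by
  rw [offWord, contractNth_sandwich_left_last h _ _ _ i hi, ofDiag_mul_offM]
  rfl

theorem contractNth_offWord_right_first (h : N + 1 = q + 1 + (r + 1)) (b : Fin q → D.A p.1.1)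
    (m : D.modM p) (a : Fin (r + 1) → D.A p.1.2) (i : Fin N) (hi : (i : ℕ) = q) :
    Fin.contractNth i.castSucc (· * ·) (offWord p h b m a) =
      offWord p (by omega) b (((1 : D.A p.1.1) ⊗ₜ[k] op (a 0)) • m) (Fin.tail a) := by
  rw [offWord, contractNth_sandwich_right_first h _ _ _ i hi, offM_mul_ofDiag]
  rfl

theorem contractNth_offWord_right (h : N + 1 = q + 1 + (r + 1)) (b : Fin q → D.A p.1.1)
    (m : D.modM p) (a : Fin (r + 1) → D.A p.1.2) (i : Fin N) (j : Fin r)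
    (hj : (i : ℕ) = q + 1 + j) :
    Fin.contractNth i.castSucc (· * ·) (offWord p h b m a) =
      offWord p (by omega) b m (Fin.contractNth j.castSucc (· * ·) a) := by
  rw [offWord, contractNth_sandwich_right h _ _ _ i j hj, offWord, ofDiag_contractNth]

end Words

/-- The restriction of `offHom` to a summand. -/
noncomputable def offHomSingle {l : ℕ} (p : Pair n) (f : Cochain k D.Alg X (l + 1)) (q r : ℕ)
    (h : q + r = l) : P (D.modM p) q r →ₗ[k] D.modX X p :=
  ((D.offHom X l p f).comp (LinearMap.single (D.A p.1.1 ⊗[k] (D.A p.1.2)ᵐᵒᵖ)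
    (fun x : Finset.HasAntidiagonal.antidiagonal l => P (D.modM p) x.1.1 x.1.2)
    (bidegree q r h))).restrictScalars k

theorem offHomSingle_apply {l : ℕ} (p : Pair n) (f : Cochain k D.Alg X (l + 1)) (q r : ℕ)
    (h : q + r = l) (y : P (D.modM p) q r) :
    offHomSingle p f q r h y = D.offHom X l p f (Pi.single (bidegree q r h) y) := rfl

theorem offHomSingle_genWord {l : ℕ} (p : Pair n) (f : Cochain k D.Alg X (l + 1)) (q r : ℕ)
    (h : q + r = l) (s : D.A p.1.1) (b : Fin q → D.A p.1.1) (s' : (D.A p.1.2)ᵐᵒᵖ)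
    (a : Fin r → D.A p.1.2) (m : D.modM p) :
    offHomSingle p f q r h (genWord (D.modM p) s b s' (revOp a) m) =
      (s ⊗ₜ[k] s') • D.projX X p (f (offWord p (by omega) b m a)) :=
  offHom_genWord p f q r h s b s' a m

/-- The `q + 1` contractions are the `q` products inside `b` together with the product of the last
`b` with `m`; the latter is the term of the bar differential in which `L` acts on the bimodule. -/
theorem offHom_dL {l : ℕ} (p : Pair n) (f : Cochain k D.Alg X (l + 1)) (q r : ℕ)
    (h : q + r = l) (h' : l + 1 + 1 = q + 1 + 1 + r) (b : Fin (q + 1) → D.A p.1.1) (m : D.modM p)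
    (a : Fin r → D.A p.1.2) :
    D.offHom X l p f (Pi.single (bidegree q r h)
        (dL (D.modM p) q r (genWord (D.modM p) 1 b 1 (revOp a) m))) =
      D.projX X p (offWord p h' b m a 0 • f (Fin.tail (offWord p h' b m a))) +
      ∑ i : Fin (q + 1), ((-1 : k) ^ (i + 1 : ℕ)) • D.projX X p
        (f (Fin.contractNth (Fin.castSucc ⟨i, by omega⟩) (· * ·) (offWord p h' b m a))) := by
  rw [dL_genWord, ← offHomSingle_apply, map_add, map_add, map_sum, map_smul, offHomSingle_genWord,
    offHomSingle_genWord, ← Algebra.TensorProduct.one_def, one_smul, Fin.sum_univ_castSucc, add_assoc]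
  congr 1
  · rw [offWord_zero, projX_ofDiag_smul, tail_offWord_succ]
  · congr 1
    · refine Finset.sum_congr rfl fun i _ => ?_
      rw [map_smul, offHomSingle_genWord, ← Algebra.TensorProduct.one_def, one_smul,
        contractNth_offWord_left p h' b m a _ i rfl]
      rfl
    · rw [contractNth_offWord_left_last p h' b m a _ (by simp)]
      rfl

/-- Because of the reversal, the first term of the bar differential is the last face of the
coboundary, and its final term is the product of `m` with the first `a`. The factor `(-1)^l` gives
the last face the sign `(-1)^(l+2)`, and for the other terms `l = q + r` makes the signs agree up to
an even power of `-1`. -/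
theorem offHom_dR {l : ℕ} (p : Pair n) (f : Cochain k D.Alg X (l + 1)) (q r : ℕ)
    (h : q + r = l) (h' : l + 1 + 1 = q + 1 + (r + 1)) (b : Fin q → D.A p.1.1) (m : D.modM p)
    (a : Fin (r + 1) → D.A p.1.2) :
    ((-1 : k) ^ l) • D.offHom X l p f (Pi.single (bidegree q r h)
        (dR (D.modM p) q r (genWord (D.modM p) 1 b 1 (revOp a) m))) =
      ∑ i : Fin (r + 1), ((-1 : k) ^ (q + i + 1 : ℕ)) • D.projX X p
        (f (Fin.contractNth (Fin.castSucc ⟨q + i, by omega⟩) (· * ·) (offWord p h' b m a))) +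
      ((-1 : k) ^ (l + 1 + 1)) • D.projX X p (op (offWord p h' b m a (Fin.last _)) •
        f (Fin.init (offWord p h' b m a))) := by
  rw [dR_genWord, ← offHomSingle_apply, map_add, map_add, map_sum, map_smul, revOp_zero, revOp_last,
    tail_revOp, init_revOp, offHomSingle_genWord,
    offHomSingle_genWord, ← Algebra.TensorProduct.one_def, one_smul, Fin.sum_univ_succ,
    smul_add, smul_add, add_rotate]
  congr 1
  swap
  · rw [offWord_last, projX_op_ofDiag_smul, init_offWord_succ]
    congr 1
    rw [pow_succ, pow_succ]
    simp
  rw [add_comm]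
  congr 1
  · rw [contractNth_offWord_right_first p h' b m a _ (by simp), smul_smul]
    congr 1
    rw [← pow_add, show l + (r + 1) = q + ((0 : Fin (r + 1)) : ℕ) + 1 + 2 * r by simp; omega, pow_add _ _ (2 * r),
      pow_mul]
    simp
  -- Contractions among the `a` occur in mirror order in the bar differential, so the sum is
  -- reindexed by reversal.
  · rw [← Equiv.sum_comp Fin.revPerm, Finset.smul_sum]
    refine Finset.sum_congr rfl fun i _ => ?_
    rw [map_smul, contractNth_revOp, offHomSingle_genWord, ← Algebra.TensorProduct.one_def, one_smul,
      contractNth_offWord_right p h' b m a _ i (by simp; omega), smul_smul, Fin.revPerm_apply,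
      Fin.rev_rev]
    congr 1
    rw [← pow_add, show l + ((Fin.rev i : Fin r) + 1 : ℕ) =
      q + (i.succ : ℕ) + 1 + 2 * (Fin.rev i : ℕ) by simp; omega, pow_add _ _ (2 * _), pow_mul]
    simp

theorem apply_eq_zero_of_diag {l : ℕ} {f : Cochain k D.Alg X l} (hf : f ∈ D.filtration X 1 l)
    (j : Fin n) (a : Fin l → D.A j) : f (fun s => D.ofDiag j (a s)) = 0 :=
  hf.2 (fun _ => j) antitone_const (by simp [length]) _ fun i => ofDiag_mem_block j (a i)

theorem apply_tail_offWord {l : ℕ} (p : Pair n) {f : Cochain k D.Alg X l}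
    (hf : f ∈ D.filtration X 1 l) (r : ℕ) (h : l + 1 = 0 + 1 + r) (b : Fin 0 → D.A p.1.1)
    (m : D.modM p) (a : Fin r → D.A p.1.2) : f (Fin.tail (offWord p h b m a)) = 0 := by
  rw [offWord, tail_sandwich_zero]
  exact apply_eq_zero_of_diag hf _ fun s => a (Fin.cast _ s)

theorem apply_init_offWord {l : ℕ} (p : Pair n) {f : Cochain k D.Alg X l}
    (hf : f ∈ D.filtration X 1 l) (q : ℕ) (h : l + 1 = q + 1 + 0) (b : Fin q → D.A p.1.1)
    (m : D.modM p) (a : Fin 0 → D.A p.1.2) : f (Fin.init (offWord p h b m a)) = 0 := by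
  rw [offWord, init_sandwich_zero]
  exact apply_eq_zero_of_diag hf _ fun s => b (Fin.cast _ s)

/-- On cochains that vanish on the diagonal words, the restriction to the words with one
off-diagonal entry commutes with the differentials. -/
theorem offHom_coboundary {l : ℕ} (p : Pair n) {f : Cochain k D.Alg X (l + 1)}
    (hf : f ∈ D.filtration X 1 (l + 1)) :
    D.offHom X (l + 1) p (coboundary k D.Alg X (l + 1) f) =
      D.offHom X l p f ∘ₗ BarResolution.d (D.modM p) l := by
  refine offHom_ext p fun q r h b a m => ?_
  rw [offHom_genWord, ← Algebra.TensorProduct.one_def, one_smul, restrictOff_eq, coboundary_apply,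
    map_add, map_add, map_sum, LinearMap.comp_apply]
  simp only [map_smul]
  -- The first `q` contractions involve the entries `b`, up to the product with `m`, and belong to
  -- `dL`; the other `r` start with `m` times the first `a` and belong to `dR`.
  rw [Fin.sum_univ_split (show l + 1 = q + r by omega)]
  cases q with
  | zero =>
    cases r with
    | zero => omega
    | succ r =>
      obtain rfl : r = l := by omega
      -- With no entries `b`, the first face is `m` acting on the value at a word in `A i` alone.
      -- The bar differential has no such term, and the face vanishes because `f` lies in `F¹`; the
      -- last face is treated in the same way when there are no entries `a`.
      rw [d_single_zero_succ, map_zsmul, neg_one_pow_zsmul k,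
        offHom_dR p f 0 r (by omega) (by omega) b m a, apply_tail_offWord p hf,
        smul_zero, map_zero, zero_add, Fin.sum_univ_zero, zero_add]
  | succ q =>
    cases r with
    | zero =>
      obtain rfl : q = l := by omega
      rw [d_single_succ_zero, offHom_dL p f q 0 rfl (by omega) b m a, apply_init_offWord p hf,
        smul_zero, map_zero, smul_zero, add_zero, Fin.sum_univ_zero]
      exact congrArg _ (add_zero _)
    | succ r =>
      rw [d_single_succ_succ, map_add, map_zsmul, neg_one_pow_zsmul k,
        offHom_dL p f q (r + 1) (by omega) (by omega) b m a,
        offHom_dR p f (q + 1) r (by omega) (by omega) b m a]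
      abel

end TriangularData

/-! ### Extension by zero of cochains on words with one off-diagonal entry. -/

theorem revOp_update {A : Type*} {r : ℕ} (a : Fin r → A) (i : Fin r) (x : A) :
    revOp (Function.update a i x) = Function.update (revOp a) (Fin.rev i) (op x) := by
  funext s
  by_cases hs : s = Fin.rev i
  · subst hs; simp [revOp]
  · have : Fin.rev s ≠ i := fun h => hs (by rw [← h, Fin.rev_rev])
    simp [revOp, hs, this]

namespace TriangularData

open Hochschild BarResolution

open scoped ModuleCat

variable {k : Type u} [Field k] {n : ℕ} {D : TriangularData k n}
  {X : Type u} [AddCommGroup X] [Module k X] [Module D.Alg X] [Module D.Algᵐᵒᵖ X]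
  [SMulCommClass D.Alg D.Algᵐᵒᵖ X] [IsScalarTower k D.Alg X] [IsScalarTower k D.Algᵐᵒᵖ X]

variable (D) in
/-- The matrix entry at position `p`, in the bimodule `modM`. -/
noncomputable def offₗ (p : Pair n) : D.Alg →ₗ[k] D.modM p where
  toFun t := t.off p
  map_add' _ _ := rfl
  map_smul' r t := (smul_modM p r (t.off p)).symm

variable (D X) in
/-- The inclusion of `modX` in `X`. -/
noncomputable def subX (p : Pair n) : D.modX X p →ₗ[k] X where
  toFun x := (show D.corner X p.1.1 p.1.2 from x).1
  map_add' _ _ := rfl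
  map_smul' r x := congrArg Subtype.val (smul_modX p r x)

theorem projX_subX (p : Pair n) (x : D.modX X p) : D.projX X p (D.subX X p x) = x :=
  proj_coe (show D.corner X p.1.1 p.1.2 from x)

theorem offₗ_offM (p : Pair n) (m : D.modM p) : D.offₗ p (D.offM p m) = m :=
  Pi.single_eq_same (M := fun p : Pair n => D.M p.1.1 p.1.2) p m

theorem offₗ_offM_of_ne {p p' : Pair n} (h : p ≠ p') (m : D.modM p') :
    D.offₗ p (D.offM p' m) = 0 :=
  Pi.single_eq_of_ne (M := fun p : Pair n => D.M p.1.1 p.1.2) h m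

theorem offₗ_scalar_mul (p : Pair n) (r : Fin n → k) (t : D.Alg) :
    D.offₗ p (D.scalar r * t) = r p.1.1 • D.offₗ p t :=
  (scalar_mul_off r t p).trans (smul_modM p _ (t.off p)).symm

theorem offₗ_mul_scalar (p : Pair n) (r : Fin n → k) (t : D.Alg) :
    D.offₗ p (t * D.scalar r) = r p.1.2 • D.offₗ p t :=
  (mul_scalar_off r t p).trans (smul_modM p _ (t.off p)).symm

/-- The first `q` diagonal entries. -/
def leftEntries (j : Fin n) {N q : ℕ} (h : q ≤ N) (t : Fin N → D.Alg) (s : Fin q) : D.A j :=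
  (t ⟨s, by omega⟩).diag j

/-- The last `r` diagonal entries. -/
def rightEntries (j : Fin n) {N q r : ℕ} (h : N = q + 1 + r) (t : Fin N → D.Alg) (s : Fin r) :
    D.A j :=
  (t ⟨q + 1 + s, by omega⟩).diag j

theorem leftEntries_update_of_lt (j : Fin n) {N q : ℕ} (h : q ≤ N) (t : Fin N → D.Alg) (i : Fin N)
    (hi : (i : ℕ) < q) (x : D.Alg) : leftEntries j h (Function.update t i x) =
      Function.update (leftEntries j h t) ⟨i, hi⟩ (diagₗ j x) := by
  funext s
  simp only [leftEntries, Function.update_apply, Fin.ext_iff]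
  split_ifs <;> rfl

theorem leftEntries_update_of_le (j : Fin n) {N q : ℕ} (h : q ≤ N) (t : Fin N → D.Alg) (i : Fin N)
    (hi : q ≤ (i : ℕ)) (x : D.Alg) :
    leftEntries j h (Function.update t i x) = leftEntries j h t := by
  funext s
  rw [leftEntries, Function.update_of_ne (by rw [Ne, Fin.ext_iff]; simp; omega)]
  rfl

theorem rightEntries_update_of_lt (j : Fin n) {N q r : ℕ} (h : N = q + 1 + r) (t : Fin N → D.Alg)
    (i : Fin N) (hi : q < (i : ℕ)) (x : D.Alg) : rightEntries j h (Function.update t i x) =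
      Function.update (rightEntries j h t) ⟨i - (q + 1), by omega⟩ (diagₗ j x) := by
  funext s
  simp only [rightEntries, Function.update_apply, Fin.ext_iff]
  split_ifs <;> first | rfl | omega

theorem rightEntries_update_of_le (j : Fin n) {N q r : ℕ} (h : N = q + 1 + r) (t : Fin N → D.Alg)
    (i : Fin N) (hi : (i : ℕ) ≤ q) (x : D.Alg) :
    rightEntries j h (Function.update t i x) = rightEntries j h t := by
  funext s
  rw [rightEntries, Function.update_of_ne (by rw [Ne, Fin.ext_iff]; simp; omega)]
  rfl

theorem diagₗ_scalar_mul (j : Fin n) (c : Fin n → k) (x : D.Alg) :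
    diagₗ j (D.scalar c * x) = c j • diagₗ j x := scalar_mul_diag c x j

theorem diagₗ_mul_scalar (j : Fin n) (c : Fin n → k) (x : D.Alg) :
    diagₗ j (x * D.scalar c) = c j • diagₗ j x := mul_scalar_diag c x j

theorem leftEntries_offWord (p : Pair n) {N q r : ℕ} (hN : N = q + 1 + r) (b : Fin q → D.A p.1.1) (m : D.modM p)
    (a : Fin r → D.A p.1.2) : leftEntries p.1.1 (by omega) (offWord p hN b m a) = b := by
  funext s
  rw [leftEntries, offWord, sandwich_of_lt _ _ _ _ (by simp)]
  exact Pi.single_eq_same _ _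

theorem rightEntries_offWord (p : Pair n) {N q r : ℕ} (hN : N = q + 1 + r) (b : Fin q → D.A p.1.1) (m : D.modM p)
    (a : Fin r → D.A p.1.2) : rightEntries p.1.2 hN (offWord p hN b m a) = a := by
  funext s
  rw [rightEntries, offWord, sandwich_of_gt _ _ _ _ (by simp; omega)]
  refine (Pi.single_eq_same _ _).trans (congrArg a (Fin.ext ?_))
  simp

theorem offWord_mid (p : Pair n) {N q r : ℕ} (hN : N = q + 1 + r) (b : Fin q → D.A p.1.1)
    (m : D.modM p) (a : Fin r → D.A p.1.2) : offWord p hN b m a ⟨q, by omega⟩ = D.offM p m :=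
  sandwich_of_eq _ _ _ _ rfl

theorem offₗ_offWord (p p' : Pair n) {N q r : ℕ} (hN : N = q + 1 + r) (b : Fin q → D.A p'.1.1)
    (m : D.modM p') (a : Fin r → D.A p'.1.2) (s : Fin N) (hs : p ≠ p' ∨ (s : ℕ) ≠ q) :
    D.offₗ p (offWord p' hN b m a s) = 0 := by
  rw [offWord, sandwich_apply]
  split_ifs with h1 h2
  · rfl
  · rfl
  · exact offₗ_offM_of_ne (hs.resolve_right fun h => h (by omega)) m

section Extend

variable (p : Pair n) {l q r : ℕ} (h : q + r = l)
  (φ : MultilinearMap k (fun _ : Fin q => D.A p.1.1)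
    (MultilinearMap k (fun _ : Fin r => (D.A p.1.2)ᵐᵒᵖ) (D.modM p →ₗ[k] D.modX X p)))

/-- The vertices of a word with `q` factors in `A j` and one in `M j i`. -/
def offVertices (p : Pair n) (l q : ℕ) (s : Fin (l + 2)) : Fin n :=
  if (s : ℕ) ≤ q then p.1.1 else p.1.2

/-- The value of the extension of a cochain by zero. -/
noncomputable def offValue (t : Fin (l + 1) → D.Alg) : X :=
  D.subX X p (φ (leftEntries p.1.1 (by omega) t)
    (revOp (rightEntries p.1.2 (show l + 1 = q + 1 + r by omega) t)) (D.offₗ p (t ⟨q, by omega⟩)))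

/-- In each slot the value depends on one matrix entry only: the one at `(j, j)` before place `q`,
at `(j, i)` in place `q`, and at `(i, i)` after it. Factoring through this entry gives both the
multilinearity of the extension and the characters by which `R` acts, hence homogeneity. -/
theorem exists_linearMap_offValue (t : Fin (l + 1) → D.Alg) (i : Fin (l + 1)) :
    ∃ G : D.Alg →ₗ[k] X, (∀ x, offValue p h φ (Function.update t i x) = G x) ∧
      (∀ c x, G (D.scalar c * x) = c (offVertices p l q i.castSucc) • G x) ∧
      (∀ c x, G (x * D.scalar c) = c (offVertices p l q i.succ) • G x) := by
  rcases lt_trichotomy (i : ℕ) q with hq | hq | hq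
  · let G : D.A p.1.1 →ₗ[k] X := {
      toFun := fun y => D.subX X p (φ (Function.update (leftEntries p.1.1 (by omega) t) ⟨i, hq⟩ y)
        (revOp (rightEntries p.1.2 (show l + 1 = q + 1 + r by omega) t))
        (D.offₗ p (t ⟨q, by omega⟩)))
      map_add' := fun x y => by
        simp only [map_add, MultilinearMap.map_update_add, add_apply, LinearMap.add_apply]
      map_smul' := fun c x => by
        simp only [map_smul, MultilinearMap.map_update_smul, smul_apply, LinearMap.smul_apply,
          RingHom.id_apply] }
    refine ⟨G ∘ₗ diagₗ p.1.1, fun x => ?_, fun c x => ?_, fun c x => ?_⟩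
    · rw [offValue, leftEntries_update_of_lt _ _ _ _ hq, rightEntries_update_of_le _ _ _ _ hq.le,
        Function.update_of_ne (by rw [Ne, Fin.ext_iff]; simp; omega)]
      rfl
    · rw [LinearMap.comp_apply, diagₗ_scalar_mul, map_smul, offVertices, if_pos (by simp; omega)]
      rfl
    · rw [LinearMap.comp_apply, diagₗ_mul_scalar, map_smul, offVertices, if_pos (by simp; omega)]
      rfl
  · let G : D.modM p →ₗ[k] X := D.subX X p ∘ₗ φ (leftEntries p.1.1 (by omega) t)
        (revOp (rightEntries p.1.2 (show l + 1 = q + 1 + r by omega) t))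
    refine ⟨G ∘ₗ D.offₗ p, fun x => ?_, fun c x => ?_, fun c x => ?_⟩
    · have hi : (⟨q, by omega⟩ : Fin (l + 1)) = i := Fin.ext hq.symm
      rw [offValue, leftEntries_update_of_le _ _ _ _ hq.ge, rightEntries_update_of_le _ _ _ _ hq.le,
        hi, Function.update_self]
      rfl
    · rw [LinearMap.comp_apply, offₗ_scalar_mul, map_smul, offVertices, if_pos (by simp; omega)]
      rfl
    · rw [LinearMap.comp_apply, offₗ_mul_scalar, map_smul, offVertices, if_neg (by simp; omega)]
      rfl
  · let G : D.A p.1.2 →ₗ[k] X := {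
      toFun := fun y => D.subX X p (φ (leftEntries p.1.1 (by omega) t)
        (revOp (Function.update (rightEntries p.1.2 (show l + 1 = q + 1 + r by omega) t)
          ⟨i - (q + 1), by omega⟩ y)) (D.offₗ p (t ⟨q, by omega⟩)))
      map_add' := fun x y => by
        simp only [map_add, revOp_update, MulOpposite.op_add, MultilinearMap.map_update_add,
          LinearMap.add_apply]
      map_smul' := fun c x => by
        simp only [map_smul, revOp_update, MulOpposite.op_smul, MultilinearMap.map_update_smul,
          LinearMap.smul_apply, RingHom.id_apply] }
    refine ⟨G ∘ₗ diagₗ p.1.2, fun x => ?_, fun c x => ?_, fun c x => ?_⟩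
    · rw [offValue, leftEntries_update_of_le _ _ _ _ hq.le, rightEntries_update_of_lt _ _ _ _ hq,
        Function.update_of_ne (by rw [Ne, Fin.ext_iff]; simp; omega)]
      rfl
    · rw [LinearMap.comp_apply, diagₗ_scalar_mul, map_smul, offVertices, if_neg (by simp; omega)]
      rfl
    · rw [LinearMap.comp_apply, diagₗ_mul_scalar, map_smul, offVertices, if_neg (by simp; omega)]
      rfl

/-- The extension of a cochain by zero. -/
noncomputable def offExtend : Cochain k D.Alg X (l + 1) where
  toFun := offValue p h φ
  map_update_add' t i x y := by
    rename_i inst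
    obtain rfl : inst = instDecidableEqFin _ := Subsingleton.elim _ _
    obtain ⟨G, hG, -⟩ := exists_linearMap_offValue p h φ t i
    simp only [hG, map_add]
  map_update_smul' t i c x := by
    rename_i inst
    obtain rfl : inst = instDecidableEqFin _ := Subsingleton.elim _ _
    obtain ⟨G, hG, -⟩ := exists_linearMap_offValue p h φ t i
    simp only [hG, map_smul]

theorem offExtend_apply (t : Fin (l + 1) → D.Alg) : offExtend p h φ t = offValue p h φ t := rfl

theorem offExtend_isHomogeneous : IsHomogeneous (offVertices p l q) (offExtend p h φ) := by
  refine ⟨fun c t i => ?_, fun c t i => ?_, fun t => ?_⟩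
  · obtain ⟨G, hG, h1, -⟩ := exists_linearMap_offValue p h φ t i
    have h2 := hG (t i)
    rw [Function.update_eq_self] at h2
    rw [offExtend_apply, offExtend_apply, hG, h1, h2]
  · obtain ⟨G, hG, -, h1⟩ := exists_linearMap_offValue p h φ t i
    have h2 := hG (t i)
    rw [Function.update_eq_self] at h2
    rw [offExtend_apply, offExtend_apply, hG, h1, h2]
  · have h0 : offVertices p l q 0 = p.1.1 := if_pos (Nat.zero_le q)
    have h1 : offVertices p l q (Fin.last (l + 1)) = p.1.2 := if_neg (by simp; omega)
    rw [h0, h1]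
    exact (show D.corner X p.1.1 p.1.2 from φ _ _ _).2

theorem offExtend_eq_zero (t : Fin (l + 1) → D.Alg) (ht : D.offₗ p (t ⟨q, by omega⟩) = 0) :
    offExtend p h φ t = 0 := by
  rw [offExtend_apply, offValue, ht, map_zero, map_zero]

theorem offExtend_offWord (b : Fin q → D.A p.1.1) (m : D.modM p) (a : Fin r → D.A p.1.2) :
    offExtend p h φ (offWord p (by omega) b m a) = D.subX X p (φ b (revOp a) m) := by
  rw [offExtend_apply, offValue, leftEntries_offWord, rightEntries_offWord, offWord_mid,
    offₗ_offM]

end Extend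

variable (D X) in
/-- The extension of a family of cochains by zero. -/
noncomputable def offExtendSum (l : ℕ) (φ : ∀ p, MultiCochain (D.modM p) (D.modX X p) l) :
    Cochain k D.Alg X (l + 1) :=
  ∑ p, ∑ x : Finset.HasAntidiagonal.antidiagonal l,
    offExtend p (Finset.HasAntidiagonal.mem_antidiagonal.1 x.2) (φ p x)

/-- A diagonal word has no entry at an off-diagonal position, so each summand vanishes on it. -/
theorem offExtendSum_mem_filtration {l : ℕ}
    (φ : ∀ p, MultiCochain (D.modM p) (D.modX X p) l) :
    D.offExtendSum X l φ ∈ D.filtration X 1 (l + 1) := by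
  refine Submodule.sum_mem _ fun p _ => Submodule.sum_mem _ fun x _ => mem_filtration_one.2
    ⟨(offExtend_isHomogeneous _ _ _).mem_relative, fun j => ?_⟩
  ext1 t
  rw [restrictDiag_apply, offExtend_eq_zero, map_zero]
  · rfl
  · rfl

/-- The pair `p` and the place `q` of the off-diagonal entry can be read off from a word, so all
other summands vanish on it; `r` is then determined by `q + r = l`. -/
theorem restrictOff_offExtendSum {l : ℕ} (φ : ∀ p, MultiCochain (D.modM p) (D.modX X p) l)
    (p : Pair n) (q r : ℕ) (h : q + r = l) (b : Fin q → D.A p.1.1) (m : D.modM p)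
    (a : Fin r → D.A p.1.2) :
    restrictOff (D.offExtendSum X l φ) p q r h b m a = φ p (bidegree q r h) b (revOp a) m := by
  rw [restrictOff_eq, offExtendSum, sum_apply, Finset.sum_eq_single p, sum_apply,
    Finset.sum_eq_single (bidegree q r h), offExtend_offWord, projX_subX]
  · rintro ⟨⟨q', r'⟩, hx⟩ - hne
    refine offExtend_eq_zero _ _ _ _ (offₗ_offWord _ _ _ _ _ _ _ (Or.inr fun hq => hne ?_))
    have := Finset.HasAntidiagonal.mem_antidiagonal.1 hx
    simp only at hq this
    exact Subtype.ext (Prod.ext hq (by simp; omega))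
  · exact fun h => absurd (Finset.mem_univ _) h
  · intro p' _ hp
    rw [sum_apply]
    exact Finset.sum_eq_zero fun x _ =>
      offExtend_eq_zero _ _ _ _ (offₗ_offWord _ _ _ _ _ _ _ (Or.inl hp))
  · exact fun h => absurd (Finset.mem_univ _) h

theorem offHom_offExtendSum {l : ℕ} (φ : ∀ p, MultiCochain (D.modM p) (D.modX X p) l)
    (p : Pair n) : D.offHom X l p (D.offExtendSum X l φ) = barHom l (φ p) := by
  refine offHom_ext p fun q r h b a m => ?_
  rw [offHom_genWord, restrictOff_offExtendSum, barHom_single, barLift_genWord]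

end TriangularData

/-! ### Sequences of length 1 and the second step of the filtration. -/

namespace TriangularData

open Hochschild BarResolution

open scoped ModuleCat

variable {k : Type u} [Field k] {n : ℕ} {D : TriangularData k n}
  {X : Type u} [AddCommGroup X] [Module k X] [Module D.Alg X] [Module D.Algᵐᵒᵖ X]
  [SMulCommClass D.Alg D.Algᵐᵒᵖ X] [IsScalarTower k D.Alg X] [IsScalarTower k D.Algᵐᵒᵖ X]

theorem offVertices_of_le {p : Pair n} {l q : ℕ} {s : Fin (l + 2)} (h : (s : ℕ) ≤ q) :
    offVertices p l q s = p.1.1 := if_pos h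

theorem offVertices_of_gt {p : Pair n} {l q : ℕ} {s : Fin (l + 2)} (h : q < (s : ℕ)) :
    offVertices p l q s = p.1.2 := if_neg (by omega)

theorem offVertices_antitone (p : Pair n) (l q : ℕ) : Antitone (offVertices p l q) := by
  intro s t hst
  have hst : (s : ℕ) ≤ t := hst
  have := p.2.le
  rw [offVertices, offVertices]
  split_ifs <;> omega

theorem length_offVertices_le (p : Pair n) (l q : ℕ) : length (offVertices p l q) ≤ 1 := by
  refine Finset.card_le_one.2 fun a ha b hb => Fin.ext ?_
  have h : ∀ a : Fin (l + 1), offVertices p l q a.castSucc ≠ offVertices p l q a.succ →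
      (a : ℕ) = q := fun a ha => by
    by_contra h
    rcases Nat.lt_or_gt_of_ne h with h | h
    · exact ha ((offVertices_of_le (by simp; omega)).trans
        (offVertices_of_le (by simp; omega)).symm)
    · exact ha ((offVertices_of_gt (by simp; omega)).trans
        (offVertices_of_gt (by simp; omega)).symm)
  rw [h a (Finset.mem_filter.1 ha).2, h b (Finset.mem_filter.1 hb).2]

theorem offWord_mem_block (p : Pair n) {l q r : ℕ} (h : l + 1 = q + 1 + r) (b : Fin q → D.A p.1.1)
    (m : D.modM p) (a : Fin r → D.A p.1.2) (s : Fin (l + 1)) : offWord p h b m a s ∈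
      D.block (offVertices p l q s.castSucc) (offVertices p l q s.succ) := by
  rw [offWord]
  rcases lt_trichotomy (s : ℕ) q with hs | hs | hs
  · rw [sandwich_of_lt _ _ _ _ hs, offVertices_of_le (by simp; omega),
      offVertices_of_le (by simp; omega)]
    exact ofDiag_mem_block _ _
  · rw [sandwich_of_eq _ _ _ _ hs, offVertices_of_le (by simp; omega),
      offVertices_of_gt (by simp; omega)]
    exact ofOff_mem_block _ _
  · rw [sandwich_of_gt _ _ _ _ hs, offVertices_of_gt (by simp; omega),
      offVertices_of_gt (by simp; omega)]
    exact ofDiag_mem_block _ _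

theorem eq_offWord_of_mem_block (p : Pair n) {l q r : ℕ} (h : l + 1 = q + 1 + r)
    {x : Fin (l + 1) → D.Alg} (hx : ∀ s, x s ∈
      D.block (offVertices p l q s.castSucc) (offVertices p l q s.succ)) :
    x = offWord p h (leftEntries p.1.1 (by omega) x) (D.offₗ p (x ⟨q, by omega⟩))
      (rightEntries p.1.2 h x) := by
  funext s
  have hs' := hx s
  rw [offWord]
  rcases lt_trichotomy (s : ℕ) q with hs | hs | hs
  · rw [offVertices_of_le (by simp; omega), offVertices_of_le (by simp; omega)] at hs'
    rw [sandwich_of_lt _ _ _ _ hs]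
    exact eq_ofDiag_of_mem_block hs'
  · rw [offVertices_of_le (by simp; omega), offVertices_of_gt (by simp; omega)] at hs'
    rw [sandwich_of_eq _ _ _ _ hs]
    have hi : (⟨q, by omega⟩ : Fin (l + 1)) = s := Fin.ext hs.symm
    rw [hi]
    exact eq_ofOff_of_mem_block hs'
  · rw [offVertices_of_gt (by simp; omega), offVertices_of_gt (by simp; omega)] at hs'
    rw [sandwich_of_gt _ _ _ _ hs]
    refine (eq_ofDiag_of_mem_block hs').trans ?_
    rw [rightEntries]
    congr 3
    ext
    simp
    omega

/-- The sequence changes at one place `s` only, so it is constant up to `s` and constant after it;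
since it is antitone, the change is a strict drop, and its two values form a pair. -/
theorem exists_eq_offVertices {l : ℕ} {v : Fin (l + 2) → Fin n} (hv : Antitone v)
    (h : length v = 1) : ∃ (p : Pair n) (s : Fin (l + 1)), v = offVertices p l s := by
  obtain ⟨s, hs⟩ := Finset.card_eq_one.1 h
  have hs' : ∀ a : Fin (l + 1), v a.castSucc ≠ v a.succ ↔ a = s := fun a => by
    have := Finset.ext_iff.1 hs a
    simpa using this
  have h1 : ∀ t : Fin (l + 2), (t : ℕ) ≤ s → v t = v 0 := by
    intro t
    induction t using Fin.induction with
    | zero => exact fun _ => rfl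
    | succ a ih =>
      intro ha
      rw [← ih (by simp at ha ⊢; omega)]
      by_contra hne
      have := (hs' a).1 fun h => hne h.symm
      subst this
      simp at ha
  have h2 : ∀ t : Fin (l + 2), (s : ℕ) < t → v t = v (Fin.last _) := by
    intro t
    induction t using Fin.reverseInduction with
    | last => exact fun _ => rfl
    | cast a ih =>
      intro ha
      rw [← ih (by simp at ha ⊢; omega)]
      by_contra hne
      have := (hs' a).1 hne
      subst this
      simp at ha
  have h3 : v (Fin.last _) < v 0 := by
    rw [← h1 s.castSucc (by simp), ← h2 s.succ (by simp)]
    exact lt_of_le_of_ne (hv (Fin.castSucc_le_succ s)) fun h => (hs' s).2 rfl h.symm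
  refine ⟨⟨(v 0, v (Fin.last _)), h3⟩, s, funext fun t => ?_⟩
  rcases le_or_gt (t : ℕ) s with ht | ht
  · rw [h1 t ht, offVertices_of_le ht]
  · rw [h2 t ht, offVertices_of_gt ht]

theorem offHom_eq_zero_iff {l : ℕ} (p : Pair n) (f : Cochain k D.Alg X (l + 1)) :
    D.offHom X l p f = 0 ↔ ∀ (q r : ℕ) (h : q + r = l) b m a, restrictOff f p q r h b m a = 0 := by
  constructor
  · intro h q r hq b m a
    rw [← offHom_barWord p f q r hq b m a, h, LinearMap.zero_apply]
  · intro h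
    refine offHom_ext p fun q r hq b a m => ?_
    rw [offHom_genWord, h, smul_zero, LinearMap.zero_apply]

/-- Only sequences of length exactly 1 have to be examined beyond `F¹`. Their words are those with
one entry in `M j i`, and the value there already lies in `e_j X e_i`, so no information is lost by
projecting to this corner. -/
theorem mem_filtration_two {l : ℕ} {f : Cochain k D.Alg X (l + 1)} :
    f ∈ D.filtration X 2 (l + 1) ↔ f ∈ D.filtration X 1 (l + 1) ∧ ∀ p, D.offHom X l p f = 0 := by
  constructor
  · rintro ⟨h, hf⟩
    refine ⟨⟨h, fun v hv hl => hf v hv (by omega)⟩, fun p =>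
      (offHom_eq_zero_iff p f).2 fun q r hq b m a => ?_⟩
    rw [restrictOff_eq, hf _ (offVertices_antitone p l q)
      (Nat.lt_succ_of_le (length_offVertices_le p l q)) _ (offWord_mem_block p _ b m a), map_zero]
  · rintro ⟨⟨h, hf⟩, hf'⟩
    refine ⟨h, fun v hv hl x hx => ?_⟩
    by_cases hl' : length v < 1
    · exact hf v hv hl' x hx
    · obtain ⟨p, s, rfl⟩ := exists_eq_offVertices hv (by omega)
      have h1 := mem_corner_of_mem_relative h (hx 0).1 (hx (Fin.last l)).2
      have e0 : offVertices p l s (Fin.castSucc 0) = p.1.1 := offVertices_of_le (by simp)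
      have e1 : offVertices p l s (Fin.last l).succ = p.1.2 := offVertices_of_gt (by simp; omega)
      rw [e0, e1] at h1
      have hw := eq_offWord_of_mem_block p (q := s) (r := l - s) (by omega) hx
      have h2 := (offHom_eq_zero_iff p f).1 (hf' p) s (l - s) (by omega)
        (leftEntries p.1.1 (by omega) x) (D.offₗ p (x ⟨s, by omega⟩))
        (rightEntries (q := s) p.1.2 (by omega) x)
      rw [restrictOff_eq, ← hw] at h2
      exact (coe_proj_of_mem h1).symm.trans (congrArg Subtype.val h2)

end TriangularData

/-! ### Ext classes of cocycles on the bar resolution. -/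

namespace BarResolution

open scoped ModuleCat

variable {k L R : Type u} [Field k] [Ring L] [Algebra k L] [Ring R] [Algebra k R]
  {M Y : ModuleCat.{u} (L ⊗[k] R)} {l : ℕ}

/-- A map on the degree `l` term of the bar resolution, as a morphism. -/
noncomputable def barMor (ψ : X M l →ₗ[L ⊗[k] R] Y) : (barResolution M).complex.X l ⟶ Y :=
  ModuleCat.ofHom ψ

theorem d_comp_barMor (ψ : X M l →ₗ[L ⊗[k] R] Y) :
    (barResolution M).complex.d (l + 1) l ≫ barMor ψ = barMor (ψ ∘ₗ d M l) := by
  refine (congrArg (· ≫ barMor ψ) (barComplex_d M l)).trans ?_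
  rfl

theorem barMor_zero : barMor (0 : X M l →ₗ[L ⊗[k] R] Y) = 0 := rfl

theorem barMor_eq_zero_iff (ψ : X M l →ₗ[L ⊗[k] R] Y) : barMor ψ = 0 ↔ ψ = 0 :=
  ⟨fun h => congrArg ModuleCat.Hom.hom h, fun h => congrArg barMor h⟩

theorem d_comp_barMor_eq_zero {ψ : X M l →ₗ[L ⊗[k] R] Y} (hψ : ψ ∘ₗ d M l = 0) :
    (barResolution M).complex.d (l + 1) l ≫ barMor ψ = 0 := by
  rw [d_comp_barMor, hψ, barMor_zero]

/-- The class of a cocycle on the bar resolution. -/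
noncomputable def extClass (ψ : X M l →ₗ[L ⊗[k] R] Y) (hψ : ψ ∘ₗ d M l = 0) :
    Abelian.Ext M Y l :=
  (barResolution M).extMk (barMor ψ) (l + 1) rfl (d_comp_barMor_eq_zero hψ)

theorem extClass_congr {ψ ψ' : X M l →ₗ[L ⊗[k] R] Y} (hψ : ψ ∘ₗ d M l = 0) (h : ψ' = ψ) :
    extClass ψ' (by rw [h, hψ]) = extClass ψ hψ := by
  subst h
  rfl

theorem extClass_add (ψ ψ' : X M l →ₗ[L ⊗[k] R] Y) (hψ : ψ ∘ₗ d M l = 0) (hψ' : ψ' ∘ₗ d M l = 0) :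
    extClass (ψ + ψ') (by rw [LinearMap.add_comp, hψ, hψ', add_zero]) =
      extClass ψ hψ + extClass ψ' hψ' :=
  ((barResolution M).add_extMk _ _ _ _ _ _).symm

theorem extClass_smul (r : k) (ψ : X M l →ₗ[L ⊗[k] R] Y) (hψ : ψ ∘ₗ d M l = 0) :
    extClass (r • ψ) (by rw [LinearMap.smul_comp, hψ, smul_zero]) = r • extClass ψ hψ := by
  refine Eq.trans ?_ ((barResolution M).smul_extMk r _ _ _ _).symm
  rfl

theorem extClass_surjective (x : Abelian.Ext M Y l) : ∃ ψ hψ, extClass ψ hψ = x := by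
  obtain ⟨f, hf, h⟩ := (barResolution M).extMk_surjective x (l + 1) rfl
  have h1 := (d_comp_barMor (M := M) f.hom).symm.trans hf
  exact ⟨f.hom, (barMor_eq_zero_iff _).1 h1, h⟩

theorem extClass_zero_eq_zero_iff (ψ : X M 0 →ₗ[L ⊗[k] R] Y) (hψ : ψ ∘ₗ d M 0 = 0) :
    extClass ψ hψ = 0 ↔ ψ = 0 :=
  ((barResolution M).extMk_zero_eq_zero_iff _ _ _ _).trans (barMor_eq_zero_iff ψ)

theorem extClass_succ_eq_zero_iff (ψ : X M (l + 1) →ₗ[L ⊗[k] R] Y) (hψ : ψ ∘ₗ d M (l + 1) = 0) :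
    extClass ψ hψ = 0 ↔ ∃ χ : X M l →ₗ[L ⊗[k] R] Y, χ ∘ₗ d M l = ψ := by
  refine ((barResolution M).extMk_eq_zero_iff _ _ _ _ l rfl).trans ⟨?_, ?_⟩
  · rintro ⟨g, hg⟩
    exact ⟨g.hom, congrArg ModuleCat.Hom.hom ((d_comp_barMor (M := M) g.hom).symm.trans hg)⟩
  · rintro ⟨χ, hχ⟩
    exact ⟨barMor χ, (d_comp_barMor χ).trans (congrArg barMor hχ)⟩

theorem isExtClass_extClass {A : Type u} [Ring A] [Algebra k A]
    {M Y : ModuleCat.{u} (L ⊗[k] Aᵐᵒᵖ)} {l : ℕ} {φ : BarCochain M Y l}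
    {ψ : X M l →ₗ[L ⊗[k] Aᵐᵒᵖ] Y} (hψ : ψ ∘ₗ d M l = 0)
    (h : ∀ (q p : ℕ) (h : q + p = l) (b : Fin q → L) (m : M) (a : Fin p → A),
      ψ (Pi.single (bidegree q p h) (barWord M b m a)) = φ q p h b m a) :
    IsExtClass φ (extClass ψ hψ) :=
  ⟨barMor ψ, d_comp_barMor_eq_zero hψ, h, rfl⟩

end BarResolution

/-! ### The term `E_1^{1,l}` as a sum of Ext groups. -/

namespace TriangularData

open Hochschild BarResolution

open scoped ModuleCat

variable {k : Type u} [Field k] {n : ℕ} {D : TriangularData k n}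
  {X : Type u} [AddCommGroup X] [Module k X] [Module D.Alg X] [Module D.Algᵐᵒᵖ X]
  [SMulCommClass D.Alg D.Algᵐᵒᵖ X] [IsScalarTower k D.Alg X] [IsScalarTower k D.Algᵐᵒᵖ X]

/-- The coboundary of an element of `F¹` stays in `F¹`, as restriction to the diagonal commutes with
coboundaries. The condition to lie in `F²` therefore only concerns words with one off-diagonal
entry, where it says that the restriction is a cocycle on the bar resolution. -/
theorem mem_cycles_one {l : ℕ} {f : Cochain k D.Alg X (l + 1)} : f ∈ D.cycles X 1 (l + 1) ↔
    f ∈ D.filtration X 1 (l + 1) ∧ ∀ p, D.offHom X l p f ∘ₗ d (D.modM p) l = 0 := by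
  have h0 : f ∈ D.cycles X 1 (l + 1) ↔ f ∈ D.filtration X 1 (l + 1) ∧
    coboundary k D.Alg X (l + 1) f ∈ D.filtration X 2 (l + 1 + 1) := Iff.rfl
  rw [h0]
  refine and_congr_right fun hf => ?_
  rw [mem_filtration_two, mem_filtration_one]
  simp only [offHom_coboundary _ hf]
  refine and_iff_right ⟨coboundary_mem_relative hf.1, fun j => ?_⟩
  rw [restrictDiag_coboundary, (mem_filtration_one.1 hf).2, map_zero]

theorem offHom_comp_d {l : ℕ} (c : D.cycles X 1 (l + 1)) (p : Pair n) :
    D.offHom X l p c.1 ∘ₗ d (D.modM p) l = 0 := (mem_cycles_one.1 c.2).2 p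

variable (D X) in
/-- The class in `Ext` of the restriction of a cycle. -/
noncomputable def offClass (l : ℕ) (p : Pair n) : D.cycles X 1 (l + 1) →ₗ[k] D.Ext X l p where
  toFun c := extClass (D.offHom X l p c.1) (offHom_comp_d c p)
  map_add' c c' := by
    refine Eq.trans ?_ (extClass_add _ _ (offHom_comp_d c p) (offHom_comp_d c' p))
    exact extClass_congr _ (map_add (D.offHom X l p) c.1 c'.1)
  map_smul' r c := by
    refine Eq.trans ?_ (extClass_smul r _ (offHom_comp_d c p))
    exact extClass_congr _ (map_smul (D.offHom X l p) r c.1)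

theorem offClass_apply {l : ℕ} (p : Pair n) (c : D.cycles X 1 (l + 1)) :
    D.offClass X l p c = extClass (D.offHom X l p c.1) (offHom_comp_d c p) := rfl

theorem isExtClass_offClass {l : ℕ} (p : Pair n) (c : D.cycles X 1 (l + 1)) :
    IsExtClass (restrictOff c.1 p) (D.offClass X l p c) :=
  isExtClass_extClass (offHom_comp_d c p) (offHom_barWord p c.1)

theorem offClass_surjective {l : ℕ} (x : ∀ p, D.Ext X l p) :
    ∃ c, ∀ p, D.offClass X l p c = x p := by
  choose ψ hψ h using fun p => extClass_surjective (x p)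
  have h1 : ∀ p, D.offHom X l p (D.offExtendSum X l fun p => restrictHom (ψ p)) = ψ p := fun p => by
    rw [offHom_offExtendSum, barHom_restrictHom]
  refine ⟨⟨_, mem_cycles_one.2 ⟨offExtendSum_mem_filtration _, fun p => by
    rw [h1]; exact hψ p⟩⟩, fun p => Eq.trans ?_ (h p)⟩
  exact extClass_congr (hψ p) (h1 p)

/-- The empty word lies in the summand of every one-vertex sequence, which has length 0. Writing `1`
as the sum of the idempotents also covers `n = 0`, where there is no such sequence but the algebra
is trivial. -/
theorem filtration_one_zero : D.filtration X 1 0 = ⊥ := by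
  refine eq_bot_iff.2 fun f hf => ?_
  ext x
  change f x = 0
  rw [← one_smul D.Alg (f x), ← sum_e, Finset.sum_smul]
  refine Finset.sum_eq_zero fun j _ => ?_
  rw [hf.2 (fun _ => j) antitone_const (by simp [length]) x (fun i => i.elim0), smul_zero]

/-- For `l = 0` neither side has coboundaries: `F¹` is zero in degree 0, and a degree 0 cocycle on
the bar resolution has trivial class only if it is zero. For `l > 0` the bounding maps are extended
to the triangular algebra, and the coboundary of the extension is subtracted. -/
theorem offClass_eq_zero_iff {l : ℕ} (c : D.cycles X 1 (l + 1)) :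
    (∀ p, D.offClass X l p c = 0) ↔
      c ∈ (D.boundaries X 1 (l + 1)).submoduleOf (D.cycles X 1 (l + 1)) := by
  have h0 : c ∈ (D.boundaries X 1 (l + 1)).submoduleOf (D.cycles X 1 (l + 1)) ↔
    c.1 ∈ D.filtration X 2 (l + 1) ⊔ (D.filtration X 1 l).map (coboundary k D.Alg X l) := Iff.rfl
  rw [h0]
  simp only [offClass_apply]
  cases l with
  | zero =>
    rw [filtration_one_zero, Submodule.map_bot, sup_bot_eq, mem_filtration_two]
    exact (forall_congr' fun p => extClass_zero_eq_zero_iff _ (offHom_comp_d c p)).trans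
      (and_iff_right c.2.1).symm
  | succ l =>
    rw [forall_congr' fun p => extClass_succ_eq_zero_iff _ (offHom_comp_d c p), Submodule.mem_sup]
    constructor
    · intro h
      choose χ hχ using h
      have h1 : ∀ p, D.offHom X l p (D.offExtendSum X l fun p => restrictHom (χ p)) = χ p :=
        fun p => by rw [offHom_offExtendSum, barHom_restrictHom]
      set g := D.offExtendSum X l fun p => restrictHom (χ p)
      have hg : g ∈ D.filtration X 1 (l + 1) := offExtendSum_mem_filtration _
      refine ⟨c.1 - coboundary k D.Alg X (l + 1) g, ?_, _, ⟨g, hg, rfl⟩, sub_add_cancel _ _⟩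
      refine mem_filtration_two.2 ⟨sub_mem c.2.1 ?_, fun p => ?_⟩
      · refine mem_filtration_one.2 ⟨coboundary_mem_relative hg.1, fun j => ?_⟩
        rw [restrictDiag_coboundary, (mem_filtration_one.1 hg).2, map_zero]
      · rw [map_sub, offHom_coboundary p hg, h1, hχ, sub_self]
    · rintro ⟨y, hy, _, ⟨z, hz, rfl⟩, h⟩ p
      refine ⟨D.offHom X l p z, ?_⟩
      rw [← offHom_coboundary p hz, ← h, map_add, (mem_filtration_two.1 hy).2, zero_add]

variable (D X) in
/-- The isomorphism `E_1^{1,l} ≅ ⨁ Ext^l(M j i, e_j X e_i)`. -/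
noncomputable def offEquiv (l : ℕ) : D.E₁ X 1 (l + 1) ≃ₗ[k] ⨁ p, D.Ext X l p :=
  LinearMap.quotEquivDirectSum (V' := D.Ext X l) (D.offClass X l) _ offClass_eq_zero_iff
    offClass_surjective

theorem offEquiv_mk {l : ℕ} (c : D.cycles X 1 (l + 1)) (p : Pair n) :
    D.offEquiv X l (FilteredComplex.E₁.mk _ _ c) p = D.offClass X l p c :=
  LinearMap.quotEquivDirectSum_mk (V' := D.Ext X l) _ _ _ _ c p

end TriangularData

/-! ### Maps of direct sums by components, and the coboundary of a diagonal extension. -/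

namespace TriangularData

section PairSum

variable {k : Type*} [CommRing k] {n : ℕ} {V : Fin n → Type*} [∀ j, AddCommGroup (V j)]
  [∀ j, Module k (V j)] {W : Pair n → Type*} [∀ p, AddCommGroup (W p)] [∀ p, Module k (W p)]

theorem sum_pair {G : Type*} [AddCommMonoid G] (F : Pair n → G) :
    ∑ p, F p = ∑ j : Fin n, ∑ i : {i : Fin n // j < i}, F ⟨(i, j), i.2⟩ := by
  rw [← Fintype.sum_sigma']
  exact Fintype.sum_bijective (fun p : Pair n => (⟨p.1.2, p.1.1, p.2⟩ :
    (j : Fin n) × {i : Fin n // j < i})) (Function.bijective_iff_has_inverse.2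
      ⟨fun z => ⟨(z.2.1, z.1), z.2.2⟩, fun _ => rfl, fun _ => rfl⟩) _ _ fun _ => rfl

theorem sum_pair' {G : Type*} [AddCommMonoid G] (F : Pair n → G) :
    ∑ p, F p = ∑ j : Fin n, ∑ i : {i : Fin n // i < j}, F ⟨(j, i), i.2⟩ := by
  rw [← Fintype.sum_sigma']
  exact Fintype.sum_bijective (fun p : Pair n => (⟨p.1.1, p.1.2, p.2⟩ :
    (j : Fin n) × {i : Fin n // i < j})) (Function.bijective_iff_has_inverse.2
      ⟨fun z => ⟨(z.1, z.2.1), z.2.2⟩, fun _ => rfl, fun _ => rfl⟩) _ _ fun _ => rfl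

/-- The sum over all pairs is regrouped by the index `j` of the source: `j` occurs as the column of
a pair for `cup₁` and as the row for `cup₂`. -/
theorem eq_sum_lof (c : k) (cup₁ : ∀ p : Pair n, V p.1.2 →ₗ[k] W p)
    (cup₂ : ∀ p : Pair n, V p.1.1 →ₗ[k] W p) (f : ⨁ j, V j) (y : ⨁ p, W p)
    (h : ∀ p : Pair n, y p = cup₁ p (f p.1.2) + c • cup₂ p (f p.1.1)) :
    y = ∑ j : Fin n,
      (∑ i : {i : Fin n // j < i}, DirectSum.lof k (Pair n) W ⟨(i, j), i.2⟩
          (cup₁ ⟨(i, j), i.2⟩ (f j)) +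
        c • ∑ i : {i : Fin n // i < j}, DirectSum.lof k (Pair n) W ⟨(j, i), i.2⟩
          (cup₂ ⟨(j, i), i.2⟩ (f j))) := by
  rw [Finset.sum_add_distrib, ← Finset.smul_sum,
    ← sum_pair fun p => DirectSum.lof k (Pair n) W p (cup₁ p (f p.1.2)),
    ← sum_pair' fun p => DirectSum.lof k (Pair n) W p (cup₂ p (f p.1.1)), Finset.smul_sum,
    ← Finset.sum_add_distrib, ← DirectSum.sum_univ_of y]
  refine Finset.sum_congr rfl fun p _ => ?_
  rw [h, ← DirectSum.lof_eq_of k, map_add, map_smul]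

theorem apply_eq_add_of_lof_eq_zero (B : (⨁ j, V j) →ₗ[k] ⨁ p, W p) (p : Pair n)
    (h : ∀ j y, j ≠ p.1.1 → j ≠ p.1.2 → B (DirectSum.lof k (Fin n) V j y) p = 0) (f : ⨁ j, V j) :
    B f p = B (DirectSum.lof k (Fin n) V p.1.2 (f p.1.2)) p +
      B (DirectSum.lof k (Fin n) V p.1.1 (f p.1.1)) p := by
  have h0 : B f p = ∑ j, B (DirectSum.lof k (Fin n) V j (f j)) p := by
    conv_lhs => rw [← DirectSum.sum_univ_of f]
    rw [map_sum, DFinsupp.finsetSum_apply]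
    rfl
  rw [h0]
  refine (Finset.sum_subset (Finset.subset_univ {p.1.2, p.1.1}) fun j _ hj => ?_).symm.trans
    (Finset.sum_pair p.2.ne)
  simp only [Finset.mem_insert, Finset.mem_singleton, not_or] at hj
  exact h j _ hj.2 hj.1

/-- The component of a map of direct sums. -/
def lofComponent (B : (⨁ j, V j) →ₗ[k] ⨁ p, W p) (p : Pair n) (j : Fin n) : V j →ₗ[k] W p :=
  DirectSum.component k (Pair n) W p ∘ₗ B ∘ₗ DirectSum.lof k (Fin n) V j

/-- The components of a map of direct sums from the summands `V p.1.1`, multiplied by `c`. -/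
def lofComponentSMul (B : (⨁ j, V j) →ₗ[k] ⨁ p, W p) (c : k) (p : Pair n) : V p.1.1 →ₗ[k] W p :=
  c • lofComponent B p p.1.1

theorem lofComponentSMul_apply (B : (⨁ j, V j) →ₗ[k] ⨁ p, W p) (c : k) (p : Pair n)
    (y : V p.1.1) :
    lofComponentSMul B c p y = c • B (DirectSum.lof k (Fin n) V p.1.1 y) p := rfl

/-- The components from the row index are normalised by `c`; since `c * c = 1`, the factor `c` in
front of them restores the original map. -/
theorem apply_eq_sum_lof (B : (⨁ j, V j) →ₗ[k] ⨁ p, W p)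
    (h : ∀ (p : Pair n) j y, j ≠ p.1.1 → j ≠ p.1.2 → B (DirectSum.lof k (Fin n) V j y) p = 0)
    (c : k) (hc : c * c = 1) (f : ⨁ j, V j) :
    B f = ∑ j : Fin n,
      (∑ i : {i : Fin n // j < i}, DirectSum.lof k (Pair n) W ⟨(i, j), i.2⟩
          (lofComponent B ⟨(i, j), i.2⟩ j (f j)) +
        c • ∑ i : {i : Fin n // i < j}, DirectSum.lof k (Pair n) W ⟨(j, i), i.2⟩
          (lofComponentSMul B c ⟨(j, i), i.2⟩ (f j))) := by
  refine eq_sum_lof c (fun p => lofComponent B p p.1.2) (lofComponentSMul B c) f _ fun p => ?_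
  rw [lofComponentSMul_apply, smul_smul, hc, one_smul]
  exact apply_eq_add_of_lof_eq_zero B p (h p) f

theorem lof_apply_eq (j i : Fin n) (y : V j) (F : ∀ i, V i) (hF : F j = y)
    (h : ∀ i, i ≠ j → F i = 0) : DirectSum.lof k (Fin n) V j y i = F i := by
  by_cases hi : i = j
  · subst hi
    rw [hF, DirectSum.lof_apply]
  · rw [h i hi]
    exact DFinsupp.single_eq_of_ne hi

end PairSum

open Hochschild BarResolution

open scoped ModuleCat

variable {k : Type u} [Field k] {n : ℕ} {D : TriangularData k n}
  {X : Type u} [AddCommGroup X] [Module k X] [Module D.Alg X] [Module D.Algᵐᵒᵖ X]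
  [SMulCommClass D.Alg D.Algᵐᵒᵖ X] [IsScalarTower k D.Alg X] [IsScalarTower k D.Algᵐᵒᵖ X]

theorem extendDiagSum_eq_zero {l : ℕ} (g : ∀ j, Cochain k (D.A j) (D.corner X j j) l)
    {t : Fin l → D.Alg} (s : Fin l) (hs : (t s).diag = 0) : D.extendDiagSum X l g t = 0 := by
  rw [extendDiagSum_apply]
  refine Finset.sum_eq_zero fun j _ => ?_
  rw [(g j).map_coord_zero s (congrFun hs j)]
  rfl

/-- Matrices with zero diagonal form an ideal, so after a contraction such an entry is still
present, either untouched or as part of a product. -/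
theorem exists_contractNth_diag_eq_zero {l : ℕ} {t : Fin (l + 1) → D.Alg} {s : Fin (l + 1)}
    (hs : (t s).diag = 0) (i : Fin l) :
    ∃ s' : Fin l, (Fin.contractNth i.castSucc (· * ·) t s').diag = 0 := by
  have hi := i.2
  rcases lt_trichotomy (i : ℕ) s with h | h | h
  · refine ⟨⟨s - 1, by omega⟩, ?_⟩
    have h1 : (⟨s - 1, by omega⟩ : Fin l).succ = s := Fin.ext (by simp; omega)
    by_cases h2 : (s : ℕ) - 1 = i
    · rw [Fin.contractNth_apply_of_eq _ _ _ _ (by simpa using h2), h1, Alg.diag_mul, hs, mul_zero]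
    · rw [Fin.contractNth_apply_of_gt _ _ _ _ (by simp; omega), h1, hs]
  · refine ⟨i, ?_⟩
    have h1 : i.castSucc = s := Fin.ext h
    rw [Fin.contractNth_apply_of_eq _ _ _ _ rfl, h1, Alg.diag_mul, hs, zero_mul]
  · refine ⟨⟨s, by omega⟩, ?_⟩
    have h1 : (⟨s, by omega⟩ : Fin l).castSucc = s := rfl
    rw [Fin.contractNth_apply_of_lt _ _ _ _ h, h1, hs]

/-- An element `m` of `M j i` satisfies `m = m e_i`, and `e_i` annihilates the corners with a
different row. -/
theorem ofOff_smul_of_ne (p : Pair n) (m : D.M p.1.1 p.1.2) {j i : Fin n} (h : j ≠ p.1.2)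
    (x : D.corner X j i) : D.ofOff p m • (x : X) = 0 := by
  rw [← (ofOff_mem_block p m).2, mul_smul, ← scalar_single, scalar_smul_corner,
    Pi.single_eq_of_ne h, zero_smul, smul_zero]

theorem op_ofOff_smul_of_ne (p : Pair n) (m : D.M p.1.1 p.1.2) {j i : Fin n} (h : i ≠ p.1.1)
    (x : D.corner X j i) : op (D.ofOff p m) • (x : X) = 0 := by
  rw [← (ofOff_mem_block p m).1, op_mul, mul_smul, ← scalar_single, op_scalar_smul_corner,
    Pi.single_eq_of_ne h, zero_smul, smul_zero]

theorem projX_offM_smul_extendDiagSum {l : ℕ} (p : Pair n)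
    (g : ∀ j, Cochain k (D.A j) (D.corner X j j) l) (m : D.modM p) (t : Fin l → D.Alg) :
    D.projX X p (D.offM p m • D.extendDiagSum X l g t) =
      leftMul p p.1.2 m (g p.1.2 fun s => (t s).diag p.1.2) := by
  rw [extendDiagSum_apply, Finset.smul_sum, Finset.sum_eq_single p.1.2
    (fun j _ hj => ofOff_smul_of_ne p m hj _) fun h => absurd (Finset.mem_univ _) h]
  exact proj_coe (leftMul p p.1.2 m (g p.1.2 fun s => (t s).diag p.1.2))

theorem projX_op_offM_smul_extendDiagSum {l : ℕ} (p : Pair n)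
    (g : ∀ j, Cochain k (D.A j) (D.corner X j j) l) (m : D.modM p) (t : Fin l → D.Alg) :
    D.projX X p (op (D.offM p m) • D.extendDiagSum X l g t) =
      rightMul p p.1.1 (g p.1.1 fun s => (t s).diag p.1.1) m := by
  rw [extendDiagSum_apply, Finset.smul_sum, Finset.sum_eq_single p.1.1
    (fun j _ hj => op_ofOff_smul_of_ne p m hj _) fun h => absurd (Finset.mem_univ _) h]
  exact proj_coe (rightMul p p.1.1 (g p.1.1 fun s => (t s).diag p.1.1) m)

theorem restrictOff_coboundary_extendDiagSum {l : ℕ} (p : Pair n)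
    (g : ∀ j, Cochain k (D.A j) (D.corner X j j) l) (q r : ℕ) (h : q + r = l)
    (b : Fin q → D.A p.1.1) (m : D.modM p) (a : Fin r → D.A p.1.2) :
    restrictOff (coboundary k D.Alg X l (D.extendDiagSum X l g)) p q r h b m a =
      cupLeft p (𝟙 (D.modM p)) (g p.1.2) q r h b m a +
        ((-1 : k) ^ (l + 1)) • cupRight p (g p.1.1) (𝟙 (D.modM p)) q r h b m a := by
  have hW : (offWord p (show l + 1 = q + 1 + r by omega) b m a ⟨q, by omega⟩).diag = 0 := by
    rw [offWord_mid]
    rfl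
  rw [restrictOff_eq, coboundary_apply, map_add, map_add,
    map_smul (D.projX X p) ((-1 : k) ^ (l + 1)), Finset.sum_eq_zero fun i _ => ?_,
    map_zero, add_zero]
  swap
  -- Inner faces vanish: the contracted word still has an entry with zero diagonal, and the
  -- extension depends on diagonals only.
  · obtain ⟨s', hs'⟩ := exists_contractNth_diag_eq_zero hW i
    rw [extendDiagSum_eq_zero g s' hs', smul_zero]
  congr 1
  · cases q with
    | zero =>
      have h0 : offWord p (show l + 1 = 0 + 1 + r by omega) b m a 0 = D.offM p m :=
        offWord_mid p _ b m a
      rw [h0, projX_offM_smul_extendDiagSum]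
      change _ = leftMul p p.1.2 m (g p.1.2 _)
      congr 2
      rw [offWord, tail_sandwich_zero]
      funext s
      exact Pi.single_eq_same _ _
    | succ q =>
      -- With a diagonal entry in front, the first face leaves `m` inside the argument, now at place
      -- `q` after the shift, so the value is zero.
      rw [extendDiagSum_eq_zero g ⟨q, by omega⟩, smul_zero, map_zero]
      · rfl
      · exact hW
  · congr 1
    cases r with
    | zero =>
      have hl : Fin.last l = ⟨q, by omega⟩ := Fin.ext (by simp; omega)
      have h0 : offWord p (show l + 1 = q + 1 + 0 by omega) b m a (Fin.last l) = D.offM p m := by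
        rw [hl]
        exact offWord_mid p _ b m a
      rw [h0, projX_op_offM_smul_extendDiagSum]
      change _ = rightMul p p.1.1 (g p.1.1 _) m
      congr 2
      rw [offWord, init_sandwich_zero]
      funext s
      exact Pi.single_eq_same _ _
    | succ r =>
      rw [extendDiagSum_eq_zero g ⟨q, by omega⟩, smul_zero, map_zero]
      · rfl
      · exact hW

end TriangularData

/-! ### Operations on cochains that represent Ext classes. -/

namespace BarResolution

open scoped ModuleCat

variable {k L A : Type u} [Field k] [Ring L] [Algebra k L] [Ring A] [Algebra k A]
  {M Y : ModuleCat.{u} (L ⊗[k] Aᵐᵒᵖ)} {l : ℕ}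

theorem IsExtClass.smul {φ : BarCochain M Y l} {x : Abelian.Ext M Y l} (h : IsExtClass φ x)
    (c : k) : IsExtClass (fun q p h b m a => c • φ q p h b m a) (c • x) := by
  obtain ⟨ψ, hψ, h1, rfl⟩ := h
  refine ⟨c • ψ, by rw [Linear.comp_smul, hψ, smul_zero], fun q p h b m a => ?_,
    ((barResolution M).smul_extMk c ψ _ _ hψ).symm⟩
  exact congrArg (c • ·) (h1 q p h b m a)

theorem IsExtClass.congr {φ φ' : BarCochain M Y l} {x : Abelian.Ext M Y l} (h : IsExtClass φ x)
    (h' : ∀ q p h b m a, φ q p h b m a = φ' q p h b m a) : IsExtClass φ' x := by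
  obtain rfl : φ = φ' := by
    funext q p h b m a
    exact h' q p h b m a
  exact h

/-- The words with outer factors `1` generate the bar term, so the only bimodule map that
corresponds to the zero cochain is zero. -/
theorem IsExtClass.eq_zero {x : Abelian.Ext M Y l} (h : IsExtClass (fun _ _ _ _ _ _ => 0) x) :
    x = 0 := by
  obtain ⟨ψ, hψ, h1, rfl⟩ := h
  have h2 : ψ = 0 := (barMor_eq_zero_iff (M := M) ψ.hom).2 <| hom_ext_genWord fun q p h b a m => by
    obtain ⟨a, rfl⟩ := revOp_surjective a
    rw [← barWord_eq]
    exact h1 q p h b m a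
  subst h2
  exact (barResolution M).extMk_zero _ _

end BarResolution

/-! ### The differential `d₁` and the cup product maps on cohomology. -/

namespace TriangularData

open Hochschild BarResolution

open scoped ModuleCat

variable {k : Type u} [Field k] {n : ℕ} {D : TriangularData k n}
  {X : Type u} [AddCommGroup X] [Module k X] [Module D.Alg X] [Module D.Algᵐᵒᵖ X]
  [SMulCommClass D.Alg D.Algᵐᵒᵖ X] [IsScalarTower k D.Alg X] [IsScalarTower k D.Algᵐᵒᵖ X]

theorem cupLeft_zero {l : ℕ} (p : Pair n) :
    cupLeft p (𝟙 (D.modM p)) (0 : Cochain k (D.A p.1.2) (D.corner X p.1.2 p.1.2) l) =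
      fun _ _ _ _ _ _ => 0 := by
  funext q r h b m a
  cases q with
  | zero => exact Subtype.ext (smul_zero (D.ofOff p m))
  | succ q => rfl

theorem cupRight_zero {l : ℕ} (p : Pair n) :
    cupRight p (0 : Cochain k (D.A p.1.1) (D.corner X p.1.1 p.1.1) l) (𝟙 (D.modM p)) =
      fun _ _ _ _ _ _ => 0 := by
  funext q r h b m a
  cases r with
  | zero => exact Subtype.ext (smul_zero (op (D.ofOff p m)))
  | succ r => rfl

variable (D X) in
/-- The differential `d_1^{0,l}` as a map `⨁ HH^l(A j, e_j X e_j) → ⨁ Ext^l(M j i, e_j X e_i)`. -/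
noncomputable def differential (l : ℕ) : (⨁ j, D.HH X l j) →ₗ[k] ⨁ p, D.Ext X l p :=
  (D.offEquiv X l).toLinearMap ∘ₗ D.d₁ X 0 l ∘ₗ (D.diagEquiv X l).symm.toLinearMap

theorem coboundary_mem_cycles {l : ℕ} (c : D.cycles X 0 l) :
    coboundary k D.Alg X l c.1 ∈ D.cycles X 1 (l + 1) := by
  refine ⟨c.2.2, ?_⟩
  change coboundary k D.Alg X (l + 1) (coboundary k D.Alg X l c.1) ∈ D.filtration X 2 (l + 1 + 1)
  rw [coboundary_coboundary]
  exact Submodule.zero_mem _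

theorem d₁_mk {l : ℕ} (c : D.cycles X 0 l) :
    D.d₁ X 0 l (FilteredComplex.E₁.mk _ _ c) =
      FilteredComplex.E₁.mk _ _ (⟨_, coboundary_mem_cycles c⟩ : D.cycles X 1 (l + 1)) := rfl

theorem differential_diagEquiv {l : ℕ} (y : D.E₁ X 0 l) :
    D.differential X l (D.diagEquiv X l y) = D.offEquiv X l (D.d₁ X 0 l y) := by
  rw [differential, LinearMap.comp_apply, LinearMap.comp_apply, LinearEquiv.coe_coe,
    LinearEquiv.coe_coe, LinearEquiv.symm_apply_apply]

theorem eq_diagEquiv_mk {l : ℕ} (g : ∀ j, cocycles k (D.A j) (D.corner X j j) l)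
    (x : ⨁ j, D.HH X l j) (hx : ∀ j, x j = HH.mk (g j)) :
    x = D.diagEquiv X l (FilteredComplex.E₁.mk _ _ ⟨_, extendDiagSum_mem_cycles g⟩) := by
  refine DFinsupp.ext fun j => (hx j).trans ((diagEquiv_mk _ j).trans ?_).symm
  congr 1
  exact Subtype.ext (restrictDiag_extendDiagSum _ j)

/-- The extension by the diagonal of any chosen cocycles lifts the class to a cycle in `F⁰`, and
`d₁` sends it to the class of its coboundary, whose restrictions are known. -/
theorem isExtClass_differential {l : ℕ} (g : ∀ j, cocycles k (D.A j) (D.corner X j j) l)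
    (x : ⨁ j, D.HH X l j) (hx : ∀ j, x j = HH.mk (g j)) (p : Pair n) :
    IsExtClass (fun q r h b m a => cupLeft p (𝟙 (D.modM p)) (g p.1.2).1 q r h b m a +
      ((-1 : k) ^ (l + 1)) • cupRight p (g p.1.1).1 (𝟙 (D.modM p)) q r h b m a)
      (D.differential X l x p) := by
  rw [eq_diagEquiv_mk g x hx, differential_diagEquiv, d₁_mk, offEquiv_mk]
  exact (isExtClass_offClass p _).congr fun q r h b m a =>
    restrictOff_coboundary_extendDiagSum p (fun j => (g j).1) q r h b m a

theorem lof_HH_apply {l : ℕ} {i : Fin n} (f : cocycles k (D.A i) (D.corner X i i) l) (j : Fin n) :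
    DirectSum.lof k (Fin n) (D.HH X l) i (HH.mk f) j =
      HH.mk (Pi.single (M := fun j => cocycles k (D.A j) (D.corner X j j) l) i f j) :=
  lof_apply_eq (V := D.HH X l) i j (HH.mk f)
    (fun j => HH.mk (Pi.single (M := fun j => cocycles k (D.A j) (D.corner X j j) l) i f j)) (by rw [Pi.single_eq_same]) fun j hj => by
    rw [Pi.single_eq_of_ne hj]
    rfl

variable (D X) in
/-- The map `f ↦ 1 ⌣ f`. -/
noncomputable def cupLeftMap (l : ℕ) (p : Pair n) : D.HH X l p.1.2 →ₗ[k] D.Ext X l p :=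
  lofComponent (V := D.HH X l) (W := D.Ext X l) (D.differential X l) p p.1.2

variable (D X) in
/-- The map `g ↦ g ⌣ 1`. -/
noncomputable def cupRightMap (l : ℕ) (p : Pair n) : D.HH X l p.1.1 →ₗ[k] D.Ext X l p :=
  lofComponentSMul (V := D.HH X l) (W := D.Ext X l) (D.differential X l) ((-1 : k) ^ (l + 1)) p

/-- For a class concentrated at the column index of `p`, the cochain of the other cup product is
zero, and `d₁` is represented by `1 ⌣ f` alone. That `1 ⌣ f` is a cocycle with class independent of
the representative is part of this statement, as the map is a component of `d₁`. -/
theorem isExtClass_cupLeftMap {l : ℕ} (p : Pair n)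
    (f : cocycles k (D.A p.1.2) (D.corner X p.1.2 p.1.2) l) :
    IsExtClass (cupLeft p (𝟙 (D.modM p)) f.1) (D.cupLeftMap X l p (HH.mk f)) := by
  have h := isExtClass_differential _ _ (lof_HH_apply f) p
  rw [Pi.single_eq_same, Pi.single_eq_of_ne p.2.ne'] at h
  refine h.congr fun q r h b m a => ?_
  rw [ZeroMemClass.coe_zero, cupRight_zero, smul_zero, add_zero]

theorem neg_one_pow_smul_smul {V : Type*} [AddCommGroup V] [Module k V] (l : ℕ) (x : V) :
    ((-1 : k) ^ l) • ((-1 : k) ^ l) • x = x := by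
  rw [smul_smul, ← mul_pow]
  simp

theorem isExtClass_cupRightMap {l : ℕ} (p : Pair n)
    (f : cocycles k (D.A p.1.1) (D.corner X p.1.1 p.1.1) l) :
    IsExtClass (cupRight p f.1 (𝟙 (D.modM p))) (D.cupRightMap X l p (HH.mk f)) := by
  -- The component of `d₁` is represented by `(-1)^(l+1)` times the cup product; multiplying by the
  -- same sign once more removes it.
  have h := (isExtClass_differential _ _ (lof_HH_apply f) p).smul ((-1 : k) ^ (l + 1))
  rw [Pi.single_eq_same, Pi.single_eq_of_ne p.2.ne] at h
  refine h.congr fun q r h b m a => ?_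
  rw [ZeroMemClass.coe_zero, cupLeft_zero, zero_add]
  exact neg_one_pow_smul_smul _ _

/-- The cochain that represents the component at `p` involves only the two cocycles at the row and
the column of `p`, and both are zero here. -/
theorem differential_lof_of_ne {l : ℕ} (p : Pair n) (j : Fin n) (y : D.HH X l j)
    (h₁ : j ≠ p.1.1) (h₂ : j ≠ p.1.2) :
    D.differential X l (DirectSum.lof k (Fin n) (D.HH X l) j y) p = 0 := by
  obtain ⟨f, rfl⟩ := Submodule.Quotient.mk_surjective _ y
  have h := isExtClass_differential _ _ (lof_HH_apply f) p
  rw [Pi.single_eq_of_ne h₁.symm, Pi.single_eq_of_ne h₂.symm] at h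
  refine IsExtClass.eq_zero ?_
  refine h.congr fun q r h b m a => ?_
  rw [ZeroMemClass.coe_zero, ZeroMemClass.coe_zero, cupLeft_zero, cupRight_zero, smul_zero,
    add_zero]

end TriangularData

/-! ### Assembly of the isomorphisms, the cup product maps and the formula for `d₁`. -/

theorem mainTheorem7 {k : Type u} [Field k] {n : ℕ} (D : TriangularData k n)
    (X : Type u) [AddCommGroup X] [Module k X] [Module D.Alg X] [Module D.Algᵐᵒᵖ X]
    [SMulCommClass D.Alg D.Algᵐᵒᵖ X] [IsScalarTower k D.Alg X] [IsScalarTower k D.Algᵐᵒᵖ X]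
    (l : ℕ) :
    ∃ (Φ₀ : D.E₁ X 0 l ≃ₗ[k] ⨁ j, D.HH X l j)
      (Φ₁ : D.E₁ X 1 (l + 1) ≃ₗ[k] ⨁ p, D.Ext X l p)
      (cup₁ : ∀ p : TriangularData.Pair n, D.HH X l p.1.2 →ₗ[k] D.Ext X l p)
      (cup₂ : ∀ p : TriangularData.Pair n, D.HH X l p.1.1 →ₗ[k] D.Ext X l p),
      (∀ (c : FilteredComplex.cycles₁ (Hochschild.coboundary k D.Alg X) (D.filtration X) 0 l)
          (j : Fin n), ∃ h : TriangularData.restrictDiag c.1 j ∈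
            Hochschild.cocycles k (D.A j) (D.corner X j j) l,
          Φ₀ (FilteredComplex.E₁.mk _ _ c) j = Hochschild.HH.mk ⟨_, h⟩) ∧
      (∀ (c : FilteredComplex.cycles₁ (Hochschild.coboundary k D.Alg X) (D.filtration X) 1 (l + 1))
          (p : TriangularData.Pair n),
          BarResolution.IsExtClass (TriangularData.restrictOff c.1 p)
            (Φ₁ (FilteredComplex.E₁.mk _ _ c) p)) ∧
      (∀ (p : TriangularData.Pair n)
          (f : Hochschild.cocycles k (D.A p.1.2) (D.corner X p.1.2 p.1.2) l),
          BarResolution.IsExtClass (TriangularData.cupLeft p (𝟙 (D.modM p)) f.1)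
            (cup₁ p (Hochschild.HH.mk f))) ∧
      (∀ (p : TriangularData.Pair n)
          (f : Hochschild.cocycles k (D.A p.1.1) (D.corner X p.1.1 p.1.1) l),
          BarResolution.IsExtClass (TriangularData.cupRight p f.1 (𝟙 (D.modM p)))
            (cup₂ p (Hochschild.HH.mk f))) ∧
      ∀ f : ⨁ j, D.HH X l j,
        Φ₁ (D.d₁ X 0 l (Φ₀.symm f)) =
          ∑ j : Fin n,
            (∑ i : {i : Fin n // j < i}, DirectSum.lof k (TriangularData.Pair n) (D.Ext X l)
                ⟨(i, j), i.2⟩ (cup₁ ⟨(i, j), i.2⟩ (f j)) +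
              (-1 : k) ^ (l + 1) •
              ∑ i : {i : Fin n // i < j}, DirectSum.lof k (TriangularData.Pair n) (D.Ext X l)
                ⟨(j, i), i.2⟩ (cup₂ ⟨(j, i), i.2⟩ (f j))) := by
  refine ⟨D.diagEquiv X l, D.offEquiv X l, D.cupLeftMap X l, D.cupRightMap X l,
    ?_, ?_, ?_, ?_, ?_⟩
  · exact fun c j => ⟨TriangularData.restrictDiag_mem_cocycles c j, TriangularData.diagEquiv_mk c j⟩
  · intro c p
    rw [TriangularData.offEquiv_mk]
    exact TriangularData.isExtClass_offClass p c
  · exact TriangularData.isExtClass_cupLeftMap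
  · exact TriangularData.isExtClass_cupRightMap
  · intro f
    exact TriangularData.apply_eq_sum_lof (V := D.HH X l) (W := D.Ext X l) (D.differential X l)
      TriangularData.differential_lof_of_ne ((-1 : k) ^ (l + 1)) (by rw [← mul_pow]; simp) f
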